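/- Let $T>0$, $p\in(2,3)$, $d\in\mathbb N_0$, and let $\mathbf X=(X,\mathbb X^{(2)})$ be a continuous $p$-rough path on $[0,T]$ over $\mathbb R^d$: $X\colon[0,T]\to\mathbb R^d$ is continuous of finite $p$-variation, $\mathbb X^{(2)}\colon\Delta_T\to\mathbb R^{d\times d}$ is continuous of finite $p/2$-variation on $\Delta_T=\{0\le s\le t\le T\}$, and $\mathbb X^{(2)}_{s,t}=\mathbb X^{(2)}_{s,u}+\mathbb X^{(2)}_{u,t}+X_{s,u}\otimes X_{u,t}$ for $s\le u\le t$, where $X_{s,t}=X_t-X_s$. Let $[\mathbf X]_t=X_{0,t}\otimes X_{0,t}-(\mathbb X^{(2)}_{0,t}+(\mathbb X^{(2)}_{0,t})^\top)$ be its bracket, $Q(X)=([\mathbf X]^{ij})_{1\le i\le j\le d}$, $\hat d=1+d+\frac{d(d+1)}2$, and $\widehat X_t=(t,X_t,Q(X)_t)\in\mathbb R^{\hat d}$. Write $e_0,e_1,\dots,e_d,(\epsilon_{ij})_{1\le i\le j\le d}$ for the corresponding canonical basis of $\mathbb R^{\hat d}$, also numbered $e_0,\dots,e_{\hat d-1}$;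 set $\epsilon_{ji}=\epsilon_{ij}$, and $\epsilon_{ij}=0$ if $i,j\in\{0,\dots,\hat d-1\}$ are not both in $\{1,\dots,d\}$. For a multi-index $I=(i_1,\dots,i_n)$ with entries in $\{0,\dots,\hat d-1\}$ let $e_I=e_{i_1}\otimes\dots\otimes e_{i_n}$ and, if $n\ge1$, $I'=(i_1,\dots,i_{n-1})$. Let $\widehat{\mathbb X}^{(2)}$ be the canonical second level over $\widehat X$: $(\widehat{\mathbb X}^{(2)}_{s,t})^{ij}=(\mathbb X^{(2)}_{s,t})^{ij}$ for $i,j\in\{1,\dots,d\}$, and $(\widehat{\mathbb X}^{(2)}_{s,t})^{ij}=\int_s^t\widehat X^i_{s,r}\,\mathrm d\widehat X^j_r$ (Young integral, the limit of left-point Riemann sums) for all other $i,j$. These integrals exist, $\widehat{\mathbf X}=(\widehat X,\widehat{\mathbb X}^{(2)})$ is a $p$-rough path over $\mathbb R^{\hat d}$, and, with $[\widehat{\mathbf X}]$ its bracket, the corrected path $(\widehat X,\widehat{\mathbb X}^{(2)}+\frac12[\widehat{\mathbf X}])$ (second level $\widehat{\mathbb X}^{(2)}_{s,t}+\frac12([\widehat{\mathbf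 X}]_t-[\widehat{\mathbf X}]_s)$) is a weakly geometric $p$-rough path, i.e. $(1,\widehat X_{0,t},\widehat{\mathbb X}^{(2)}_{0,t}+\frac12[\widehat{\mathbf X}]_t)$ lies in the free step-2 nilpotent group $G^2(\mathbb R^{\hat d})$ for all $t$. A Lyons extension of a rough path $(Y,\mathbb Y^{(2)})$ is a continuous map $(s,t)\mapsto\mathbb Y_{s,t}\in T((\mathbb R^{\hat d}))=\prod_{n\ge0}(\mathbb R^{\hat d})^{\otimes n}$ on $\Delta_T$ whose components of level $0,1,2$ are $1$, $Y_{s,t}$, $\mathbb Y^{(2)}_{s,t}$, which satisfies $\mathbb Y_{s,t}=\mathbb Y_{s,u}\otimes\mathbb Y_{u,t}$ for $s\le u\le t$, and whose level $n$ has finite $p/n$-variation for every $n\ge1$; one writes $\mathbb Y_t=\mathbb Y_{0,t}$. Then $\widehat{\mathbf X}$ has a Lyons extension $\widehat{\mathbb X}$, and $(\widehat X,\widehat{\mathbb X}^{(2)}+\frac12[\widehat{\mathbf X}])$ has a Lyons extension $\widehat{\mathbb X}^o$; and for any such extensions, for all $t\in[0,T]$, $\widehat{\mathbb X}^o_t$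 is group-like, i.e. the tensor exponential of a Lie series, and for every multi-index $I$ with entries in $\{0,\dots,\hat d-1\}$ $$\langle e_I,\widehat{\mathbb X}_t\rangle=\langle\ell^I,\widehat{\mathbb X}^o_t\rangle ,$$ where $\ell^I\in T(\mathbb R^{\hat d})=\bigoplus_{n\ge0}(\mathbb R^{\hat d})^{\otimes n}$ is defined recursively by $\ell^\emptyset=e_\emptyset$, $\ell^{(i_1)}=e_{i_1}$ and, for $n=|I|\ge2$, $$\ell^I=\ell^{I'}\otimes e_{i_n}-\tfrac12\,\ell^{(I')'}\otimes\epsilon_{i_{n-1}i_n}.$$ -/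

import Mathlib

noncomputable section

/-! ### Tensor algebra and tensor series over `ℝ^ι`, in the basis of words -/

/-- The tensor algebra `T(ℝ^ι)`: finite real linear combinations of words in the letters `ι`.
The word `(i₁, …, iₙ)` stands for `e_{i₁} ⊗ ⋯ ⊗ e_{iₙ}`, and the product is `⊗`. -/
abbrev TensorPoly (ι : Type) : Type := MonoidAlgebra ℝ (FreeMonoid ι)

/-- The extended tensor algebra `T((ℝ^ι))`: an element is given by its coefficients `a_I`. -/
abbrev TensorSeries (ι : Type) : Type := List ι → ℝ

/-- The basis tensor `e_I`. -/
def basisTensor {ι : Type} (I : List ι) : TensorPoly ι :=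
  MonoidAlgebra.single (FreeMonoid.ofList I) 1

/-- The pairing `⟨ℓ, a⟩ = ∑_I ℓ_I a_I` of `T(ℝ^ι)` with `T((ℝ^ι))`. -/
def tensorPairing {ι : Type} (l : TensorPoly ι) (a : TensorSeries ι) : ℝ :=
  Finsupp.sum l.coeff fun w c => c * a w.toList

/-- The product `a ⊗ b` in `T((ℝ^ι))`. -/
def TensorSeries.tmul {ι : Type} (a b : TensorSeries ι) : TensorSeries ι := fun w =>
  ∑ k ∈ Finset.range (w.length + 1), a (w.take k) * b (w.drop k)

/-- The unit `(1, 0, 0, …)` of `T((ℝ^ι))`. -/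
def TensorSeries.unit {ι : Type} : TensorSeries ι
  | [] => 1
  | _ :: _ => 0

/-- The powers `a^{⊗ k}`. -/
def TensorSeries.tpow {ι : Type} (a : TensorSeries ι) : ℕ → TensorSeries ι
  | 0 => TensorSeries.unit
  | k + 1 => TensorSeries.tmul (TensorSeries.tpow a k) a

/-- The tensor exponential `∑_k a^{⊗ k} / k!` of a series `a` without constant term; then
`a^{⊗ k}` has no component of level `< k`, so the sum is finite at every word. -/
def TensorSeries.texp {ι : Type} (a : TensorSeries ι) : TensorSeries ι := fun w =>
  ∑ k ∈ Finset.range (w.length + 1), ((k.factorial : ℝ))⁻¹ * TensorSeries.tpow a k w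

/-- The component of level `n` of a series, as an element of the tensor algebra. -/
def TensorSeries.level {ι : Type} [Fintype ι] (a : TensorSeries ι) (n : ℕ) : TensorPoly ι :=
  ∑ v : Fin n → ι, a (List.ofFn v) • basisTensor (List.ofFn v)

attribute [local instance] LieRing.ofAssociativeRing

/-- Lie series: every homogeneous component lies in the Lie algebra generated by the letters
(with the commutator bracket of the tensor algebra). In particular the constant term is `0`. -/
def TensorSeries.IsLie {ι : Type} [Fintype ι] (a : TensorSeries ι) : Prop :=
  ∀ n : ℕ, TensorSeries.level a n ∈
    LieSubalgebra.lieSpan ℝ (TensorPoly ι) (Set.range fun i : ι => basisTensor [i])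

/-- The group-like elements `G((ℝ^ι))`: exponentials of Lie series. -/
def TensorSeries.IsGroupLike {ι : Type} [Fintype ι] (g : TensorSeries ι) : Prop :=
  ∃ a : TensorSeries ι, TensorSeries.IsLie a ∧ g = TensorSeries.texp a

/-! ### Partitions, variation, Young integrals -/

/-- The simplex `Δ_T`. -/
def timeSimplex (T : ℝ) : Set (ℝ × ℝ) := {q | 0 ≤ q.1 ∧ q.1 ≤ q.2 ∧ q.2 ≤ T}

/-- `s = u 0 < u 1 < ⋯ < u n = t`. -/
def IsPartitionOf (s t : ℝ) (n : ℕ) (u : ℕ → ℝ) : Prop :=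
  u 0 = s ∧ u n = t ∧ ∀ k < n, u k < u (k + 1)

/-- The Euclidean norm of a finite family of real numbers. -/
def euclNorm {κ : Type} [Fintype κ] (x : κ → ℝ) : ℝ := ‖WithLp.toLp 2 x‖

/-- A two-parameter function has finite `r`-variation on `[0,T]`. -/
def HasFiniteVar {κ : Type} [Fintype κ] (r T : ℝ) (F : ℝ → ℝ → κ → ℝ) : Prop :=
  ∃ C : ℝ, ∀ (n : ℕ) (u : ℕ → ℝ), IsPartitionOf 0 T n u →
    ∑ k ∈ Finset.range n, euclNorm (F (u k) (u (k + 1))) ^ r ≤ C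

/-- `∫_s^t f dg` exists and equals `J`, as the limit of the left-point Riemann sums along
partitions of `[s,t]` with vanishing mesh. -/
def HasYoungIntegral (f g : ℝ → ℝ) (s t J : ℝ) : Prop :=
  ∀ ε > 0, ∃ δ > 0, ∀ (n : ℕ) (u : ℕ → ℝ), IsPartitionOf s t n u →
    (∀ k < n, u (k + 1) - u k < δ) →
    |∑ k ∈ Finset.range n, f (u k) * (g (u (k + 1)) - g (u k)) - J| < ε

/-! ### Rough paths and Lyons' extension -/

/-- `(X, X2)` is a continuous rough path on `[0,T]` over `ℝ^ι`, of finite `p`-variation. -/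
structure IsRoughPath {ι : Type} [Fintype ι] (p T : ℝ) (X : ℝ → ι → ℝ)
    (X2 : ℝ → ℝ → Matrix ι ι ℝ) : Prop where
  continuousOn_path : ContinuousOn X (Set.Icc 0 T)
  var_path : HasFiniteVar p T fun s t => X t - X s
  continuousOn_lift : ContinuousOn (fun q : ℝ × ℝ => X2 q.1 q.2) (timeSimplex T)
  var_lift : HasFiniteVar (p / 2) T fun s t (q : ι × ι) => X2 s t q.1 q.2
  chen : ∀ s u t : ℝ, 0 ≤ s → s ≤ u → u ≤ t → t ≤ T → ∀ i j : ι,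
    X2 s t i j = X2 s u i j + X2 u t i j + (X u i - X s i) * (X t j - X u j)

/-- `(X, X2)` is a weakly geometric rough path: `(1, X_{0,t}, X2_{0,t})` is the truncation to
level two of a group-like element, for all `t`. -/
structure IsWeaklyGeometric {ι : Type} [Fintype ι] (p T : ℝ) (X : ℝ → ι → ℝ)
    (X2 : ℝ → ℝ → Matrix ι ι ℝ) : Prop extends IsRoughPath p T X X2 where
  mem_group : ∀ t ∈ Set.Icc 0 T, ∃ g : TensorSeries ι, TensorSeries.IsGroupLike g ∧
    (∀ i, g [i] = X t i - X 0 i) ∧ ∀ i j, g [i, j] = X2 0 t i j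

/-- `S` is Lyons' extension of `(1, X, X2)`: a continuous multiplicative functional with values
in `T((ℝ^ι))`, of finite `p`-variation at all levels, which extends `(1, X, X2)`. -/
structure IsLyonsExtension {ι : Type} [Fintype ι] (p T : ℝ) (X : ℝ → ι → ℝ)
    (X2 : ℝ → ℝ → Matrix ι ι ℝ) (S : ℝ → ℝ → TensorSeries ι) : Prop where
  level_zero : ∀ s t : ℝ, 0 ≤ s → s ≤ t → t ≤ T → S s t [] = 1
  level_one : ∀ s t : ℝ, 0 ≤ s → s ≤ t → t ≤ T → ∀ i, S s t [i] = X t i - X s i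
  level_two : ∀ s t : ℝ, 0 ≤ s → s ≤ t → t ≤ T → ∀ i j, S s t [i, j] = X2 s t i j
  chen : ∀ s u t : ℝ, 0 ≤ s → s ≤ u → u ≤ t → t ≤ T →
    S s t = TensorSeries.tmul (S s u) (S u t)
  continuousOn : ∀ I : List ι, ContinuousOn (fun q : ℝ × ℝ => S q.1 q.2 I) (timeSimplex T)
  var : ∀ n : ℕ, 1 ≤ n →
    HasFiniteVar (p / n) T fun s t (v : Fin n → ι) => S s t (List.ofFn v)

/-- The rough path bracket `[𝐗]_t = X_{0,t} ⊗ X_{0,t} - (X2_{0,t} + X2_{0,t}ᵀ)`. -/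
def roughBracket {ι : Type} (X : ℝ → ι → ℝ) (X2 : ℝ → ℝ → Matrix ι ι ℝ) (t : ℝ) :
    Matrix ι ι ℝ :=
  Matrix.vecMulVec (X t - X 0) (X t - X 0) - (X2 0 t + (X2 0 t).transpose)

/-- The second level `X2 + ½ [𝐗]`, as a two-parameter function: `X2_{s,t} + ½ [𝐗]_{s,t}`. -/
def correctedLift {ι : Type} (X : ℝ → ι → ℝ) (X2 : ℝ → ℝ → Matrix ι ι ℝ) (s t : ℝ) :
    Matrix ι ι ℝ :=
  X2 s t + (1 / 2 : ℝ) • (roughBracket X X2 t - roughBracket X X2 s)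

/-! ### The extension by time and bracket -/

/-- The `1 + d + d (d + 1) / 2` coordinates of the extended path: time, the coordinates of the
path, and the bracket terms `[𝐗]^{ij}`, `i ≤ j`. -/
inductive ExtIndex (d : ℕ) : Type
  | time : ExtIndex d
  | path (i : Fin d) : ExtIndex d
  | bracket (q : {q : Fin d × Fin d // q.1 ≤ q.2}) : ExtIndex d
  deriving DecidableEq, Fintype

/-- The extended path `X̂ = (·, X, Q(X))`. -/
def extPath {d : ℕ} (X : ℝ → Fin d → ℝ) (X2 : ℝ → ℝ → Matrix (Fin d) (Fin d) ℝ) (t : ℝ) :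
    ExtIndex d → ℝ
  | .time => t
  | .path i => X t i
  | .bracket q => roughBracket X X2 t q.1.1 q.1.2

/-- `Y2` is the canonical second level over `X̂`: it is `X2` on pairs of coordinates of the path,
and it is given by Young integrals on all other pairs. -/
structure IsCanonicalLift {d : ℕ} (T : ℝ) (X : ℝ → Fin d → ℝ)
    (X2 : ℝ → ℝ → Matrix (Fin d) (Fin d) ℝ)
    (Y2 : ℝ → ℝ → Matrix (ExtIndex d) (ExtIndex d) ℝ) : Prop where
  path_path : ∀ s t : ℝ, 0 ≤ s → s ≤ t → t ≤ T → ∀ i j : Fin d,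
    Y2 s t (.path i) (.path j) = X2 s t i j
  young : ∀ s t : ℝ, 0 ≤ s → s ≤ t → t ≤ T → ∀ a b : ExtIndex d,
    ¬ ((∃ i, a = .path i) ∧ ∃ j, b = .path j) →
    HasYoungIntegral (fun r => extPath X X2 r a - extPath X X2 s a)
      (fun r => extPath X X2 r b) s t (Y2 s t a b)

/-- `ε_{ab}`: the basis vector of the coordinate `[𝐗]^{ij} = [𝐗]^{ji}` when `a, b` are the
coordinates `i, j` of the path, and `0` otherwise. -/
def epsTensor {d : ℕ} : ExtIndex d → ExtIndex d → TensorPoly (ExtIndex d)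
  | .path i, .path j => basisTensor [.bracket ⟨(min i j, max i j), min_le_max⟩]
  | _, _ => 0

/-- `ℓ^I` as a function of the reversed word, so that the recursion removes the last letters. -/
def ellReverse {d : ℕ} : List (ExtIndex d) → TensorPoly (ExtIndex d)
  | [] => 1
  | [a] => basisTensor [a]
  | b :: a :: J =>
      ellReverse (a :: J) * basisTensor [b] - (1 / 2 : ℝ) • (ellReverse J * epsTensor a b)

/-- The coefficients `ℓ^I`. -/
def ellCoeff {d : ℕ} (I : List (ExtIndex d)) : TensorPoly (ExtIndex d) := ellReverse I.reverse

theorem ellCoeff_nil {d : ℕ} : ellCoeff ([] : List (ExtIndex d)) = basisTensor [] := rfl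

theorem ellCoeff_singleton {d : ℕ} (a : ExtIndex d) : ellCoeff [a] = basisTensor [a] := rfl

/-- The recursion `ℓ^I = ℓ^{I'} ⊗ e_{i_n} - ½ ℓ^{(I')'} ⊗ ε_{i_{n-1} i_n}`. -/
theorem ellCoeff_append {d : ℕ} (J : List (ExtIndex d)) (a b : ExtIndex d) :
    ellCoeff (J ++ [a, b]) =
      ellCoeff (J ++ [a]) * basisTensor [b] - (1 / 2 : ℝ) • (ellCoeff J * epsTensor a b) := by
  simp [ellCoeff, ellReverse]

end

/-! The transpose of `e_I ↦ ℓ^I`, called `ellTranspose`, is multiplicative for the tensor product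
(`ellTranspose_tmul`). It therefore turns the extension `So` of the corrected path into another
functional satisfying Chen's identity. On level two the term `-½ ε` removes exactly the correction
`½ [X̂]`, so this functional agrees with `S` through level two.

At level `n ≥ 3`, agreement on the lower levels makes the difference of the two functionals additive
in time. An additive function dominated by a power larger than one of a continuous control is zero
(`Controlled.eq_zero`), so only a bound is missing. For `S` it is part of the definition of the
extension. For the transform, `ℓ^I` may contain words shorter than `I`; but a bracket letter
replaces two path letters and has twice their regularity. Counting it twice, every word of `ℓ^I` has
weight at least `|I|` (`ellCoeff_mem_weightSpan`). A word of length two occurring there thus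
contains a letter other than a path coordinate, and its coefficient is a Young integral of order
`3/p > 1`.

That `So 0 t` is group-like rests on the same uniqueness principle. The corrected second level has
symmetric part `½ X̂ ⊗ X̂`, which is the shuffle relation for two letters; the defects of the longer
shuffle relations are additive and small, hence zero (`IsLyonsExtension.isShuffleCharacter`). If
`exp a` is a character of the shuffle algebra, so is `exp (m a)` for every natural `m`; comparing
coefficients of `m` shows that `a` vanishes on shuffles of non-empty words (`shuffleEval_log`).
Dynkin's operator then multiplies level `n` of `a` by `n`, so `a` is a Lie series
(`isLie_of_shuffle`).

For existence, finite variation and continuity are first converted into a continuous control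
(`exists_control`). Sewing (`exists_sewing`) then produces both the Young integrals and, one level
at a time, the Lyons extensions (`IsMultUpTo.exists_succ`). -/

open Filter Topology TensorSeries

/-! ### Partition sums and controls -/

/-- `PartSum N s t x`: `x` is the sum of `N` over the consecutive points of a partition of
`[s,t]`. -/
inductive PartSum (N : ℝ → ℝ → ℝ) (s : ℝ) : ℝ → ℝ → Prop
  | refl : PartSum N s s 0
  | snoc {u t x : ℝ} : PartSum N s u x → u < t → PartSum N s t (x + N u t)

namespace PartSum

variable {N : ℝ → ℝ → ℝ} {s t u x y T : ℝ}

theorem le (h : PartSum N s t x) : s ≤ t := by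
  induction h with
  | refl => exact le_rfl
  | snoc _ hut ih => exact ih.trans hut.le

theorem single (h : s < t) : PartSum N s t (N s t) := by
  simpa using PartSum.snoc (N := N) PartSum.refl h

theorem trans (h : PartSum N s u x) (h' : PartSum N u t y) : PartSum N s t (x + y) := by
  induction h' with
  | refl => simpa using h
  | snoc _ hut ih => rw [← add_assoc]; exact ih.snoc hut

theorem exists_partition (h : PartSum N s t x) :
    ∃ n u, IsPartitionOf s t n u ∧ ∑ k ∈ Finset.range n, N (u k) (u (k + 1)) = x := by
  induction h with
  | refl => exact ⟨0, fun _ => s, ⟨rfl, rfl, by simp⟩, by simp⟩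
  | @snoc v t x _ hut ih =>
    obtain ⟨n, u, ⟨h0, hn, hlt⟩, hsum⟩ := ih
    refine ⟨n + 1, fun k => if k ≤ n then u k else t, ⟨by simp [h0], by simp, ?_⟩, ?_⟩
    · intro k hk
      rcases Nat.lt_succ_iff_lt_or_eq.1 hk with hk | rfl
      · simpa [hk.le, Nat.succ_le_iff.2 hk] using hlt k hk
      · simpa [hn] using hut
    · rw [Finset.sum_range_succ, ← hsum]
      congr 1
      · refine Finset.sum_congr rfl fun k hk => ?_
        have hk := Finset.mem_range.1 hk
        simp [hk.le, Nat.succ_le_iff.2 hk]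
      · simp [hn]

/-- Only the first interval of the partition is touched: `N` is continuous in its left endpoint, so
that endpoint can move slightly to the right at a cost below `η`. -/
theorem exists_shift (hN : ContinuousOn (fun q : ℝ × ℝ => N q.1 q.2) (timeSimplex T))
    (hs : 0 ≤ s) (h : PartSum N s t x) (hst : s < t) (ht : t ≤ T) {η : ℝ} (hη : 0 < η) :
    ∃ s' y, s < s' ∧ s' < t ∧ PartSum N s' t y ∧ x - η < y := by
  induction h with
  | refl => exact absurd hst (lt_irrefl _)
  | @snoc v t x hv hvt ih =>
    rcases hv.le.eq_or_lt with rfl | hsv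
    · have hc : ContinuousWithinAt (fun r => N r t) (Set.Icc 0 t) s :=
        ContinuousWithinAt.comp (f := fun r : ℝ => (r, t)) (t := timeSimplex T)
          (hN (s, t) ⟨hs, hst.le, ht⟩) (by fun_prop) (fun r hr => ⟨hr.1, hr.2, ht⟩)
      have hx : x = 0 := by
        cases hv with
        | refl => rfl
        | snoc h1 h2 => exact absurd h1.le (not_le.2 h2)
      have h1 : ∀ᶠ r in 𝓝[Set.Icc 0 t] s, N s t - η < N r t :=
        hc.eventually (lt_mem_nhds (by linarith))
      have h2 : 𝓝[>] s ≤ 𝓝[Set.Icc 0 t] s := by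
        refine nhdsWithin_le_of_mem ?_
        refine mem_of_superset (Ioo_mem_nhdsGT hst) fun r hr => ⟨hs.trans hr.1.le, hr.2.le⟩
      obtain ⟨r, hr, hr'⟩ := ((h1.filter_mono h2).and (Ioo_mem_nhdsGT hst)).exists
      exact ⟨r, N r t, hr'.1, hr'.2, single hr'.2, by rw [hx, zero_add]; exact hr⟩
    · obtain ⟨s', y, h1, h2, h3, h4⟩ := ih hsv (hvt.le.trans ht)
      exact ⟨s', y + N v t, h1, h2.trans hvt, h3.snoc hvt, by linarith⟩

/-- At most one interval of the partition straddles `t₀`. Cutting it there costs `ε`, and the piece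
to the right of `t₀` may be added because `N` is nonnegative on it. No superadditivity of `N` is
needed. -/
theorem exists_split (h : PartSum N 0 t x) {t₀ ε : ℝ} (h0 : 0 ≤ t₀) (ht₀ : t₀ ≤ t) (hε : 0 ≤ ε)
    (hNn : ∀ v, t₀ ≤ v → v ≤ t → 0 ≤ N t₀ v)
    (hN : ∀ u v, 0 ≤ u → u ≤ t₀ → t₀ ≤ v → v ≤ t → N u v ≤ N u t₀ + ε) :
    ∃ y z, PartSum N 0 t₀ y ∧ PartSum N t₀ t z ∧ x ≤ y + z + ε := by
  induction h with
  | refl =>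
    obtain rfl : t₀ = 0 := le_antisymm ht₀ h0
    exact ⟨0, 0, .refl, .refl, by linarith⟩
  | @snoc v t x hv hvt ih =>
    rcases lt_or_ge v t₀ with hlt | hge
    · rcases ht₀.eq_or_lt with rfl | hlt'
      · exact ⟨_, 0, hv.snoc hlt, .refl, by linarith⟩
      · refine ⟨_, _, hv.snoc hlt, single hlt', ?_⟩
        have := hN v t hv.le hlt.le ht₀ le_rfl
        have := hNn t ht₀ le_rfl
        linarith
    · obtain ⟨y, z, hy, hz, hx⟩ := ih hge (fun w h1 h2 => hNn w h1 (h2.trans hvt.le))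
        (fun a b h1 h2 h3 h4 => hN a b h1 h2 h3 (h4.trans hvt.le))
      exact ⟨y, _, hy, hz.snoc hvt, by linarith⟩

end PartSum

theorem isCompact_timeSimplex (T : ℝ) : IsCompact (timeSimplex T) := by
  refine IsCompact.of_isClosed_subset (isCompact_Icc (a := ((0 : ℝ), (0 : ℝ))) (b := (T, T))) ?_ ?_
  · refine (isClosed_le continuous_const continuous_fst).inter
      ((isClosed_le continuous_fst continuous_snd).inter
        (isClosed_le continuous_snd continuous_const))
  · rintro ⟨a, b⟩ ⟨h1, h2, h3⟩
    exact ⟨⟨h1, h1.trans h2⟩, ⟨h2.trans h3, h3⟩⟩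

/-- A primitive of a continuous additive control on `[0,T]`. -/
structure IsControl (T : ℝ) (h : ℝ → ℝ) : Prop where
  mono : MonotoneOn h (Set.Icc 0 T)
  cont : ContinuousOn h (Set.Icc 0 T)

theorem IsControl.sub_nonneg {T : ℝ} {h : ℝ → ℝ} (hh : IsControl T h) {s t : ℝ} (hs : 0 ≤ s)
    (hst : s ≤ t) (ht : t ≤ T) : 0 ≤ h t - h s :=
  _root_.sub_nonneg.2 (hh.mono ⟨hs, hst.trans ht⟩ ⟨hs.trans hst, ht⟩ hst)

/-- Small intervals have small partition sums. -/
theorem exists_partSum_small {T : ℝ} {N : ℝ → ℝ → ℝ}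
    (hN : ContinuousOn (fun q : ℝ × ℝ => N q.1 q.2) (timeSimplex T))
    (hN0 : ∀ s t, 0 ≤ s → s ≤ t → t ≤ T → 0 ≤ N s t) {C : ℝ}
    (hC : ∀ s x, 0 ≤ s → PartSum N s T x → x ≤ C) {t₀ ε : ℝ} (ht₀ : 0 ≤ t₀) (hε : 0 < ε) :
    ∃ δ > 0, ∀ t x, t < t₀ + δ → t ≤ T → PartSum N t₀ t x → x ≤ ε := by
  by_contra! hcon
  rcases lt_or_ge t₀ T with htT | htT
  swap
  · obtain ⟨t, x, -, h2, h3, h4⟩ := hcon 1 one_pos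
    cases h3 with
    | refl => linarith
    | snoc h5 h6 => linarith [h5.le]
  -- If the claim fails, sums larger than `ε` exist arbitrarily close to the right of `t₀`.
  -- Detaching each from `t₀` by `exists_shift` costs `ε / 2` and leaves room for the next one
  -- closer to `t₀`; `k` disjoint blocks then contradict the bound `C`.
  have key : ∀ k : ℕ, ∃ t x, t₀ < t ∧ t ≤ T ∧ PartSum N t T x ∧ k * (ε / 2) ≤ x := by
    intro k
    induction k with
    | zero => exact ⟨T, 0, htT, le_rfl, .refl, by simp⟩
    | succ k ih =>
      obtain ⟨t, x, h1, h2, h3, h4⟩ := ih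
      obtain ⟨t', x', h1', h2', h3', h4'⟩ := hcon (t - t₀) (by linarith)
      have hlt : t₀ < t' := by
        rcases h3'.le.eq_or_lt with rfl | hlt
        · cases h3' with
          | refl => linarith
          | snoc h5 h6 => linarith [h5.le]
        · exact hlt
      obtain ⟨s', y, g1, g2, g3, g4⟩ :=
        h3'.exists_shift hN ht₀ hlt h2' (half_pos hε)
      have ht : t' < t := by linarith
      refine ⟨s', _, g1, g2.le.trans h2', (g3.snoc ht).trans h3, ?_⟩
      have := hN0 t' t (by linarith) ht.le h2
      push_cast
      linarith
  obtain ⟨k, hk⟩ := exists_nat_gt (C / (ε / 2))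
  obtain ⟨t, x, h1, h2, h3, h4⟩ := key k
  rw [div_lt_iff₀ (by linarith)] at hk
  linarith [hC t x (by linarith) h3]

/-- The control is the supremum of the partition sums of `N` over `[0, t]`; appending an interval to
a partition gives the estimate. Continuity from the left comes from moving the last point of a
nearly optimal partition, and continuity from the right from `exists_partSum_small`. -/
theorem exists_control {T : ℝ} (hT : 0 ≤ T) {N : ℝ → ℝ → ℝ}
    (hN : ContinuousOn (fun q : ℝ × ℝ => N q.1 q.2) (timeSimplex T))
    (hN0 : ∀ s t, 0 ≤ s → s ≤ t → t ≤ T → 0 ≤ N s t)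
    (hNd : ∀ s, 0 ≤ s → s ≤ T → N s s = 0) {C : ℝ}
    (hC : ∀ (n : ℕ) (u : ℕ → ℝ), IsPartitionOf 0 T n u →
      ∑ k ∈ Finset.range n, N (u k) (u (k + 1)) ≤ C) :
    ∃ h, IsControl T h ∧ ∀ s t, 0 ≤ s → s ≤ t → t ≤ T → N s t ≤ h t - h s := by
  have hC0 : ∀ x, PartSum N 0 T x → x ≤ C := fun x hx => by
    obtain ⟨n, u, hu, rfl⟩ := hx.exists_partition
    exact hC n u hu
  have hCs : ∀ s x, 0 ≤ s → PartSum N s T x → x ≤ C := fun s x hs hx => by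
    rcases hs.eq_or_lt with rfl | hs'
    · exact hC0 x hx
    · have := hC0 _ ((PartSum.single hs').trans hx)
      linarith [hN0 0 s le_rfl hs hx.le]
  have hCt : ∀ t x, t ≤ T → PartSum N 0 t x → x ≤ C := fun t x ht hx => by
    rcases ht.eq_or_lt with rfl | ht'
    · exact hC0 x hx
    · have := hC0 _ (hx.snoc ht')
      linarith [hN0 t T hx.le ht le_rfl]
  set h : ℝ → ℝ := fun t => sSup {x | PartSum N 0 t x} with hh
  have hbdd : ∀ t, t ≤ T → BddAbove {x | PartSum N 0 t x} := fun t ht => ⟨C, fun x hx => hCt t x ht hx⟩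
  have hne : ∀ t, 0 ≤ t → {x | PartSum N 0 t x}.Nonempty := fun t ht => by
    rcases ht.eq_or_lt with rfl | ht'
    · exact ⟨0, .refl⟩
    · exact ⟨_, .single ht'⟩
  have hle : ∀ t x, t ≤ T → PartSum N 0 t x → x ≤ h t := fun t x ht hx => le_csSup (hbdd t ht) hx
  have hinc : ∀ s t, 0 ≤ s → s ≤ t → t ≤ T → N s t ≤ h t - h s := by
    intro s t hs hst ht
    rcases hst.eq_or_lt with rfl | hlt
    · simp [hNd s hs ht]
    · rw [le_sub_iff_add_le, ← le_sub_iff_add_le']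
      refine csSup_le (hne s hs) fun x hx => ?_
      linarith [hle t _ ht (hx.snoc hlt)]
  have hmono : MonotoneOn h (Set.Icc 0 T) := fun s hs t ht hst => by
    linarith [hinc s t hs.1 hst ht.2, hN0 s t hs.1 hst ht.2]
  refine ⟨h, ⟨hmono, ?_⟩, hinc⟩
  intro t₀ ht₀
  rw [Metric.continuousWithinAt_iff]
  intro ε hε
  -- lower bound to the left
  have hleft : ∃ δ > 0, ∀ t, 0 ≤ t → t ≤ t₀ → t₀ - δ < t → h t₀ - ε < h t := by
    obtain ⟨x, hx, hxε⟩ := exists_lt_of_lt_csSup (hne t₀ ht₀.1) (show h t₀ - ε / 2 < h t₀ by linarith)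
    cases hx with
    | refl =>
      refine ⟨1, one_pos, fun t h1 h2 _ => ?_⟩
      obtain rfl : t = 0 := le_antisymm h2 h1
      linarith
    | @snoc u _ x hu hut =>
      have hc : ContinuousWithinAt (fun r => N u r) (Set.Icc u T) t₀ :=
        ContinuousWithinAt.comp (f := fun r : ℝ => (u, r)) (t := timeSimplex T)
          (hN (u, t₀) ⟨hu.le, hut.le, ht₀.2⟩) (by fun_prop) (fun r hr => ⟨hu.le, hr.1, hr.2⟩)
      obtain ⟨δ, hδ, hd⟩ := Metric.continuousWithinAt_iff.1 hc (ε / 2) (by linarith)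
      refine ⟨min δ (t₀ - u), by simp [hδ, hut], fun t h1 h2 h3 => ?_⟩
      have hut' : u < t := by linarith [min_le_right δ (t₀ - u)]
      have h4 := hd (x := t) ⟨hut'.le, h2.trans ht₀.2⟩ (by
        rw [Real.dist_eq, abs_lt]; constructor <;> linarith [min_le_left δ (t₀ - u)])
      rw [Real.dist_eq, abs_lt] at h4
      linarith [hle t _ (h2.trans ht₀.2) (hu.snoc hut')]
  -- A partition of `[0, t]` is split at `t₀`. One `ε / 4` pays for the straddling interval, by
  -- uniform continuity of `N`, and the other for the partition sum over the short interval `[t₀,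
  -- t]`.
  have hright : ∃ δ > 0, ∀ t, t₀ ≤ t → t ≤ T → t < t₀ + δ → h t < h t₀ + ε := by
    obtain ⟨δ₁, hδ₁, hd₁⟩ := exists_partSum_small hN hN0 hCs ht₀.1 (show 0 < ε / 4 by linarith)
    have huc := (isCompact_timeSimplex T).uniformContinuousOn_of_continuous hN
    obtain ⟨δ₂, hδ₂, hd₂⟩ := Metric.uniformContinuousOn_iff.1 huc (ε / 4) (by linarith)
    refine ⟨min δ₁ δ₂, lt_min hδ₁ hδ₂, fun t h1 h2 h3 => ?_⟩
    have : h t ≤ h t₀ + ε / 2 := by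
      refine csSup_le (hne t (ht₀.1.trans h1)) fun x hx => ?_
      obtain ⟨y, z, hy, hz, hxyz⟩ := PartSum.exists_split hx ht₀.1 h1 (show 0 ≤ ε / 4 by linarith)
        (fun v g1 g2 => hN0 _ _ ht₀.1 g1 (g2.trans h2)) (fun u v g1 g2 g3 g4 => by
          have := hd₂ (u, v) ⟨g1, g2.trans g3, g4.trans h2⟩ (u, t₀) ⟨g1, g2, ht₀.2⟩ (by
            rw [Prod.dist_eq]
            simp only [dist_self, Real.dist_eq]
            rw [abs_of_nonneg (by linarith)]
            refine max_lt hδ₂ ?_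
            linarith [min_le_right δ₁ δ₂])
          rw [Real.dist_eq, abs_lt] at this
          simp only at this
          linarith)
      have := hd₁ t z (by linarith [min_le_left δ₁ δ₂]) h2 hz
      linarith [hle t₀ y ht₀.2 hy]
    linarith
  obtain ⟨δ₁, hδ₁, hl⟩ := hleft
  obtain ⟨δ₂, hδ₂, hr⟩ := hright
  refine ⟨min δ₁ δ₂, lt_min hδ₁ hδ₂, fun t ht hd => ?_⟩
  rw [Real.dist_eq, abs_lt] at hd ⊢
  rcases le_total t t₀ with h1 | h1
  · have := hl t ht.1 h1 (by linarith [min_le_left δ₁ δ₂])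
    have := hmono ht ht₀ h1
    constructor <;> linarith
  · have := hr t h1 ht.2 (by linarith [min_le_right δ₁ δ₂])
    have := hmono ht₀ ht h1
    constructor <;> linarith

/-! ### Functions dominated by a power of a control -/

/-- `|F s t| ≤ C (h t - h s) ^ θ` on the simplex. -/
def Controlled (T : ℝ) (h : ℝ → ℝ) (θ : ℝ) (F : ℝ → ℝ → ℝ) : Prop :=
  ∃ C, 0 ≤ C ∧ ∀ s t, 0 ≤ s → s ≤ t → t ≤ T → |F s t| ≤ C * (h t - h s) ^ θ

namespace Controlled

variable {T θ θ' : ℝ} {h h' : ℝ → ℝ} {F G : ℝ → ℝ → ℝ}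

theorem congr (hF : Controlled T h θ F)
    (hFG : ∀ s t, 0 ≤ s → s ≤ t → t ≤ T → G s t = F s t) : Controlled T h θ G := by
  obtain ⟨C, hC, hb⟩ := hF
  exact ⟨C, hC, fun s t hs hst ht => by rw [hFG s t hs hst ht]; exact hb s t hs hst ht⟩

theorem zero : Controlled T h θ fun _ _ => 0 :=
  ⟨0, le_rfl, fun s t _ _ _ => by simp⟩

theorem add (hF : Controlled T h θ F) (hG : Controlled T h θ G) :
    Controlled T h θ fun s t => F s t + G s t := by
  obtain ⟨C, hC, hb⟩ := hF
  obtain ⟨D, hD, hd⟩ := hG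
  refine ⟨C + D, add_nonneg hC hD, fun s t hs hst ht => (abs_add_le _ _).trans ?_⟩
  rw [add_mul]
  exact add_le_add (hb s t hs hst ht) (hd s t hs hst ht)

theorem const_mul (c : ℝ) (hF : Controlled T h θ F) : Controlled T h θ fun s t => c * F s t := by
  obtain ⟨C, hC, hb⟩ := hF
  refine ⟨|c| * C, by positivity, fun s t hs hst ht => ?_⟩
  rw [abs_mul, mul_assoc]
  exact mul_le_mul_of_nonneg_left (hb s t hs hst ht) (abs_nonneg c)

theorem neg (hF : Controlled T h θ F) : Controlled T h θ fun s t => -F s t :=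
  (hF.const_mul (-1)).congr fun _ _ _ _ _ => by ring

theorem sub (hF : Controlled T h θ F) (hG : Controlled T h θ G) :
    Controlled T h θ fun s t => F s t - G s t :=
  (hF.add hG.neg).congr fun _ _ _ _ _ => by ring

theorem mul (hh : IsControl T h) (h1 : 0 ≤ θ) (h2 : 0 ≤ θ') (hF : Controlled T h θ F)
    (hG : Controlled T h θ' G) : Controlled T h (θ + θ') fun s t => F s t * G s t := by
  obtain ⟨C, hC, hb⟩ := hF
  obtain ⟨D, hD, hd⟩ := hG
  refine ⟨C * D, mul_nonneg hC hD, fun s t hs hst ht => ?_⟩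
  have h0 := hh.sub_nonneg hs hst ht
  rw [abs_mul, Real.rpow_add_of_nonneg h0 h1 h2, mul_mul_mul_comm]
  exact mul_le_mul (hb s t hs hst ht) (hd s t hs hst ht) (abs_nonneg _) (by positivity)

theorem sum {κ : Type*} {F : κ → ℝ → ℝ → ℝ} (A : Finset κ)
    (hF : ∀ k ∈ A, Controlled T h θ (F k)) :
    Controlled T h θ fun s t => ∑ k ∈ A, F k s t := by
  classical
  induction A using Finset.induction_on with
  | empty => simpa using zero
  | insert a A ha ih =>
    simp only [Finset.sum_insert ha]
    exact (hF a (by simp)).add (ih fun k hk => hF k (by simp [hk]))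

theorem mono_exponent (hh : IsControl T h) (h1 : 0 < θ') (h2 : θ' ≤ θ)
    (hF : Controlled T h θ F) : Controlled T h θ' F := by
  obtain ⟨C, hC, hb⟩ := hF
  refine ⟨C * |h T - h 0| ^ (θ - θ'), by positivity, fun s t hs hst ht => ?_⟩
  have h0 := hh.sub_nonneg hs hst ht
  refine (hb s t hs hst ht).trans ?_
  have : (h t - h s) ^ θ = (h t - h s) ^ (θ - θ') * (h t - h s) ^ θ' := by
    rw [← Real.rpow_add_of_nonneg h0 (by linarith) h1.le]; ring_nf
  rw [this, ← mul_assoc]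
  have hle : h t - h s ≤ |h T - h 0| := by
    refine le_trans ?_ (le_abs_self _)
    have := hh.sub_nonneg le_rfl hs (hst.trans ht)
    have := hh.sub_nonneg (hs.trans hst) ht le_rfl
    linarith
  gcongr

theorem mono_control (hh : IsControl T h) (h1 : 0 ≤ θ)
    (hle : ∀ s t, 0 ≤ s → s ≤ t → t ≤ T → h t - h s ≤ h' t - h' s)
    (hF : Controlled T h θ F) : Controlled T h' θ F := by
  obtain ⟨C, hC, hb⟩ := hF
  refine ⟨C, hC, fun s t hs hst ht => (hb s t hs hst ht).trans ?_⟩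
  exact mul_le_mul_of_nonneg_left
    (Real.rpow_le_rpow (hh.sub_nonneg hs hst ht) (hle s t hs hst ht) h1) hC

end Controlled

theorem IsControl.add {T : ℝ} {h h' : ℝ → ℝ} (hh : IsControl T h) (hh' : IsControl T h') :
    IsControl T fun t => h t + h' t :=
  ⟨hh.mono.add hh'.mono, hh.cont.add hh'.cont⟩

theorem Controlled.add_left {T θ : ℝ} {h h' : ℝ → ℝ} {F : ℝ → ℝ → ℝ} (hh : IsControl T h)
    (hh' : IsControl T h') (h1 : 0 ≤ θ) (hF : Controlled T h θ F) :
    Controlled T (fun t => h t + h' t) θ F :=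
  hF.mono_control hh h1 fun s t hs hst ht => by linarith [hh'.sub_nonneg hs hst ht]

theorem Controlled.add_right {T θ : ℝ} {h h' : ℝ → ℝ} {F : ℝ → ℝ → ℝ} (hh : IsControl T h)
    (hh' : IsControl T h') (h1 : 0 ≤ θ) (hF : Controlled T h' θ F) :
    Controlled T (fun t => h t + h' t) θ F :=
  hF.mono_control hh' h1 fun s t hs hst ht => by linarith [hh.sub_nonneg hs hst ht]

/-! ### Partitions, and the passage between finite variation and controls. -/

theorem IsPartitionOf.le_of_le {s t : ℝ} {n : ℕ} {u : ℕ → ℝ} (hu : IsPartitionOf s t n u) :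
    ∀ {j k : ℕ}, j ≤ k → k ≤ n → u j ≤ u k := by
  intro j k hjk
  induction k, hjk using Nat.le_induction with
  | base => intro _; exact le_rfl
  | succ k _ ih => intro hk; exact (ih (by omega)).trans (hu.2.2 k (by omega)).le

theorem IsPartitionOf.mem {s t : ℝ} {n : ℕ} {u : ℕ → ℝ} (hu : IsPartitionOf s t n u) {k : ℕ}
    (hk : k ≤ n) : s ≤ u k ∧ u k ≤ t :=
  ⟨hu.1 ▸ hu.le_of_le (Nat.zero_le k) hk, hu.2.1 ▸ hu.le_of_le hk le_rfl⟩

theorem abs_le_euclNorm {κ : Type} [Fintype κ] (x : κ → ℝ) (i : κ) : |x i| ≤ euclNorm x := by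
  simpa [euclNorm] using PiLp.norm_apply_le (WithLp.toLp 2 x) i

theorem euclNorm_le_sum {κ : Type} [Fintype κ] (x : κ → ℝ) : euclNorm x ≤ ∑ i, |x i| := by
  rw [euclNorm, EuclideanSpace.norm_eq]
  refine Real.sqrt_le_iff.2 ⟨Finset.sum_nonneg fun i _ => abs_nonneg _, ?_⟩
  simpa using Finset.sum_sq_le_sq_sum_of_nonneg (s := Finset.univ) (f := fun i => |x i|)
    (fun i _ => abs_nonneg _)

theorem HasFiniteVar.of_controlled {κ : Type} [Fintype κ] {T r : ℝ} {h : ℝ → ℝ}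
    (hh : IsControl T h) (hr : 0 < r) {F : ℝ → ℝ → κ → ℝ}
    (hF : ∀ i, Controlled T h r⁻¹ fun s t => F s t i) : HasFiniteVar r T F := by
  choose C hC hb using hF
  set D := ∑ i, C i with hD
  have hD0 : 0 ≤ D := Finset.sum_nonneg fun i _ => hC i
  refine ⟨D ^ r * (h T - h 0), fun n u hu => ?_⟩
  have key : ∀ k ∈ Finset.range n,
      euclNorm (F (u k) (u (k + 1))) ^ r ≤ D ^ r * (h (u (k + 1)) - h (u k)) := by
    intro k hk
    have hk := Finset.mem_range.1 hk
    have h1 := (hu.mem hk.le).1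
    have h2 := (hu.2.2 k hk).le
    have h3 := (hu.mem (Nat.succ_le_iff.2 hk)).2
    have h0 := hh.sub_nonneg h1 h2 h3
    have h4 : euclNorm (F (u k) (u (k + 1))) ≤ D * (h (u (k + 1)) - h (u k)) ^ r⁻¹ := by
      refine (euclNorm_le_sum _).trans ?_
      rw [hD, Finset.sum_mul]
      exact Finset.sum_le_sum fun i _ => hb i _ _ h1 h2 h3
    refine (Real.rpow_le_rpow (norm_nonneg _) h4 hr.le).trans ?_
    rw [Real.mul_rpow hD0 (Real.rpow_nonneg h0 _), Real.rpow_inv_rpow h0 hr.ne']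
  refine (Finset.sum_le_sum key).trans ?_
  rw [← Finset.mul_sum, Finset.sum_range_sub (fun k => h (u k)), hu.1, hu.2.1]

theorem continuous_euclNorm {κ : Type} [Fintype κ] : Continuous (euclNorm : (κ → ℝ) → ℝ) :=
  (PiLp.continuous_toLp 2 _).norm

theorem euclNorm_zero {κ : Type} [Fintype κ] : euclNorm (0 : κ → ℝ) = 0 := by
  simp [euclNorm]

theorem HasFiniteVar.exists_control {κ : Type} [Fintype κ] {T r : ℝ} (hT : 0 ≤ T) (hr : 0 < r)
    {F : ℝ → ℝ → κ → ℝ} (hF : HasFiniteVar r T F)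
    (hc : ContinuousOn (fun q : ℝ × ℝ => F q.1 q.2) (timeSimplex T))
    (hd : ∀ s, 0 ≤ s → s ≤ T → F s s = 0) :
    ∃ h, IsControl T h ∧ ∀ i, Controlled T h r⁻¹ fun s t => F s t i := by
  obtain ⟨C, hC⟩ := hF
  obtain ⟨h, hh, hb⟩ := _root_.exists_control (N := fun s t => euclNorm (F s t) ^ r) hT
    ((continuous_euclNorm.comp_continuousOn hc).rpow_const fun _ _ => Or.inr hr.le)
    (fun s t _ _ _ => Real.rpow_nonneg (norm_nonneg _) _)
    (fun s hs ht => by simp [hd s hs ht, euclNorm_zero, hr.ne']) hC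
  refine ⟨h, hh, fun i => ⟨1, zero_le_one, fun s t hs hst ht => ?_⟩⟩
  rw [one_mul, Real.le_rpow_inv_iff_of_pos (abs_nonneg _) (hh.sub_nonneg hs hst ht) hr]
  exact (Real.rpow_le_rpow (abs_nonneg _) (abs_le_euclNorm _ i) hr.le).trans (hb s t hs hst ht)

/-! ### Sewing -/

/-- Only `θ - 1` of the exponent is spent on smallness. The remaining first power telescopes when
the `x k` are increments of a control. -/
theorem sum_rpow_le {κ : Type*} (A : Finset κ) {x : κ → ℝ} {η θ : ℝ} (hθ : 1 < θ)
    (h0 : ∀ k ∈ A, 0 ≤ x k) (h1 : ∀ k ∈ A, x k ≤ η) :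
    ∑ k ∈ A, x k ^ θ ≤ η ^ (θ - 1) * ∑ k ∈ A, x k := by
  rw [Finset.mul_sum]
  refine Finset.sum_le_sum fun k hk => ?_
  have : x k ^ θ = x k ^ (θ - 1) * x k := by
    rw [← Real.rpow_add_one' (h0 k hk) (by linarith)]; ring_nf
  rw [this]
  exact mul_le_mul_of_nonneg_right (Real.rpow_le_rpow (h0 k hk) (h1 k hk) (by linarith)) (h0 k hk)

theorem exists_crossing (f : ℕ → ℝ) {c : ℝ} {n : ℕ} (hn : 0 < n) (h0 : f 0 ≤ c) (h1 : c ≤ f n) :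
    ∃ k < n, f k ≤ c ∧ c ≤ f (k + 1) := by
  induction n with
  | zero => omega
  | succ n ih =>
    by_cases hc : f n ≤ c
    · exact ⟨n, by omega, hc, h1⟩
    · rcases Nat.eq_zero_or_pos n with rfl | hn'
      · exact absurd h0 hc
      · obtain ⟨k, hk, h2⟩ := ih hn' (not_le.1 hc).le
        exact ⟨k, by omega, h2⟩

/-- Induction on the number of intervals. The interval on which `h` crosses the midpoint of its
range is singled out, so that each of the two remaining blocks carries at most half of the control;
reassembling the three pieces uses the defect bound twice. The points need only be monotone, which
admits clamped grids. -/
theorem partition_bound {T θ C : ℝ} {h : ℝ → ℝ} (hh : IsControl T h) (hθ : 1 < θ) (hC : 0 ≤ C)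
    {A : ℝ → ℝ → ℝ}
    (hA : ∀ s u t, 0 ≤ s → s ≤ u → u ≤ t → t ≤ T →
      |A s t - A s u - A u t| ≤ C * (h t - h s) ^ θ)
    {u : ℕ → ℝ} (hu : Monotone u) (hu0 : ∀ k, 0 ≤ u k) (huT : ∀ k, u k ≤ T) (n : ℕ) :
    ∀ m, |∑ k ∈ Finset.range n, A (u (m + k)) (u (m + k + 1)) - A (u m) (u (m + n))| ≤
      2 * C / (1 - 2 * 2⁻¹ ^ θ) * (h (u (m + n)) - h (u m)) ^ θ := by
  have h2 : (2 : ℝ) * 2⁻¹ ^ θ < 1 := by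
    have : (2⁻¹ : ℝ) ^ θ < 2⁻¹ ^ (1 : ℝ) :=
      Real.rpow_lt_rpow_of_exponent_gt (by norm_num) (by norm_num) hθ
    rw [Real.rpow_one] at this
    linarith
  set K := 2 * C / (1 - 2 * 2⁻¹ ^ θ) with hK
  have hK0 : 0 ≤ K := div_nonneg (by linarith) (by linarith)
  -- The constant is the fixed point of the recursion: two blocks at half the control, plus two
  -- defects.
  have hKeq : 2 * K * 2⁻¹ ^ θ + 2 * C = K := by
    rw [hK]; field_simp [show (1 - 2 * (2⁻¹ : ℝ) ^ θ) ≠ 0 by linarith]; ring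
  have hmono : ∀ j k, j ≤ k → 0 ≤ h (u k) - h (u j) := fun j k hjk =>
    hh.sub_nonneg (hu0 j) (hu hjk) (huT k)
  induction n using Nat.strong_induction_on with
  | _ n ih =>
  intro m
  rcases Nat.eq_zero_or_pos n with rfl | hn
  · have := hA (u m) (u m) (u m) (hu0 m) le_rfl le_rfl (huT m)
    simp only [sub_self, Real.zero_rpow (by linarith : θ ≠ 0), mul_zero, zero_sub, abs_neg] at this
    simpa [Real.zero_rpow (by linarith : θ ≠ 0)] using this
  set ω := h (u (m + n)) - h (u m) with hω
  have hω0 : 0 ≤ ω := hmono _ _ (by omega)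
  obtain ⟨k, hk, hk1, hk2⟩ := exists_crossing (fun k => h (u (m + k))) (c := h (u m) + ω / 2) hn
    (by simp only [add_zero]; linarith) (by linarith)
  have hl : h (u (m + k)) - h (u m) ≤ ω / 2 := by linarith
  have hr : h (u (m + n)) - h (u (m + k + 1)) ≤ ω / 2 := by
    have : h (u (m + k + 1)) = h (u (m + (k + 1))) := rfl
    linarith
  have i1 := ih k hk m
  have i2 := ih (n - (k + 1)) (by omega) (m + k + 1)
  have e1 : m + k + 1 + (n - (k + 1)) = m + n := by omega
  rw [e1] at i2
  have hhalf : (ω / 2) ^ θ = 2⁻¹ ^ θ * ω ^ θ := by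
    rw [div_eq_inv_mul, Real.mul_rpow (by norm_num) hω0]
  have b1 : K * (h (u (m + k)) - h (u m)) ^ θ ≤ K * (2⁻¹ ^ θ * ω ^ θ) := by
    rw [← hhalf]
    exact mul_le_mul_of_nonneg_left (Real.rpow_le_rpow (hmono _ _ (by omega)) hl (by linarith)) hK0
  have b2 : K * (h (u (m + n)) - h (u (m + k + 1))) ^ θ ≤ K * (2⁻¹ ^ θ * ω ^ θ) := by
    rw [← hhalf]
    exact mul_le_mul_of_nonneg_left (Real.rpow_le_rpow (hmono _ _ (by omega)) hr (by linarith)) hK0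
  have d1 := hA (u m) (u (m + k)) (u (m + n)) (hu0 _) (hu (by omega)) (hu (by omega)) (huT _)
  have d2 := hA (u (m + k)) (u (m + k + 1)) (u (m + n)) (hu0 _) (hu (by omega)) (hu (by omega))
    (huT _)
  have d3 : C * (h (u (m + n)) - h (u (m + k))) ^ θ ≤ C * ω ^ θ := by
    refine mul_le_mul_of_nonneg_left (Real.rpow_le_rpow (hmono _ _ (by omega)) ?_ (by linarith)) hC
    linarith [hmono m (m + k) (by omega)]
  have hsum : ∑ j ∈ Finset.range n, A (u (m + j)) (u (m + j + 1)) =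
      ∑ j ∈ Finset.range k, A (u (m + j)) (u (m + j + 1)) + A (u (m + k)) (u (m + k + 1)) +
      ∑ j ∈ Finset.range (n - (k + 1)), A (u (m + k + 1 + j)) (u (m + k + 1 + j + 1)) := by
    conv_lhs => rw [show n = k + 1 + (n - (k + 1)) by omega]
    rw [Finset.sum_range_add, Finset.sum_range_succ]
    simp only [add_assoc]
  rw [hsum]
  have hfin : K * ω ^ θ = 2 * (K * (2⁻¹ ^ θ * ω ^ θ)) + 2 * (C * ω ^ θ) := by
    conv_lhs => rw [← hKeq]
    ring
  rw [hfin]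
  rw [abs_le] at i1 i2 d1 d2 ⊢
  constructor <;> linarith [i1.1, i1.2, i2.1, i2.2, d1.1, d1.2, d2.1, d2.2]

/-- Sewing: an almost additive function is close to the increments of a path. The path is a limit
of sums over uniform grids along an ultrafilter. -/
theorem exists_sewing {T θ : ℝ} (hT : 0 < T) {h : ℝ → ℝ} (hh : IsControl T h) (hθ : 1 < θ)
    {A : ℝ → ℝ → ℝ} {C : ℝ} (hC : 0 ≤ C)
    (hA : ∀ s u t, 0 ≤ s → s ≤ u → u ≤ t → t ≤ T →
      |A s t - A s u - A u t| ≤ C * (h t - h s) ^ θ) :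
    ∃ J : ℝ → ℝ, Controlled T h θ fun s t => J t - J s - A s t := by
  have h2 : (2 : ℝ) * 2⁻¹ ^ θ < 1 := by
    have : (2⁻¹ : ℝ) ^ θ < 2⁻¹ ^ (1 : ℝ) :=
      Real.rpow_lt_rpow_of_exponent_gt (by norm_num) (by norm_num) hθ
    rw [Real.rpow_one] at this
    linarith
  set K := 2 * C / (1 - 2 * 2⁻¹ ^ θ) with hK
  have hK0 : 0 ≤ K := div_nonneg (by linarith) (by linarith)
  have hAd : ∀ s, 0 ≤ s → s ≤ T → A s s = 0 := fun s h0 h1 => by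
    have := hA s s s h0 le_rfl le_rfl h1
    simp only [sub_self, Real.zero_rpow (by linarith : θ ≠ 0), mul_zero, zero_sub, abs_neg] at this
    exact abs_nonpos_iff.1 this
  -- the uniform grid with `n + 1` intervals
  set g : ℕ → ℕ → ℝ := fun n k => k * (T / (n + 1)) with hg
  have hgm : ∀ n, Monotone (g n) := fun n j k hjk => by
    have : (j : ℝ) ≤ k := by exact_mod_cast hjk
    exact mul_le_mul_of_nonneg_right this (by positivity)
  have hg0 : ∀ n k, 0 ≤ g n k := fun n k => by positivity
  have hg0' : ∀ n, g n 0 = 0 := fun n => by simp [hg]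
  have hgT : ∀ n, g n (n + 1) = T := fun n => by
    simp only [hg]; push_cast; field_simp
  have hgs : ∀ n k, g n (k + 1) - g n k = T / (n + 1) := fun n k => by
    simp only [hg]; push_cast; ring
  -- Clamping at `t` lets one grid serve all `t`: intervals beyond `t` become degenerate, where `A`
  -- vanishes.
  set Jn : ℕ → ℝ → ℝ := fun n t =>
    ∑ k ∈ Finset.range (n + 1), A (min (g n k) t) (min (g n (k + 1)) t) with hJn
  have clampBound : ∀ n s t, 0 ≤ s → s ≤ t → t ≤ T →
      |∑ k ∈ Finset.range (n + 1), A (max s (min (g n k) t)) (max s (min (g n (k + 1)) t))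
        - A s t| ≤ K * (h t - h s) ^ θ := by
    intro n s t hs hst ht
    have := partition_bound hh hθ hC hA (u := fun k => max s (min (g n k) t))
      (fun j k hjk => max_le_max le_rfl (min_le_min (hgm n hjk) le_rfl))
      (fun k => hs.trans (le_max_left _ _))
      (fun k => max_le (hst.trans ht) ((min_le_right _ _).trans ht)) (n + 1) 0
    simpa [hg0', hgT, hs.trans hst, hs, hst, ht] using this
  have Jbound : ∀ t, 0 ≤ t → t ≤ T → ∀ n, Jn n t ∈ Set.Icc (A 0 t - K * (h t - h 0) ^ θ)
      (A 0 t + K * (h t - h 0) ^ θ) := by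
    intro t h0 ht n
    have := clampBound n 0 t le_rfl h0 ht
    have e : ∀ k, max 0 (min (g n k) t) = min (g n k) t := fun k =>
      max_eq_right (le_min (hg0 n k) h0)
    simp only [e] at this
    rw [abs_le] at this
    constructor <;> simp only [hJn] <;> linarith [this.1, this.2]
  -- Boundedness alone gives a limit along the ultrafilter, at every `t` along the same one, so
  -- increments pass to the limit without a proof that the grid sums converge.
  have hlim : ∀ t, ∃ J, 0 ≤ t → t ≤ T → Tendsto (fun n => Jn n t) (hyperfilter ℕ) (𝓝 J) := by
    intro t
    by_cases ht : 0 ≤ t ∧ t ≤ T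
    · obtain ⟨J, -, hJ⟩ := isCompact_Icc.ultrafilter_le_nhds ((hyperfilter ℕ).map fun n => Jn n t)
        (le_principal_iff.2 (mem_map.2 (univ_mem' (Jbound t ht.1 ht.2))))
      exact ⟨J, fun _ _ => hJ⟩
    · exact ⟨0, fun h1 h2 => absurd ⟨h1, h2⟩ ht⟩
  choose J hJ using hlim
  refine ⟨J, K, hK0, fun s t hs hst ht => ?_⟩
  -- the clamped sums approximate the increments of `Jn`
  have happrox : Tendsto (fun n => Jn n t - Jn n s -
      ∑ k ∈ Finset.range (n + 1), A (max s (min (g n k) t)) (max s (min (g n (k + 1)) t)))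
      atTop (𝓝 0) := by
    rw [Metric.tendsto_atTop]
    intro ε hε
    have hH : 0 ≤ h T - h 0 := hh.sub_nonneg le_rfl hT.le le_rfl
    obtain ⟨η, hη, hηε⟩ : ∃ η > 0, C * (η ^ (θ - 1) * (h T - h 0)) < ε := by
      have : Tendsto (fun η : ℝ => C * (η ^ (θ - 1) * (h T - h 0))) (𝓝[>] 0) (𝓝 0) := by
        have h1 : Tendsto (fun η : ℝ => η ^ (θ - 1)) (𝓝[>] 0) (𝓝 0) := by
          have := (Real.continuousAt_rpow_const 0 (θ - 1) (Or.inr (by linarith))).tendsto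
          rw [Real.zero_rpow (by linarith)] at this
          exact this.mono_left nhdsWithin_le_nhds
        simpa using (h1.mul_const (h T - h 0)).const_mul C
      obtain ⟨η, h1, h2⟩ := ((this.eventually (gt_mem_nhds hε)).and self_mem_nhdsWithin).exists
      exact ⟨η, h2, h1⟩
    have huc := isCompact_Icc.uniformContinuousOn_of_continuous hh.cont
    obtain ⟨δ, hδ, hd⟩ := Metric.uniformContinuousOn_iff.1 huc η hη
    obtain ⟨n₀, hn₀⟩ := exists_nat_gt (T / δ)
    refine ⟨n₀, fun n hn => ?_⟩
    have hmesh : T / (n + 1) < δ := by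
      rw [div_lt_iff₀ hδ] at hn₀
      rw [div_lt_iff₀ (by positivity)]
      have : (n₀ : ℝ) ≤ n := by exact_mod_cast hn
      nlinarith
    rw [Real.dist_eq, sub_zero]
    refine lt_of_le_of_lt ?_ hηε
    simp only [hJn]
    rw [← Finset.sum_sub_distrib, ← Finset.sum_sub_distrib]
    set a : ℕ → ℝ := fun k => min (g n k) t with ha
    have ham : ∀ k, a k ≤ a (k + 1) := fun k => min_le_min (hgm n (by omega)) le_rfl
    have ha0 : ∀ k, 0 ≤ a k := fun k => le_min (hg0 n k) (hs.trans hst)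
    have haT : ∀ k, a k ≤ T := fun k => (min_le_right _ _).trans ht
    have has : ∀ k, min (g n k) s = min (a k) s := fun k => by
      simp only [ha]; rw [min_assoc, min_eq_right hst]
    have hsT := hst.trans ht
    -- A grid interval on one side of `s` contributes zero. The one containing `s` contributes the
    -- defect of `A` for cutting at `s`.
    have hterm : ∀ k ∈ Finset.range (n + 1),
        |A (min (g n k) t) (min (g n (k + 1)) t) - A (min (g n k) s) (min (g n (k + 1)) s) -
          A (max s (min (g n k) t)) (max s (min (g n (k + 1)) t))| ≤
        C * (h (a (k + 1)) - h (a k)) ^ θ := by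
      intro k _
      rw [has, has]
      change |A (a k) (a (k + 1)) - _ - A (max s (a k)) (max s (a (k + 1)))| ≤ _
      have hpos : 0 ≤ C * (h (a (k + 1)) - h (a k)) ^ θ :=
        mul_nonneg hC (Real.rpow_nonneg (hh.sub_nonneg (ha0 k) (ham k) (haT _)) _)
      rcases le_total (a (k + 1)) s with h1 | h1
      · rw [min_eq_left h1, min_eq_left ((ham k).trans h1), max_eq_left h1,
          max_eq_left ((ham k).trans h1), hAd s hs hsT]
        simpa using hpos
      · rcases le_total s (a k) with h3 | h3
        · rw [min_eq_right h1, min_eq_right h3, max_eq_right h1, max_eq_right h3, hAd s hs hsT]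
          simpa using hpos
        · rw [min_eq_right h1, min_eq_left h3, max_eq_right h1, max_eq_left h3]
          exact hA _ _ _ (ha0 k) h3 h1 (haT _)
    refine (Finset.abs_sum_le_sum_abs _ _).trans ((Finset.sum_le_sum hterm).trans ?_)
    rw [← Finset.mul_sum]
    refine mul_le_mul_of_nonneg_left ?_ hC
    refine (sum_rpow_le (η := η) _ hθ (fun k _ => hh.sub_nonneg (ha0 k) (ham k) (haT _))
      fun k _ => ?_).trans ?_
    · have := hd (a (k + 1)) ⟨ha0 _, haT _⟩ (a k) ⟨ha0 _, haT _⟩ (by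
        rw [Real.dist_eq, abs_of_nonneg (by linarith [ham k])]
        refine lt_of_le_of_lt ?_ hmesh
        rw [← hgs n k]
        simp only [ha]
        rcases le_total (g n k) t with h1 | h1
        · rw [min_eq_left h1]; linarith [min_le_left (g n (k + 1)) t]
        · rw [min_eq_right h1]
          linarith [min_le_right (g n (k + 1)) t, hgm n (Nat.le_succ k)])
      rw [Real.dist_eq] at this
      exact (le_abs_self _).trans this.le
    · refine mul_le_mul_of_nonneg_left ?_ (Real.rpow_nonneg hη.le _)
      rw [Finset.sum_range_sub (fun k => h (a k))]
      have h1 := hh.mono ⟨ha0 (n + 1), haT _⟩ (Set.right_mem_Icc.2 hT.le) (haT _)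
      have h3 := hh.mono (Set.left_mem_Icc.2 hT.le) ⟨ha0 0, haT _⟩ (ha0 _)
      linarith
  have hlimit := (((hJ t (hs.trans hst) ht).sub (hJ s hs (hst.trans ht))).sub
    (happrox.mono_left Nat.hyperfilter_le_atTop)).sub_const (A s t)
  have := le_of_tendsto hlimit.abs (Eventually.of_forall fun n => by
    have := clampBound n s t hs hst ht
    refine le_trans (le_of_eq ?_) this
    congr 1
    ring)
  simpa using this

/-- The bound forces `A` to vanish on the diagonal, so `|A| + C ω ^ θ` tends to zero there and
dominates the increments of `J`. Ordering the two times by `min` and `max` treats both sides of `t₀`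
together. -/
theorem continuousOn_of_controlled {T θ : ℝ} {h : ℝ → ℝ} (hh : IsControl T h) (hθ : 0 < θ)
    {J : ℝ → ℝ} {A : ℝ → ℝ → ℝ} (hA : ContinuousOn (fun q : ℝ × ℝ => A q.1 q.2) (timeSimplex T))
    (hJ : Controlled T h θ fun s t => J t - J s - A s t) : ContinuousOn J (Set.Icc 0 T) := by
  obtain ⟨C, hC, hb⟩ := hJ
  have hAd : ∀ s, 0 ≤ s → s ≤ T → A s s = 0 := fun s h0 h1 => by
    simpa [Real.zero_rpow hθ.ne'] using hb s s h0 le_rfl h1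
  intro t₀ ht₀
  set m : ℝ → ℝ := fun t => min t t₀ with hm
  set M : ℝ → ℝ := fun t => max t t₀ with hM
  have hmM : ∀ t ∈ Set.Icc 0 T, (m t, M t) ∈ timeSimplex T := fun t ht =>
    ⟨le_min ht.1 ht₀.1, min_le_max, max_le ht.2 ht₀.2⟩
  have hmc : Continuous m := continuous_id.min continuous_const
  have hMc : Continuous M := continuous_id.max continuous_const
  have e1 : m t₀ = t₀ := min_self _
  have e2 : M t₀ = t₀ := max_self _
  have c1 : ContinuousWithinAt (fun t => |A (m t) (M t)| + C * (h (M t) - h (m t)) ^ θ)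
      (Set.Icc 0 T) t₀ := by
    have hA' : ContinuousWithinAt (fun t => A (m t) (M t)) (Set.Icc 0 T) t₀ :=
      ContinuousWithinAt.comp (f := fun t => (m t, M t)) (t := timeSimplex T)
        (hA _ (hmM t₀ ht₀)) (hmc.prodMk hMc).continuousWithinAt hmM
    have hM' : ContinuousWithinAt (fun t => h (M t)) (Set.Icc 0 T) t₀ :=
      ContinuousWithinAt.comp (f := M) (t := Set.Icc 0 T)
        (by rw [e2]; exact hh.cont _ ht₀) hMc.continuousWithinAt
        (fun t ht => ⟨ht₀.1.trans (le_max_right _ _), max_le ht.2 ht₀.2⟩)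
    have hm' : ContinuousWithinAt (fun t => h (m t)) (Set.Icc 0 T) t₀ :=
      ContinuousWithinAt.comp (f := m) (t := Set.Icc 0 T)
        (by rw [e1]; exact hh.cont _ ht₀) hmc.continuousWithinAt
        (fun t ht => ⟨le_min ht.1 ht₀.1, (min_le_right _ _).trans ht₀.2⟩)
    exact hA'.abs.add (((hM'.sub hm').rpow_const (Or.inr hθ.le)).const_mul C)
  have c2 : Tendsto (fun t => |A (m t) (M t)| + C * (h (M t) - h (m t)) ^ θ)
      (𝓝[Set.Icc 0 T] t₀) (𝓝 0) := by
    have := c1.tendsto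
    rw [e1, e2, hAd t₀ ht₀.1 ht₀.2] at this
    simpa [Real.zero_rpow hθ.ne'] using this
  rw [ContinuousWithinAt, tendsto_iff_dist_tendsto_zero]
  refine squeeze_zero' (Eventually.of_forall fun _ => dist_nonneg) ?_ c2
  filter_upwards [self_mem_nhdsWithin] with t ht
  have key := hb (m t) (M t) (hmM t ht).1 (hmM t ht).2.1 (hmM t ht).2.2
  have hdist : dist (J t) (J t₀) = |J (M t) - J (m t)| := by
    rw [Real.dist_eq]
    rcases le_total t t₀ with h1 | h1
    · simp only [hm, hM, min_eq_left h1, max_eq_right h1]; exact abs_sub_comm _ _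
    · simp only [hm, hM, min_eq_right h1, max_eq_left h1]
  rw [hdist]
  have := abs_add_le (J (M t) - J (m t) - A (m t) (M t)) (A (m t) (M t))
  rw [sub_add_cancel] at this
  linarith

/-- An additive function dominated by a power larger than one of a control vanishes. -/
theorem Controlled.eq_zero {T θ : ℝ} {h : ℝ → ℝ} (hh : IsControl T h) (hθ : 1 < θ)
    {F : ℝ → ℝ → ℝ} (hF : Controlled T h θ F)
    (hadd : ∀ s u t, 0 ≤ s → s ≤ u → u ≤ t → t ≤ T → F s t = F s u + F u t)
    {s t : ℝ} (hs : 0 ≤ s) (hst : s ≤ t) (ht : t ≤ T) : F s t = 0 := by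
  obtain ⟨C, hC, hb⟩ := hF
  have h2 : (2 : ℝ) * 2⁻¹ ^ θ < 1 := by
    have : (2⁻¹ : ℝ) ^ θ < 2⁻¹ ^ (1 : ℝ) :=
      Real.rpow_lt_rpow_of_exponent_gt (by norm_num) (by norm_num) hθ
    rw [Real.rpow_one] at this
    linarith
  have key : ∀ n : ℕ, ∀ s t, 0 ≤ s → s ≤ t → t ≤ T →
      |F s t| ≤ (2 * 2⁻¹ ^ θ) ^ n * (C * (h t - h s) ^ θ) := by
    intro n
    induction n with
    | zero => simpa using hb
    | succ n ih =>
      intro s t hs hst ht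
      have h0 := hh.sub_nonneg hs hst ht
      -- The interval is bisected in the value of `h`, not in time, so each bisection gains the
      -- factor `2 * 2⁻¹ ^ θ < 1`.
      obtain ⟨u, hu, hum⟩ := intermediate_value_Icc hst
        (hh.cont.mono (Set.Icc_subset_Icc hs ht))
        (show (h s + h t) / 2 ∈ Set.Icc (h s) (h t) by constructor <;> linarith)
      have i1 := ih s u hs hu.1 (hu.2.trans ht)
      have i2 := ih u t (hs.trans hu.1) hu.2 ht
      rw [hadd s u t hs hu.1 hu.2 ht]
      refine (abs_add_le _ _).trans ((add_le_add i1 i2).trans (le_of_eq ?_))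
      rw [show h u - h s = 2⁻¹ * (h t - h s) by rw [hum]; ring,
        show h t - h u = 2⁻¹ * (h t - h s) by rw [hum]; ring,
        Real.mul_rpow (by norm_num) h0]
      ring
  have hlim : Tendsto (fun n : ℕ => ((2 : ℝ) * 2⁻¹ ^ θ) ^ n * (C * (h t - h s) ^ θ)) atTop (𝓝 0) := by
    simpa using (tendsto_pow_atTop_nhds_zero_of_lt_one (by positivity) h2).mul_const
      (C * (h t - h s) ^ θ)
  exact abs_nonpos_iff.1 (ge_of_tendsto' hlim fun n => key n s t hs hst ht)

/-! ### The product of tensor series -/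

namespace TensorSeries

variable {ι : Type}

theorem tmul_nil (a b : TensorSeries ι) : tmul a b [] = a [] * b [] := by simp [tmul]

theorem tmul_cons (a b : TensorSeries ι) (x : ι) (w : List ι) :
    tmul a b (x :: w) = a [] * b (x :: w) + tmul (fun v => a (x :: v)) b w := by
  simp only [tmul, List.length_cons]
  rw [Finset.sum_range_succ']
  simp [add_comm]

theorem tmul_concat (a b : TensorSeries ι) (x : ι) (w : List ι) :
    tmul a b (w ++ [x]) = a (w ++ [x]) * b [] + tmul a (fun v => b (v ++ [x])) w := by
  simp only [tmul, List.length_append, List.length_singleton]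
  rw [Finset.sum_range_succ, add_comm]
  congr 1
  · rw [List.take_of_length_le (by simp), List.drop_of_length_le (by simp)]
  · refine Finset.sum_congr rfl fun k hk => ?_
    have hk : k ≤ w.length := Nat.lt_succ_iff.1 (Finset.mem_range.1 hk)
    rw [List.take_append_of_le_length hk, List.drop_append_of_le_length hk]

theorem add_tmul (a a' b : TensorSeries ι) (w : List ι) :
    tmul (fun v => a v + a' v) b w = tmul a b w + tmul a' b w := by
  simp [tmul, add_mul, Finset.sum_add_distrib]

theorem tmul_add (a b b' : TensorSeries ι) (w : List ι) :
    tmul a (fun v => b v + b' v) w = tmul a b w + tmul a b' w := by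
  simp [tmul, mul_add, Finset.sum_add_distrib]

theorem smul_tmul (c : ℝ) (a b : TensorSeries ι) (w : List ι) :
    tmul (fun v => c * a v) b w = c * tmul a b w := by
  simp [tmul, mul_assoc, Finset.mul_sum]

theorem tmul_smul (c : ℝ) (a b : TensorSeries ι) (w : List ι) :
    tmul a (fun v => c * b v) w = c * tmul a b w := by
  simp [tmul, mul_left_comm, Finset.mul_sum]

theorem tmul_assoc (a b c : TensorSeries ι) : tmul (tmul a b) c = tmul a (tmul b c) := by
  funext w
  induction w generalizing a with
  | nil => simp [tmul_nil, mul_assoc]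
  | cons x w ih =>
    rw [tmul_cons, tmul_nil, tmul_cons a, tmul_cons b]
    simp only [tmul_cons a b]
    rw [add_tmul, smul_tmul, ih]
    ring

theorem tmul_congr {a a' b b' : TensorSeries ι} {w : List ι}
    (ha : ∀ v, v.length ≤ w.length → a v = a' v) (hb : ∀ v, v.length ≤ w.length → b v = b' v) :
    tmul a b w = tmul a' b' w := by
  refine Finset.sum_congr rfl fun k _ => ?_
  rw [ha _ (by simp), hb _ (by simp)]

/-- Terms with a proper prefix of `w` cancel, and only the term with all of `w` in the first factor
survives. This and its mirror image isolate the top level in every induction on the level. -/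
theorem tmul_sub_tmul_left {a a' b : TensorSeries ι} {w : List ι}
    (h : ∀ v, v.length < w.length → a v = a' v) :
    tmul a b w - tmul a' b w = (a w - a' w) * b [] := by
  rw [tmul, tmul, ← Finset.sum_sub_distrib, Finset.sum_range_succ, Finset.sum_eq_zero]
  · simp; ring
  · intro k hk
    have := Finset.mem_range.1 hk
    rw [h _ (by simp; omega), sub_self]

theorem tmul_sub_tmul_right {a b b' : TensorSeries ι} {w : List ι}
    (h : ∀ v, v.length < w.length → b v = b' v) :
    tmul a b w - tmul a b' w = a [] * (b w - b' w) := by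
  rw [tmul, tmul, ← Finset.sum_sub_distrib, Finset.sum_range_succ', Finset.sum_eq_zero]
  · simp; ring
  · intro k hk
    have := Finset.mem_range.1 hk
    rw [h _ (by simp; omega), sub_self]

theorem tmul_unit (a : TensorSeries ι) : tmul a unit = a := by
  funext w
  rw [tmul, Finset.sum_range_succ, Finset.sum_eq_zero]
  · simp [unit]
  · intro k hk
    have hk := Finset.mem_range.1 hk
    rcases hd : w.drop k with _ | ⟨x, v⟩
    · have := congrArg List.length hd
      simp at this
      omega
    · simp [unit]

theorem unit_tmul (a : TensorSeries ι) : tmul unit a = a := by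
  funext w
  cases w with
  | nil => simp [tmul_nil, unit]
  | cons x w =>
    rw [tmul_cons]
    simp [unit, tmul]

end TensorSeries

/-! ### Controls of rough paths and of multiplicative functionals -/

theorem IsRoughPath.lift_self {ι : Type} [Fintype ι] {p T : ℝ} {X : ℝ → ι → ℝ}
    {X2 : ℝ → ℝ → Matrix ι ι ℝ} (hX : IsRoughPath p T X X2) {s : ℝ} (hs : 0 ≤ s) (ht : s ≤ T)
    (i j : ι) : X2 s s i j = 0 := by
  have := hX.chen s s s hs le_rfl le_rfl ht i j
  simpa using this

theorem continuousOn_fst_simplex {T : ℝ} {f : ℝ → ℝ} (hf : ContinuousOn f (Set.Icc 0 T)) :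
    ContinuousOn (fun q : ℝ × ℝ => f q.1) (timeSimplex T) :=
  hf.comp continuousOn_fst fun _ hq => ⟨hq.1, hq.2.1.trans hq.2.2⟩

theorem continuousOn_snd_simplex {T : ℝ} {f : ℝ → ℝ} (hf : ContinuousOn f (Set.Icc 0 T)) :
    ContinuousOn (fun q : ℝ × ℝ => f q.2) (timeSimplex T) :=
  hf.comp continuousOn_snd fun _ hq => ⟨hq.1.trans hq.2.1, hq.2.2⟩

theorem continuousOn_zero_fst {T : ℝ} {F : ℝ → ℝ → ℝ}
    (hF : ContinuousOn (fun q : ℝ × ℝ => F q.1 q.2) (timeSimplex T)) :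
    ContinuousOn (fun q : ℝ × ℝ => F 0 q.1) (timeSimplex T) :=
  hF.comp (f := fun q : ℝ × ℝ => ((0 : ℝ), q.1)) (by fun_prop)
    fun _ hq => ⟨le_rfl, hq.1, hq.2.1.trans hq.2.2⟩

theorem IsRoughPath.exists_control {ι : Type} [Fintype ι] {p T : ℝ} (hp : 0 < p) (hT : 0 ≤ T)
    {X : ℝ → ι → ℝ} {X2 : ℝ → ℝ → Matrix ι ι ℝ} (hX : IsRoughPath p T X X2) :
    ∃ h, IsControl T h ∧ (∀ i, Controlled T h (1 / p) fun s t => X t i - X s i) ∧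
      ∀ i j, Controlled T h (2 / p) fun s t => X2 s t i j := by
  have hXi : ∀ i, ContinuousOn (fun t => X t i) (Set.Icc 0 T) := fun i =>
    (continuous_apply i).comp_continuousOn hX.continuousOn_path
  obtain ⟨h1, hh1, hb1⟩ := hX.var_path.exists_control hT hp
    (continuousOn_pi.2 fun i => (continuousOn_snd_simplex (hXi i)).sub
      (continuousOn_fst_simplex (hXi i))) (fun s _ _ => sub_self _)
  obtain ⟨h2, hh2, hb2⟩ := hX.var_lift.exists_control hT (by positivity)
    (continuousOn_pi.2 fun q => (continuous_apply_apply q.1 q.2).comp_continuousOn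
      hX.continuousOn_lift) (fun s hs ht => funext fun q => hX.lift_self hs ht q.1 q.2)
  refine ⟨_, hh1.add hh2, fun i => ?_, fun i j => ?_⟩
  · have := (hb1 i).add_left hh1 hh2 (by positivity)
    simpa using this
  · have := (hb2 (i, j)).add_right hh1 hh2 (by positivity)
    simpa using this

/-! ### Construction of Lyons' extension, one level at a time. -/

/-- A functional which is multiplicative, continuous and dominated by `h` on words of length at
most `n`. -/
structure IsMultUpTo {ι : Type} (p T : ℝ) (h : ℝ → ℝ) (n : ℕ) (S : ℝ → ℝ → TensorSeries ι) :
    Prop where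
  nil : ∀ s t : ℝ, 0 ≤ s → s ≤ t → t ≤ T → S s t [] = 1
  chen : ∀ w : List ι, w.length ≤ n → ∀ s u t : ℝ, 0 ≤ s → s ≤ u → u ≤ t → t ≤ T →
    S s t w = tmul (S s u) (S u t) w
  cont : ∀ w : List ι, w.length ≤ n →
    ContinuousOn (fun q : ℝ × ℝ => S q.1 q.2 w) (timeSimplex T)
  bound : ∀ w : List ι, w ≠ [] → w.length ≤ n → Controlled T h (w.length / p) fun s t => S s t w

/-- Since `R` vanishes at level `n + 1`, only splittings into two non-empty words contribute, and
their exponents add up to `(n + 1) / p`. -/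
theorem exists_three_point_bound {ι : Type} {p T : ℝ} (hp : 0 < p) {h : ℝ → ℝ} (hh : IsControl T h)
    {n : ℕ} {R : ℝ → ℝ → TensorSeries ι}
    (hR0 : ∀ s t w, n < w.length → R s t w = 0)
    (hR : ∀ w : List ι, w ≠ [] → w.length ≤ n → Controlled T h (w.length / p) fun s t => R s t w)
    {w : List ι} (hw : w.length = n + 1) :
    ∃ C, 0 ≤ C ∧ ∀ s u t, 0 ≤ s → s ≤ u → u ≤ t → t ≤ T →
      |tmul (R s u) (R u t) w| ≤ C * (h t - h s) ^ (((n + 1 : ℕ) : ℝ) / p) := by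
  have hk : ∀ k ∈ Finset.range (w.length + 1), ∃ C, 0 ≤ C ∧ ∀ s u t, 0 ≤ s → s ≤ u → u ≤ t →
      t ≤ T → |R s u (w.take k) * R u t (w.drop k)| ≤ C * (h t - h s) ^ (((n + 1 : ℕ) : ℝ) / p) := by
    intro k hk
    have hk := Finset.mem_range.1 hk
    rcases Nat.eq_zero_or_pos k with rfl | hk0
    · exact ⟨0, le_rfl, fun s u t _ _ _ _ => by simp [hR0 u t w (by omega)]⟩
    rcases Nat.lt_or_ge k (n + 1) with hkn | hkn
    swap
    · exact ⟨0, le_rfl, fun s u t _ _ _ _ => by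
        rw [hR0 s u (w.take k) (by simp; omega)]; simp⟩
    have hl1 : (w.take k).length = k := by simp; omega
    have hl2 : (w.drop k).length = n + 1 - k := by simp; omega
    obtain ⟨C, hC, hb⟩ := hR (w.take k) (by rw [← List.length_pos_iff, hl1]; omega) (by omega)
    obtain ⟨D, hD, hd⟩ := hR (w.drop k) (by rw [← List.length_pos_iff, hl2]; omega) (by omega)
    refine ⟨C * D, mul_nonneg hC hD, fun s u t hs hsu hut ht => ?_⟩
    have g1 := hh.sub_nonneg hs hsu (hut.trans ht)
    have g2 := hh.sub_nonneg (hs.trans hsu) hut ht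
    have e : (((n + 1 : ℕ) : ℝ) / p) = (w.take k).length / p + (w.drop k).length / p := by
      rw [← add_div, ← Nat.cast_add, hl1, hl2]; congr 2; omega
    rw [e, Real.rpow_add_of_nonneg (by linarith) (by positivity) (by positivity), abs_mul,
      mul_mul_mul_comm]
    refine mul_le_mul ((hb s u hs hsu (hut.trans ht)).trans ?_)
      ((hd u t (hs.trans hsu) hut ht).trans ?_) (abs_nonneg _)
      (mul_nonneg hC (Real.rpow_nonneg (by linarith) _))
    · exact mul_le_mul_of_nonneg_left (Real.rpow_le_rpow g1 (by linarith) (by positivity)) hC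
    · exact mul_le_mul_of_nonneg_left (Real.rpow_le_rpow g2 (by linarith) (by positivity)) hD
  choose! C hC hb using hk
  refine ⟨∑ k ∈ Finset.range (w.length + 1), C k, Finset.sum_nonneg hC,
    fun s u t hs hsu hut ht => ?_⟩
  rw [Finset.sum_mul]
  exact (Finset.abs_sum_le_sum_abs _ _).trans
    (Finset.sum_le_sum fun k hk => hb k hk s u t hs hsu hut ht)

/-- Cut off above level `n`, `S` becomes `R`. At level `n + 1` the function `A s t = (R 0 s ⊗ R s
t)_w` has defect `-(R s u ⊗ R u t)_w`, of order `(n + 1) / p > 1`. With `J` the sewn path of `A`,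
the new component is `J t - J s - A s t`: it is small by sewing and its failure to be additive is
what Chen's identity demands. -/
theorem IsMultUpTo.exists_succ {ι : Type} {p T : ℝ} (hp : 0 < p) (hT : 0 < T) {h : ℝ → ℝ}
    (hh : IsControl T h) {n : ℕ} (hn : p < n + 1) {S : ℝ → ℝ → TensorSeries ι}
    (hS : IsMultUpTo p T h n S) :
    ∃ S', IsMultUpTo p T h (n + 1) S' ∧ ∀ w : List ι, w.length ≤ n → ∀ s t, S' s t w = S s t w := by
  classical
  set R : ℝ → ℝ → TensorSeries ι := fun s t w => if w.length ≤ n then S s t w else 0 with hRdef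
  have hRS : ∀ s t w, w.length ≤ n → R s t w = S s t w := fun s t w hw => by simp [hRdef, hw]
  have hR0 : ∀ s t w, n < w.length → R s t w = 0 := fun s t w hw => by
    simp [hRdef, not_le.2 hw]
  have hRnil : ∀ s t, 0 ≤ s → s ≤ t → t ≤ T → R s t [] = 1 := fun s t h1 h2 h3 => by
    rw [hRS _ _ _ (by simp), hS.nil s t h1 h2 h3]
  have hRchen : ∀ w : List ι, w.length ≤ n → ∀ s u t : ℝ, 0 ≤ s → s ≤ u → u ≤ t → t ≤ T →
      tmul (R s u) (R u t) w = R s t w := fun w hw s u t h1 h2 h3 h4 => by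
    rw [hRS _ _ _ hw, hS.chen w hw s u t h1 h2 h3 h4]
    exact tmul_congr (fun v hv => hRS _ _ _ (hv.trans hw)) (fun v hv => hRS _ _ _ (hv.trans hw))
  have hRb : ∀ w : List ι, w ≠ [] → w.length ≤ n →
      Controlled T h (w.length / p) fun s t => R s t w := fun w h1 h2 =>
    (hS.bound w h1 h2).congr fun s t _ _ _ => hRS _ _ _ h2
  have hRc : ∀ w : List ι, ContinuousOn (fun q : ℝ × ℝ => R q.1 q.2 w) (timeSimplex T) := by
    intro w
    by_cases hw : w.length ≤ n
    · simpa [hRdef, hw] using hS.cont w hw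
    · simpa [hRdef, hw] using continuousOn_const
  -- Associativity of `R a b ⊗ R b c ⊗ R c d` at level `n + 1`: replacing an inner product by `R`
  -- changes only its top level, which is multiplied by a constant term `1`.
  have hcocycle : ∀ w : List ι, w.length = n + 1 → ∀ a b c d, 0 ≤ a → a ≤ b → b ≤ c → c ≤ d →
      d ≤ T → tmul (R a b) (R b d) w + tmul (R b c) (R c d) w =
        tmul (R a c) (R c d) w + tmul (R a b) (R b c) w := by
    intro w hw a b c d h0 h1 h2 h3 h4
    have e1 := tmul_sub_tmul_right (a := R a b) (b := tmul (R b c) (R c d)) (b' := R b d) (w := w)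
      fun v hv => hRchen v (by omega) b c d (by linarith) h2 h3 h4
    have e2 := tmul_sub_tmul_left (a := tmul (R a b) (R b c)) (a' := R a c) (b := R c d) (w := w)
      fun v hv => hRchen v (by omega) a b c h0 h1 h2 (by linarith)
    rw [tmul_assoc] at e2
    rw [hRnil a b h0 h1 (by linarith), hR0 b d w (by omega)] at e1
    rw [hRnil c d (by linarith) h3 h4, hR0 a c w (by omega)] at e2
    linarith
  have hJ : ∀ w : List ι, ∃ J : ℝ → ℝ, w.length = n + 1 →
      Controlled T h (((n + 1 : ℕ) : ℝ) / p) fun s t => J t - J s - tmul (R 0 s) (R s t) w := by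
    intro w
    by_cases hw : w.length = n + 1
    swap
    · exact ⟨0, fun h' => absurd h' hw⟩
    obtain ⟨C, hC, hb⟩ := exists_three_point_bound hp hh hR0 hRb hw
    obtain ⟨J, hJ⟩ := exists_sewing (A := fun s t => tmul (R 0 s) (R s t) w) hT hh
      (θ := ((n + 1 : ℕ) : ℝ) / p) (by rw [lt_div_iff₀ hp]; push_cast; linarith) hC
      (fun s u t hs hsu hut ht => by
        have := hcocycle w hw 0 s u t le_rfl hs hsu hut ht
        rw [show tmul (R 0 s) (R s t) w - tmul (R 0 s) (R s u) w - tmul (R 0 u) (R u t) w =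
          -tmul (R s u) (R u t) w by linarith, abs_neg]
        exact hb s u t hs hsu hut ht)
    exact ⟨J, fun _ => hJ⟩
  choose J hJ using hJ
  set S' : ℝ → ℝ → TensorSeries ι := fun s t w =>
    if w.length ≤ n then S s t w else J w t - J w s - tmul (R 0 s) (R s t) w with hS'
  have e1 : ∀ w : List ι, w.length ≤ n → ∀ s t, S' s t w = S s t w := fun w hw s t => by
    simp [hS', hw]
  have e2 : ∀ w : List ι, w.length = n + 1 → ∀ s t,
      S' s t w = J w t - J w s - tmul (R 0 s) (R s t) w := fun w hw s t => by
    simp [hS', hw]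
  refine ⟨S', ⟨fun s t h1 h2 h3 => ?_, fun w hw s u t h1 h2 h3 h4 => ?_, fun w hw => ?_,
    fun w hw0 hw => ?_⟩, e1⟩
  · rw [e1 _ (by simp), hS.nil s t h1 h2 h3]
  · rcases Nat.lt_or_ge n w.length with hlt | hle
    · have hw : w.length = n + 1 := by omega
      have l1 := tmul_sub_tmul_left (a := S' s u) (a' := R s u) (b := S' u t) (w := w)
        fun v hv => by rw [e1 _ (by omega), hRS _ _ _ (by omega)]
      have l2 := tmul_sub_tmul_right (a := R s u) (b := S' u t) (b' := R u t) (w := w)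
        fun v hv => by rw [e1 _ (by omega), hRS _ _ _ (by omega)]
      rw [hR0 _ _ _ hlt, e1 [] (by simp), hS.nil u t (by linarith) h3 h4] at l1
      rw [hR0 _ _ _ hlt, hRnil s u h1 h2 (by linarith)] at l2
      have l3 := hcocycle w hw 0 s u t le_rfl h1 h2 h3 h4
      rw [e2 w hw] at l1 l2 ⊢
      linarith
    · rw [e1 w hle, hS.chen w hle s u t h1 h2 h3 h4]
      exact tmul_congr (fun v hv => (e1 v (by omega) _ _).symm)
        (fun v hv => (e1 v (by omega) _ _).symm)
  · rcases Nat.lt_or_ge n w.length with hlt | hle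
    · have hw : w.length = n + 1 := by omega
      have hA : ContinuousOn (fun q : ℝ × ℝ => tmul (R 0 q.1) (R q.1 q.2) w) (timeSimplex T) := by
        unfold tmul
        exact continuousOn_finsetSum _ fun k _ =>
          (continuousOn_zero_fst (F := fun s t => R s t (w.take k)) (hRc _)).mul (hRc _)
      have hJc := continuousOn_of_controlled (A := fun s t => tmul (R 0 s) (R s t) w) hh
        (by positivity) hA (hJ w hw)
      simp only [e2 w hw]
      exact ((continuousOn_snd_simplex hJc).sub (continuousOn_fst_simplex hJc)).sub hA
    · simpa only [e1 w hle] using hS.cont w hle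
  · rcases Nat.lt_or_ge n w.length with hlt | hle
    · have hw : w.length = n + 1 := by omega
      simpa only [e2 w hw, hw] using hJ w hw
    · simpa only [e1 w hle] using hS.bound w hw0 hle

/-- The functional `(1, X, X2, 0, …)`. -/
def truncatedSignature {ι : Type} (X : ℝ → ι → ℝ) (X2 : ℝ → ℝ → Matrix ι ι ℝ) (s t : ℝ) :
    TensorSeries ι
  | [] => 1
  | [i] => X t i - X s i
  | [i, j] => X2 s t i j
  | _ => 0

theorem IsRoughPath.isMultUpTo {ι : Type} [Fintype ι] {p T : ℝ} {X : ℝ → ι → ℝ}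
    {X2 : ℝ → ℝ → Matrix ι ι ℝ} (hX : IsRoughPath p T X X2) {h : ℝ → ℝ}
    (h1 : ∀ i, Controlled T h (1 / p) fun s t => X t i - X s i)
    (h2 : ∀ i j, Controlled T h (2 / p) fun s t => X2 s t i j) :
    IsMultUpTo p T h 2 (truncatedSignature X X2) where
  nil _ _ _ _ _ := rfl
  chen w hw s u t hs hsu hut ht := by
    match w, hw with
    | [], _ => simp [tmul_nil, truncatedSignature]
    | [i], _ => simp [tmul_cons, tmul_nil, truncatedSignature]
    | [i, j], _ =>
      simp [tmul_cons, tmul_nil, truncatedSignature, hX.chen s u t hs hsu hut ht i j]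
      ring
  cont w hw := by
    have hXi : ∀ i, ContinuousOn (fun t => X t i) (Set.Icc 0 T) := fun i =>
      (continuous_apply i).comp_continuousOn hX.continuousOn_path
    match w, hw with
    | [], _ => simpa [truncatedSignature] using continuousOn_const
    | [i], _ => exact (continuousOn_snd_simplex (hXi i)).sub (continuousOn_fst_simplex (hXi i))
    | [i, j], _ => exact (continuous_apply_apply i j).comp_continuousOn hX.continuousOn_lift
  bound w hw0 hw := by
    match w, hw0, hw with
    | [i], _, _ => simpa [truncatedSignature] using h1 i
    | [i, j], _, _ => simpa [truncatedSignature] using h2 i j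

theorem IsRoughPath.exists_lyonsExtension {ι : Type} [Fintype ι] {p T : ℝ} (hp : 0 < p)
    (hp3 : p < 3) (hT : 0 < T) {X : ℝ → ι → ℝ} {X2 : ℝ → ℝ → Matrix ι ι ℝ}
    (hX : IsRoughPath p T X X2) : ∃ S, IsLyonsExtension p T X X2 S := by
  obtain ⟨h, hh, h1, h2⟩ := hX.exists_control hp hT.le
  have step : ∀ (n : ℕ) (S : {S // IsMultUpTo (ι := ι) p T h (n + 2) S}),
      ∃ S' : {S // IsMultUpTo (ι := ι) p T h (n + 1 + 2) S},
        ∀ w : List ι, w.length ≤ n + 2 → ∀ s t, S'.1 s t w = S.1 s t w := fun n S => by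
    obtain ⟨S', hS', he⟩ := S.2.exists_succ hp hT hh (by push_cast; linarith [n.cast_nonneg (α := ℝ)])
    exact ⟨⟨S', hS'⟩, he⟩
  choose next hnext using step
  set f : (n : ℕ) → {S // IsMultUpTo (ι := ι) p T h (n + 2) S} :=
    fun n => Nat.rec ⟨_, hX.isMultUpTo h1 h2⟩ next n with hf
  have hsucc : ∀ n, f (n + 1) = next n (f n) := fun n => rfl
  have hstab : ∀ (w : List ι) (k m : ℕ), w.length ≤ k + 2 → k ≤ m → ∀ s t,
      (f m).1 s t w = (f k).1 s t w := by
    intro w k m hk hkm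
    induction m, hkm using Nat.le_induction with
    | base => intros; rfl
    | succ m hm ih => intro s t; rw [hsucc, hnext m _ w (by omega), ih]
  -- Stage `k` is multiplicative up to level `k + 2`, so stage `w.length` already has the final
  -- value at `w`. The construction may start at level two because `p < 3`.
  set S : ℝ → ℝ → TensorSeries ι := fun s t w => (f w.length).1 s t w with hS
  have hSf : ∀ (w : List ι) (m : ℕ), w.length ≤ m → ∀ s t, S s t w = (f m).1 s t w :=
    fun w m hm s t => (hstab w w.length m (by omega) hm s t).symm
  have hS0 : ∀ (w : List ι), w.length ≤ 2 → ∀ s t, S s t w = truncatedSignature X X2 s t w :=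
    fun w hw s t => hstab w 0 w.length (by omega) (by omega) s t
  refine ⟨S, ⟨fun s t _ _ _ => ?_, fun s t _ _ _ i => ?_, fun s t _ _ _ i j => ?_,
    fun s u t hs hsu hut ht => funext fun w => ?_, fun w => ?_, fun n hn => ?_⟩⟩
  · exact hS0 [] (by simp) s t
  · exact hS0 [i] (by simp) s t
  · exact hS0 [i, j] (by simp) s t
  · rw [hSf w w.length le_rfl, (f w.length).2.chen w (by omega) s u t hs hsu hut ht]
    exact tmul_congr (fun v hv => (hSf v _ hv _ _).symm) (fun v hv => (hSf v _ hv _ _).symm)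
  · exact (f w.length).2.cont w (by omega)
  · refine HasFiniteVar.of_controlled hh (by positivity) fun v => ?_
    have := (f (List.ofFn v).length).2.bound (List.ofFn v)
      (by rw [← List.length_pos_iff, List.length_ofFn]; omega) (by omega)
    simpa [hS] using this

namespace IsLyonsExtension

variable {ι : Type} [Fintype ι] {p T : ℝ} {X : ℝ → ι → ℝ} {X2 : ℝ → ℝ → Matrix ι ι ℝ}
  {S : ℝ → ℝ → TensorSeries ι}

/-- Once the lower levels vanish, Chen's identity at three equal times gives twice the top component
equal to itself. Vanishing on the diagonal is what `HasFiniteVar.exists_control` asks for. -/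
theorem self_eq_zero (hS : IsLyonsExtension p T X X2 S) {s : ℝ} (hs : 0 ≤ s) (hsT : s ≤ T)
    (n : ℕ) : ∀ w : List ι, w.length = n → w ≠ [] → S s s w = 0 := by
  induction n using Nat.strong_induction_on with
  | _ n ih =>
  intro w hw hw0
  have h1 := tmul_sub_tmul_right (a := S s s) (b := S s s) (b' := unit) (w := w) fun v hv => by
    rcases v with _ | ⟨x, v⟩
    · exact hS.level_zero s s hs le_rfl hsT
    · exact ih _ (by omega) _ rfl (by simp)
  rw [← hS.chen s s s hs le_rfl le_rfl hsT, tmul_unit, sub_self,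
    hS.level_zero s s hs le_rfl hsT] at h1
  obtain ⟨x, v, rfl⟩ := List.exists_cons_of_ne_nil hw0
  simpa [unit] using h1.symm

/-- Each level supplies its own control; their sum dominates all levels up to `n` at once. -/
theorem exists_control (hS : IsLyonsExtension p T X X2 S) (hp : 0 < p) (hT : 0 ≤ T) (n : ℕ) :
    ∃ h, IsControl T h ∧ ∀ w : List ι, w ≠ [] → w.length ≤ n →
      Controlled T h (w.length / p) fun s t => S s t w := by
  induction n with
  | zero =>
    exact ⟨fun _ => 0, ⟨monotoneOn_const, continuousOn_const⟩, fun w h1 h2 =>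
      absurd (List.eq_nil_of_length_eq_zero (by omega)) h1⟩
  | succ n ih =>
    obtain ⟨h, hh, hb⟩ := ih
    obtain ⟨h', hh', hb'⟩ := (hS.var (n + 1) (by omega)).exists_control hT (by positivity)
      (continuousOn_pi.2 fun v => hS.continuousOn _)
      (fun s hs ht => funext fun v => hS.self_eq_zero hs ht _ _ rfl (by simp))
    refine ⟨_, hh.add hh', fun w h1 h2 => ?_⟩
    rcases Nat.lt_or_ge n w.length with hlt | hle
    · have hw : w.length = n + 1 := by omega
      have := (hb' fun k => w.get (k.cast hw.symm)).add_right hh hh' (by positivity)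
      have e : List.ofFn (fun k : Fin (n + 1) => w.get (k.cast hw.symm)) = w := 
        List.ext_getElem (by simp [hw]) fun k _ _ => by rw [List.getElem_ofFn]; rfl
      rw [e] at this
      simpa [hw] using this
    · exact (hb w h1 hle).add_left hh hh' (by positivity)

end IsLyonsExtension

/-! ### Shuffles -/

/-- `⟨u ⧢ v, a⟩` for the shuffle product of the words `u` and `v`. -/
def shuffleEval {ι : Type} : List ι → List ι → TensorSeries ι → ℝ
  | [], v, a => a v
  | x :: u, [], a => a (x :: u)
  | x :: u, y :: v, a =>
      shuffleEval u (y :: v) (fun w => a (x :: w)) + shuffleEval (x :: u) v (fun w => a (y :: w))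
termination_by u v => u.length + v.length

section Shuffle

variable {ι : Type}

theorem shuffleEval_nil_left (v : List ι) (a : TensorSeries ι) : shuffleEval [] v a = a v := by
  rw [shuffleEval]

theorem shuffleEval_nil_right (u : List ι) (a : TensorSeries ι) : shuffleEval u [] a = a u := by
  cases u <;> rw [shuffleEval]

theorem shuffleEval_cons_cons (x y : ι) (u v : List ι) (a : TensorSeries ι) :
    shuffleEval (x :: u) (y :: v) a =
      shuffleEval u (y :: v) (fun w => a (x :: w)) +
        shuffleEval (x :: u) v (fun w => a (y :: w)) := by
  rw [shuffleEval]

/-- Induction along the recursion of the shuffle product, for statements about a series. -/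
theorem shuffle_induction {α : Type*} (shift : ι → α → α) {P : List ι → List ι → α → Prop}
    (nil_left : ∀ v a, P [] v a) (nil_right : ∀ u a, P u [] a)
    (cons_cons : ∀ x y u v a, P u (y :: v) (shift x a) → P (x :: u) v (shift y a) →
      P (x :: u) (y :: v) a) (u v : List ι) (a : α) : P u v a := by
  induction hn : u.length + v.length using Nat.strong_induction_on generalizing u v a with
  | _ n ih =>
  match u, v with
  | [], v => exact nil_left v a
  | u, [] => exact nil_right u a
  | x :: u, y :: v =>
    simp only [List.length_cons] at hn
    exact cons_cons x y u v a (ih _ (by simp; omega) _ _ _ rfl) (ih _ (by simp; omega) _ _ _ rfl)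

theorem shuffleEval_sum {κ : Type*} (A : Finset κ) (c : κ → ℝ) (a : κ → TensorSeries ι)
    (u v : List ι) : shuffleEval u v (fun w => ∑ k ∈ A, c k * a k w) =
      ∑ k ∈ A, c k * shuffleEval u v (a k) := by
  refine shuffle_induction (α := κ → TensorSeries ι) (fun x a k w => a k (x :: w))
    (P := fun u v a => shuffleEval u v (fun w => ∑ k ∈ A, c k * a k w) =
      ∑ k ∈ A, c k * shuffleEval u v (a k)) ?_ ?_ ?_ u v a
  · intro v a; simp only [shuffleEval_nil_left]
  · intro u a; simp only [shuffleEval_nil_right]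
  · intro x y u v a h1 h2
    simp only [shuffleEval_cons_cons, mul_add, Finset.sum_add_distrib, h1, h2]

theorem shuffleEval_congr {u v : List ι} {a b : TensorSeries ι}
    (h : ∀ w, w.length = u.length + v.length → a w = b w) :
    shuffleEval u v a = shuffleEval u v b := by
  refine shuffle_induction (α := TensorSeries ι × TensorSeries ι)
    (fun x q => (fun w => q.1 (x :: w), fun w => q.2 (x :: w)))
    (P := fun u v q => (∀ w, w.length = u.length + v.length → q.1 w = q.2 w) →
      shuffleEval u v q.1 = shuffleEval u v q.2) ?_ ?_ ?_ u v (a, b) h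
  · intro v q h; simpa only [shuffleEval_nil_left] using h v (by simp)
  · intro u q h; simpa only [shuffleEval_nil_right] using h u (by simp)
  · intro x y u v q h1 h2 h
    simp only [shuffleEval_cons_cons]
    rw [h1 fun w hw => h (x :: w) (by simp at hw ⊢; omega),
      h2 fun w hw => h (y :: w) (by simp at hw ⊢; omega)]

theorem Controlled.shuffleEval {T θ : ℝ} {h : ℝ → ℝ} {u v : List ι}
    {S : ℝ → ℝ → TensorSeries ι}
    (hS : ∀ w, w.length = u.length + v.length → Controlled T h θ fun s t => S s t w) :
    Controlled T h θ fun s t => shuffleEval u v (S s t) := by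
  refine shuffle_induction (α := ℝ → ℝ → TensorSeries ι) (fun x S s t w => S s t (x :: w))
    (P := fun u v S => (∀ w, w.length = u.length + v.length → Controlled T h θ fun s t => S s t w) →
      Controlled T h θ fun s t => _root_.shuffleEval u v (S s t)) ?_ ?_ ?_ u v S hS
  · intro v S hS; simpa only [shuffleEval_nil_left] using hS v (by simp)
  · intro u S hS; simpa only [shuffleEval_nil_right] using hS u (by simp)
  · intro x y u v S h1 h2 hS
    simp only [shuffleEval_cons_cons]
    exact (h1 fun w hw => hS (x :: w) (by simp at hw ⊢; omega)).add
      (h2 fun w hw => hS (y :: w) (by simp at hw ⊢; omega))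

theorem shuffleEval_add (u v : List ι) (a b : TensorSeries ι) :
    shuffleEval u v (fun w => a w + b w) = shuffleEval u v a + shuffleEval u v b := by
  have := shuffleEval_sum Finset.univ (fun _ : Bool => 1) (fun k => if k then a else b) u v
  simpa using this

theorem shuffleEval_mul (u v : List ι) (c : ℝ) (a : TensorSeries ι) :
    shuffleEval u v (fun w => c * a w) = c * shuffleEval u v a := by
  have := shuffleEval_sum {()} (fun _ => c) (fun _ => a) u v
  simpa using this

/-- Deconcatenation is a homomorphism for the shuffle product. -/
theorem shuffleEval_tmul (u v : List ι) (a b : TensorSeries ι) :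
    shuffleEval u v (tmul a b) =
      ∑ i ∈ Finset.range (u.length + 1), ∑ j ∈ Finset.range (v.length + 1),
        shuffleEval (u.take i) (v.take j) a * shuffleEval (u.drop i) (v.drop j) b := by
  refine shuffle_induction (fun x a w => a (x :: w))
    (P := fun u v a => shuffleEval u v (tmul a b) =
      ∑ i ∈ Finset.range (u.length + 1), ∑ j ∈ Finset.range (v.length + 1),
        shuffleEval (u.take i) (v.take j) a * shuffleEval (u.drop i) (v.drop j) b) ?_ ?_ ?_ u v a
  · intro v a; simp [shuffleEval_nil_left, tmul]
  · intro u a; simp [shuffleEval_nil_right, tmul]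
  · intro x y u v a h1 h2
    simp only [shuffleEval_cons_cons, tmul_cons, shuffleEval_add, shuffleEval_mul, h1, h2]
    simp only [List.length_cons]
    simp only [Finset.sum_range_succ' _ (u.length + 1), Finset.sum_range_succ' _ (v.length + 1),
      List.take_succ_cons, List.drop_succ_cons, List.take_zero, List.drop_zero,
      shuffleEval_nil_left, shuffleEval_nil_right, shuffleEval_cons_cons, add_mul, mul_add,
      Finset.sum_add_distrib]
    ring

end Shuffle

/-! ### Lyons extensions of geometric type are shuffle characters. -/

/-- Characters of the shuffle algebra. -/
structure IsShuffleCharacter {ι : Type} (g : TensorSeries ι) : Prop where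
  nil : g [] = 1
  shuffle : ∀ u v, shuffleEval u v g = g u * g v

theorem IsShuffleCharacter.tmul {ι : Type} {g g' : TensorSeries ι} (hg : IsShuffleCharacter g)
    (hg' : IsShuffleCharacter g') : IsShuffleCharacter (TensorSeries.tmul g g') := by
  refine ⟨by simp [tmul_nil, hg.nil, hg'.nil], fun u v => ?_⟩
  rw [shuffleEval_tmul, TensorSeries.tmul, TensorSeries.tmul, Finset.sum_mul_sum]
  refine Finset.sum_congr rfl fun i _ => Finset.sum_congr rfl fun j _ => ?_
  rw [hg.shuffle, hg'.shuffle]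
  ring

theorem isShuffleCharacter_unit {ι : Type} : IsShuffleCharacter (unit : TensorSeries ι) := by
  refine ⟨rfl, fun u v => ?_⟩
  rcases u with _ | ⟨x, u⟩
  · rw [shuffleEval_nil_left]; simp [unit]
  rcases v with _ | ⟨y, v⟩
  · rw [shuffleEval_nil_right]; simp [unit]
  have : shuffleEval (x :: u) (y :: v) (unit : TensorSeries ι) =
      shuffleEval (x :: u) (y :: v) (fun w => 0 * unit w) :=
    shuffleEval_congr fun w hw => by
      rcases w with _ | ⟨z, w⟩
      · simp at hw
      · simp [unit]
  rw [this, shuffleEval_mul]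
  simp [unit]

/-- A Lyons extension of a rough path whose second level has symmetric part `½ X ⊗ X` takes
values in the characters of the shuffle algebra. -/
theorem IsLyonsExtension.isShuffleCharacter {ι : Type} [Fintype ι] {p T : ℝ} (hp : 0 < p)
    (hp3 : p < 3) (hT : 0 ≤ T) {X : ℝ → ι → ℝ} {X2 : ℝ → ℝ → Matrix ι ι ℝ}
    {S : ℝ → ℝ → TensorSeries ι} (hS : IsLyonsExtension p T X X2 S)
    (hsymm : ∀ s t : ℝ, 0 ≤ s → s ≤ t → t ≤ T → ∀ i j,
      X2 s t i j + X2 s t j i = (X t i - X s i) * (X t j - X s j))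
    {s t : ℝ} (hs : 0 ≤ s) (hst : s ≤ t) (ht : t ≤ T) : IsShuffleCharacter (S s t) := by
  refine ⟨hS.level_zero s t hs hst ht, fun u v => ?_⟩
  induction hn : u.length + v.length using Nat.strong_induction_on generalizing u v s t with
  | _ n ih =>
  rcases eq_or_ne u [] with rfl | hu
  · rw [shuffleEval_nil_left, hS.level_zero s t hs hst ht, one_mul]
  rcases eq_or_ne v [] with rfl | hv
  · rw [shuffleEval_nil_right, hS.level_zero s t hs hst ht, mul_one]
  have hu' := List.length_pos_iff.2 hu
  have hv' := List.length_pos_iff.2 hv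
  -- Two non-empty words of total length below three are single letters, and their relation is
  -- `hsymm`. From total length three on, the exponent `n / p` exceeds one.
  rcases Nat.lt_or_ge n 3 with hn3 | hn3
  · obtain ⟨i, rfl⟩ := List.length_eq_one_iff.1 (show u.length = 1 by omega)
    obtain ⟨j, rfl⟩ := List.length_eq_one_iff.1 (show v.length = 1 by omega)
    rw [shuffleEval_cons_cons, shuffleEval_nil_left, shuffleEval_nil_right,
      hS.level_two s t hs hst ht, hS.level_two s t hs hst ht, hS.level_one s t hs hst ht,
      hS.level_one s t hs hst ht, hsymm s t hs hst ht]
  obtain ⟨h, hh, hb⟩ := hS.exists_control hp hT n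
  have hbound : Controlled T h ((n : ℝ) / p) fun s t =>
      shuffleEval u v (S s t) - S s t u * S s t v := by
    refine Controlled.sub (Controlled.shuffleEval fun w hw => ?_) ?_
    · have := hb w (by rw [← List.length_pos_iff]; omega) (by omega)
      rwa [hw, hn] at this
    · have := (hb u hu (by omega)).mul hh (by positivity) (by positivity) (hb v hv (by omega))
      rwa [← add_div, ← Nat.cast_add, hn] at this
  refine sub_eq_zero.1 (hbound.eq_zero hh ?_ (fun s r t h1 h2 h3 h4 => ?_) hs hst ht)
  · rw [lt_div_iff₀ hp]
    have : (3 : ℝ) ≤ n := by exact_mod_cast hn3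
    linarith
  · rw [hS.chen s r t h1 h2 h3 h4, shuffleEval_tmul]
    simp only [tmul]
    rw [Finset.sum_mul_sum, ← Finset.sum_product', ← Finset.sum_product', ← Finset.sum_sub_distrib]
    have g0 := hS.level_zero s r h1 h2 (h3.trans h4)
    have g1 := hS.level_zero r t (h1.trans h2) h3 h4
    -- In the expanded defect, the splittings with both parts shorter than `n` cancel by induction.
    -- The two extreme splittings leave the defects over `[s, r]` and `[r, t]`, which is additivity.
    rw [Finset.sum_eq_add (0, 0) (u.length, v.length) (by simp; omega) ?_ (by simp) (by simp)]
    · simp only [List.take_zero, List.drop_zero, List.take_length, List.drop_length,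
        shuffleEval_nil_left, g0, g1]
      ring
    · rintro ⟨i, j⟩ hij ⟨hne1, hne2⟩
      simp only [Finset.mem_product, Finset.mem_range, Prod.mk.injEq, ne_eq] at hij hne1 hne2
      rw [ih ((u.take i).length + (v.take j).length) (by simp; omega) h1 h2 (h3.trans h4) _ _ rfl,
        ih ((u.drop i).length + (v.drop j).length) (by simp; omega) (h1.trans h2) h3 h4 _ _ rfl]
      ring

/-! ### The tensor exponential and its inverse -/

namespace TensorSeries

variable {ι : Type}

theorem tpow_eq_zero {a : TensorSeries ι} (ha : a [] = 0) (k : ℕ) :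
    ∀ w : List ι, w.length < k → tpow a k w = 0 := by
  induction k with
  | zero => intro w hw; omega
  | succ k ih =>
    intro w hw
    rw [tpow, tmul]
    refine Finset.sum_eq_zero fun j hj => ?_
    have hj := Finset.mem_range.1 hj
    rcases Nat.lt_or_ge j w.length with hjw | hjw
    · rw [ih _ (by simp; omega), zero_mul]
    · rw [List.drop_of_length_le hjw, ha, mul_zero]

theorem tpow_congr {a b : TensorSeries ι} {n : ℕ} (hab : ∀ v, v.length < n → a v = b v) (k : ℕ) :
    ∀ w : List ι, w.length < n → tpow a k w = tpow b k w := by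
  induction k with
  | zero => intro w _; rfl
  | succ k ih =>
    intro w hw
    exact tmul_congr (fun v hv => ih v (by omega)) (fun v hv => hab v (by omega))

/-- With two or more factors and no constant term, each factor is evaluated strictly below the top
level. This triangularity lets the logarithm be solved level by level. -/
theorem tpow_congr_of_two_le {a b : TensorSeries ι} (ha : a [] = 0) (hb : b [] = 0) {n : ℕ}
    (hab : ∀ v, v.length < n → a v = b v) {k : ℕ} (hk : 2 ≤ k) {w : List ι} (hw : w.length ≤ n) :
    tpow a k w = tpow b k w := by
  obtain ⟨k, rfl⟩ := Nat.exists_eq_add_of_le' (show 1 ≤ k by omega)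
  rw [tpow, tpow, tmul, tmul]
  refine Finset.sum_congr rfl fun j hj => ?_
  have hj := Finset.mem_range.1 hj
  rcases Nat.eq_zero_or_pos j with rfl | hj0
  · rw [tpow_eq_zero ha _ _ (by simp; omega), tpow_eq_zero hb _ _ (by simp; omega)]
    simp
  rcases Nat.lt_or_ge j w.length with hjw | hjw
  · rw [tpow_congr hab _ _ (by simp; omega), hab _ (by simp; omega)]
  · rw [List.drop_of_length_le hjw, ha, hb, mul_zero, mul_zero]

theorem tpow_one (a : TensorSeries ι) : tpow a 1 = a := unit_tmul a

theorem tpow_smul (c : ℝ) (a : TensorSeries ι) (k : ℕ) :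
    tpow (fun w => c * a w) k = fun w => c ^ k * tpow a k w := by
  induction k with
  | zero => funext w; simp [tpow]
  | succ k ih =>
    funext w
    rw [tpow, ih, smul_tmul, tmul_smul, tpow]
    ring

theorem tpow_add (a : TensorSeries ι) (i j : ℕ) :
    tpow a (i + j) = tmul (tpow a i) (tpow a j) := by
  induction j with
  | zero => exact (tmul_unit _).symm
  | succ j ih => rw [← add_assoc, tpow, ih, tpow, tmul_assoc]

theorem texp_eq {a : TensorSeries ι} (ha : a [] = 0) {w : List ι} {n : ℕ} (hn : w.length ≤ n) :
    texp a w = ∑ k ∈ Finset.range (n + 1), ((k.factorial : ℝ))⁻¹ * tpow a k w := by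
  refine Finset.sum_subset (Finset.range_mono (by omega)) fun k _ hk => ?_
  rw [tpow_eq_zero ha k w (by simpa using hk), mul_zero]

theorem texp_eq_add (a : TensorSeries ι) {w : List ι} (hw : w ≠ []) :
    texp a w = a w + ∑ k ∈ Finset.Ico 2 (w.length + 1), ((k.factorial : ℝ))⁻¹ * tpow a k w := by
  have hl := List.length_pos_iff.2 hw
  obtain ⟨x, v, rfl⟩ := List.exists_cons_of_ne_nil hw
  rw [texp, Finset.range_eq_Ico, Finset.sum_eq_sum_Ico_succ_bot (by omega),
    Finset.sum_eq_sum_Ico_succ_bot (by omega), tpow_one]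
  simp [tpow, unit]

/-- Approximations of the tensor logarithm: level `n` is correct after `n` steps. -/
noncomputable def logIter (g : TensorSeries ι) : ℕ → TensorSeries ι
  | 0 => fun _ => 0
  | n + 1 => fun w => match w with
    | [] => 0
    | x :: w => g (x :: w) -
        ∑ k ∈ Finset.Ico 2 ((x :: w).length + 1), ((k.factorial : ℝ))⁻¹ *
          tpow (logIter g n) k (x :: w)

theorem logIter_nil (g : TensorSeries ι) (n : ℕ) : logIter g n [] = 0 := by cases n <;> rfl

theorem logIter_stable (g : TensorSeries ι) (n : ℕ) :
    ∀ m, n ≤ m → ∀ w : List ι, w.length ≤ n → logIter g m w = logIter g n w := by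
  induction n with
  | zero =>
    intro m _ w hw
    rw [List.eq_nil_of_length_eq_zero (Nat.le_zero.1 hw), logIter_nil, logIter_nil]
  | succ n ih =>
    intro m hm w hw
    obtain ⟨m, rfl⟩ := Nat.exists_eq_add_of_le' (show 1 ≤ m by omega)
    rcases w with _ | ⟨x, w⟩
    · rfl
    · simp only [logIter]
      congr 1
      refine Finset.sum_congr rfl fun k hk => ?_
      rw [tpow_congr_of_two_le (logIter_nil g m) (logIter_nil g n) (n := n + 1)
        (fun v hv => ih m (by omega) v (by omega)) (Finset.mem_Ico.1 hk).1 hw]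

theorem exists_texp_eq {g : TensorSeries ι} (hg : g [] = 1) :
    ∃ a : TensorSeries ι, a [] = 0 ∧ texp a = g := by
  set a : TensorSeries ι := fun w => logIter g w.length w with ha
  have ha0 : a [] = 0 := rfl
  refine ⟨a, ha0, funext fun w => ?_⟩
  rcases w with _ | ⟨x, w⟩
  · simp [texp, tpow, unit, hg]
  rw [texp_eq_add a (by simp)]
  have h1 : a (x :: w) = g (x :: w) - ∑ k ∈ Finset.Ico 2 ((x :: w).length + 1),
      ((k.factorial : ℝ))⁻¹ * tpow (logIter g w.length) k (x :: w) := rfl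
  rw [h1, sub_add_eq_add_sub, sub_eq_iff_eq_add]
  congr 1
  refine Finset.sum_congr rfl fun k hk => ?_
  rw [tpow_congr_of_two_le ha0 (logIter_nil g w.length) (n := w.length + 1)
    (fun v hv => (logIter_stable g v.length w.length (by omega) v le_rfl).symm)
    (Finset.mem_Ico.1 hk).1 (by simp)]

theorem texp_smul_eq {a : TensorSeries ι} (ha : a [] = 0) (c : ℝ) {w : List ι} {n : ℕ}
    (hn : w.length ≤ n) : texp (fun v => c * a v) w =
      ∑ k ∈ Finset.range (n + 1), c ^ k * ((k.factorial : ℝ)⁻¹ * tpow a k w) := by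
  rw [texp_eq (by simp [ha]) hn]
  refine Finset.sum_congr rfl fun k _ => ?_
  rw [tpow_smul]
  ring

/-- All terms are powers of the same series, so this is the binomial theorem. It makes `exp (m a)`
the `m`-fold product of `exp a` without any Baker–Campbell–Hausdorff formula. -/
theorem texp_add_one_smul {a : TensorSeries ι} (ha : a [] = 0) (c : ℝ) :
    texp (fun v => (c + 1) * a v) = tmul (texp fun v => c * a v) (texp a) := by
  funext w
  set n := w.length with hn
  have h1 : tmul (texp fun v => c * a v) (texp a) w =
      ∑ i ∈ Finset.range (n + 1), ∑ j ∈ Finset.range (n + 1),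
        c ^ i * (i.factorial : ℝ)⁻¹ * (j.factorial : ℝ)⁻¹ * tpow a (i + j) w := by
    have e1 : ∀ k, texp (fun v => c * a v) (w.take k) = ∑ i ∈ Finset.range (n + 1),
        c ^ i * ((i.factorial : ℝ)⁻¹ * tpow a i (w.take k)) := fun k =>
      texp_smul_eq ha c (by simp [hn])
    have e2 : ∀ k, texp a (w.drop k) = ∑ j ∈ Finset.range (n + 1),
        (j.factorial : ℝ)⁻¹ * tpow a j (w.drop k) := fun k => texp_eq ha (by simp [hn])
    simp only [tmul, e1, e2, Finset.sum_mul_sum, tpow_add]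
    simp only [Finset.mul_sum]
    rw [Finset.sum_comm]
    refine Finset.sum_congr rfl fun i _ => ?_
    rw [Finset.sum_comm]
    refine Finset.sum_congr rfl fun j _ => Finset.sum_congr rfl fun k _ => ?_
    ring
  rw [h1, texp_smul_eq ha (c + 1) le_rfl]
  have h2 : ∀ i ∈ Finset.range (n + 1), ∑ j ∈ Finset.range (n + 1),
        c ^ i * (i.factorial : ℝ)⁻¹ * (j.factorial : ℝ)⁻¹ * tpow a (i + j) w =
      ∑ j ∈ Finset.range (n + 1 - i),
        c ^ i * (i.factorial : ℝ)⁻¹ * (j.factorial : ℝ)⁻¹ * tpow a (i + j) w := by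
    intro i hi
    refine (Finset.sum_subset (Finset.range_mono (by omega)) fun j _ hj => ?_).symm
    rw [tpow_eq_zero ha _ _ (by simp at hj; omega), mul_zero]
  rw [Finset.sum_congr rfl h2, ← Finset.sum_range_diag_flip (n + 1) fun i j =>
    c ^ i * (i.factorial : ℝ)⁻¹ * (j.factorial : ℝ)⁻¹ * tpow a (i + j) w]
  refine Finset.sum_congr rfl fun k _ => ?_
  rw [add_pow, Finset.sum_mul]
  refine Finset.sum_congr rfl fun i hi => ?_
  have hi : i ≤ k := Nat.lt_succ_iff.1 (Finset.mem_range.1 hi)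
  rw [Nat.add_sub_cancel' hi, Nat.cast_choose ℝ hi, one_pow]
  have := Nat.factorial_ne_zero k
  field_simp

theorem isShuffleCharacter_texp_nsmul {a : TensorSeries ι} (ha : a [] = 0)
    (hg : IsShuffleCharacter (texp a)) (m : ℕ) :
    IsShuffleCharacter (texp fun v => (m : ℝ) * a v) := by
  induction m with
  | zero =>
    convert isShuffleCharacter_unit using 1
    funext w
    rw [texp_smul_eq ha _ le_rfl, Finset.sum_range_succ', Finset.sum_eq_zero]
    · simp [tpow]
    · simp
  | succ m ih =>
    push_cast
    rw [texp_add_one_smul ha]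
    exact ih.tmul hg

open Polynomial in
/-- The logarithm of a character of the shuffle algebra vanishes on shuffles. -/
theorem shuffleEval_log {a : TensorSeries ι} (ha : a [] = 0) (hg : IsShuffleCharacter (texp a))
    {u v : List ι} (hu : u ≠ []) (hv : v ≠ []) : shuffleEval u v a = 0 := by
  set n := u.length + v.length with hn
  have hn0 : 0 < n := by have := List.length_pos_iff.2 hu; omega
  let pol : (ℕ → ℝ) → ℝ[X] := fun c =>
    ∑ k ∈ Finset.range (n + 1), C ((k.factorial : ℝ)⁻¹ * c k) * X ^ k
  have heval : ∀ c x, (pol c).eval x =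
      ∑ k ∈ Finset.range (n + 1), x ^ k * ((k.factorial : ℝ)⁻¹ * c k) := fun c x => by
    simp only [pol, eval_finsetSum, eval_mul, eval_C, eval_pow, eval_X, mul_comm]
  have hcoeff : ∀ c, ∀ k ≤ n, (pol c).coeff k = (k.factorial : ℝ)⁻¹ * c k := fun c k hk => by
    simp only [pol, finsetSum_coeff, coeff_C_mul, coeff_X_pow, mul_ite, mul_one, mul_zero]
    rw [Finset.sum_ite_eq, if_pos (Finset.mem_range.2 (by omega))]
  -- `P` is the shuffle relation of `exp (x a)` at `u`, `v` as a polynomial in `x`; it vanishes at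
  -- every natural number.
  set P : ℝ[X] := pol (fun k => shuffleEval u v (tpow a k)) -
    pol (fun k => tpow a k u) * pol (fun k => tpow a k v) with hP
  have hroot : ∀ m : ℕ, P.IsRoot (m : ℝ) := by
    intro m
    rw [IsRoot.def, hP, eval_sub, eval_mul, heval, heval, heval,
      ← texp_smul_eq ha (m : ℝ) (w := u) (by omega), ← texp_smul_eq ha (m : ℝ) (w := v) (by omega),
      ← (isShuffleCharacter_texp_nsmul ha hg m).shuffle u v, sub_eq_zero]
    rw [shuffleEval_congr (b := fun w => ∑ k ∈ Finset.range (n + 1),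
      ((m : ℝ) ^ k * (k.factorial : ℝ)⁻¹) * tpow a k w), shuffleEval_sum]
    · simp only [mul_assoc]
    · intro w hw
      rw [texp_smul_eq ha (m : ℝ) (n := n) (by omega)]
      simp only [mul_assoc]
  have hP0 : P = 0 := eq_zero_of_infinite_isRoot P
    ((Set.infinite_range_of_injective (Nat.cast_injective (R := ℝ))).mono
      (by rintro _ ⟨m, rfl⟩; exact hroot m))
  -- The linear coefficient of the first part is `shuffleEval u v a`. The product has none, because
  -- both factors lack a constant term at non-empty words.
  have h1 : P.coeff 1 = 0 := by rw [hP0, coeff_zero]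
  have hu0 : tpow a 0 u = 0 := by
    obtain ⟨x, w, rfl⟩ := List.exists_cons_of_ne_nil hu
    rfl
  have hv0 : tpow a 0 v = 0 := by
    obtain ⟨x, w, rfl⟩ := List.exists_cons_of_ne_nil hv
    rfl
  rw [hP, coeff_sub, mul_coeff_one, hcoeff _ 1 hn0, hcoeff _ 0 (by omega),
    hcoeff _ 0 (by omega), tpow_one, hu0, hv0] at h1
  simpa using h1

end TensorSeries

/-! ### Dynkin's operator -/

section Dynkin

variable {ι : Type}

/-- Weighted sums over the splittings `w = w₁ w₂` of the shuffles of `w₁` and of the reversal of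
`w₂`, with weights `c |w₁|`. -/
def splitShuffle (c : ℕ → ℝ) (w : List ι) (a : TensorSeries ι) : ℝ :=
  ∑ k ∈ Finset.range (w.length + 1), c k * shuffleEval (w.take k) (w.drop k).reverse a

/-- A shuffle of a prefix of `w` with the reversal of the complementary suffix starts either with
the first or with the last letter of `w`. Sorting by that letter leaves the same kind of sum for `w`
without it. -/
theorem splitShuffle_cons_concat (c : ℕ → ℝ) (x y : ι) (w : List ι) (a : TensorSeries ι) :
    splitShuffle c (x :: (w ++ [y])) a =
      splitShuffle (fun k => c (k + 1)) (w ++ [y]) (fun v => a (x :: v)) +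
        splitShuffle c (x :: w) (fun v => a (y :: v)) := by
  simp only [splitShuffle, List.length_cons, List.length_append, List.length_nil, zero_add]
  rw [Finset.sum_range_succ' _ (w.length + 1 + 1), Finset.sum_range_succ _ (w.length + 1),
    Finset.sum_range_succ _ (w.length + 1), Finset.sum_range_succ' _ (w.length + 1)]
  have hmid : ∀ k ∈ Finset.range (w.length + 1),
      c (k + 1) * shuffleEval ((x :: (w ++ [y])).take (k + 1))
        ((x :: (w ++ [y])).drop (k + 1)).reverse a =
      c (k + 1) * shuffleEval ((w ++ [y]).take k) ((w ++ [y]).drop k).reverse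
        (fun v => a (x :: v)) +
      c (k + 1) * shuffleEval ((x :: w).take (k + 1)) ((x :: w).drop (k + 1)).reverse
        (fun v => a (y :: v)) := by
    intro k hk
    have hk : k ≤ w.length := Nat.lt_succ_iff.1 (Finset.mem_range.1 hk)
    simp only [List.take_succ_cons, List.drop_succ_cons]
    rw [List.drop_append_of_le_length hk, List.take_append_of_le_length hk, List.reverse_append]
    simp only [List.reverse_cons, List.reverse_nil, List.nil_append, List.singleton_append]
    rw [shuffleEval_cons_cons, mul_add]
  rw [Finset.sum_congr rfl hmid, Finset.sum_add_distrib]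
  have e1 : (w ++ [y]).take (w.length + 1) = w ++ [y] := List.take_of_length_le (by simp)
  have e2 : (w ++ [y]).drop (w.length + 1) = [] := List.drop_of_length_le (by simp)
  simp only [List.take_succ_cons, List.drop_succ_cons, e1, e2, List.reverse_nil,
    shuffleEval_nil_right, List.take_zero, List.drop_zero, shuffleEval_nil_left,
    List.reverse_cons, List.reverse_append, List.nil_append, List.cons_append]
  ring

theorem List.exists_cons_concat {w : List ι} {n : ℕ} (hw : w.length = n + 2) :
    ∃ x v y, w = x :: (v ++ [y]) := by
  obtain ⟨x, w', rfl⟩ := List.exists_cons_of_length_eq_add_one hw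
  have hw' : w' ≠ [] := by rintro rfl; simp at hw
  exact ⟨x, w'.dropLast, w'.getLast hw', by rw [List.dropLast_append_getLast]⟩

theorem splitShuffle_add_mul (c c' : ℕ → ℝ) (r : ℝ) (w : List ι) (a : TensorSeries ι) :
    splitShuffle (fun k => c k + r * c' k) w a = splitShuffle c w a + r * splitShuffle c' w a := by
  simp only [splitShuffle, add_mul, Finset.sum_add_distrib, Finset.mul_sum, mul_assoc]

theorem splitShuffle_mul (c : ℕ → ℝ) (r : ℝ) (w : List ι) (a : TensorSeries ι) :
    splitShuffle (fun k => r * c k) w a = r * splitShuffle c w a := by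
  simp only [splitShuffle, Finset.mul_sum, mul_assoc]

/-- The antipode identity for the shuffle algebra. -/
theorem splitShuffle_antipode (n : ℕ) : ∀ (w : List ι) (a : TensorSeries ι), w.length = n + 1 →
    splitShuffle (fun k => (-1) ^ k) w a = 0 := by
  induction n with
  | zero =>
    intro w a hw
    obtain ⟨x, rfl⟩ := List.length_eq_one_iff.1 hw
    simp [splitShuffle, Finset.sum_range_succ, shuffleEval_nil_left, shuffleEval_nil_right]
  | succ n ih =>
    intro w a hw
    obtain ⟨x, v, y, rfl⟩ := List.exists_cons_concat hw
    rw [splitShuffle_cons_concat, ih (x :: v) _ (by simpa using hw)]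
    have := splitShuffle_mul (fun k => (-1) ^ k) (-1) (v ++ [y]) (fun w => a (x :: w))
    rw [ih _ _ (by simpa using hw)] at this
    simp only [pow_succ, mul_comm _ (-1 : ℝ)]
    rw [this]
    simp

/-- The pairing of `a` with the adjoint of Dynkin's operator at `w`. -/
def dynkinEval (w : List ι) (a : TensorSeries ι) : ℝ :=
  (-1) ^ w.length * splitShuffle (fun k => (-1) ^ k * k) w a

theorem dynkinEval_singleton (x : ι) (a : TensorSeries ι) : dynkinEval [x] a = a [x] := by
  simp [dynkinEval, splitShuffle, Finset.sum_range_succ, shuffleEval_nil_right]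

/-- This is `[e_x, Q] = e_x ⊗ Q - Q ⊗ e_x` read off at the first and the last letter. Shifting the
weight from `k` to `k + 1` creates an extra alternating sum, which the antipode identity removes. -/
theorem dynkinEval_cons_concat (x y : ι) (w : List ι) (a : TensorSeries ι) :
    dynkinEval (x :: (w ++ [y])) a = dynkinEval (w ++ [y]) (fun v => a (x :: v)) -
      dynkinEval (x :: w) (fun v => a (y :: v)) := by
  have h0 := splitShuffle_antipode w.length (w ++ [y]) (fun v => a (x :: v)) (by simp)
  have h1 := splitShuffle_add_mul (fun k => (-1) * ((-1) ^ k * k)) (fun k => (-1) ^ k) (-1)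
    (w ++ [y]) (fun v => a (x :: v))
  rw [h0, splitShuffle_mul] at h1
  have h2 : (fun k : ℕ => ((-1 : ℝ)) ^ (k + 1) * ((k + 1 : ℕ) : ℝ)) =
      fun k : ℕ => (-1 : ℝ) * ((-1) ^ k * k) + (-1) * (-1) ^ k := by
    funext k; push_cast; ring
  simp only [dynkinEval, splitShuffle_cons_concat]
  rw [h2, h1]
  simp only [List.length_cons, List.length_append, List.length_nil]
  ring

/-- The splitting with empty prefix has weight zero and the proper ones are shuffles of non-empty
words. What remains is the whole word with weight `w.length`: the Dynkin–Specht–Wever criterion. -/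
theorem dynkinEval_of_shuffle {a : TensorSeries ι}
    (ha : ∀ u v, u ≠ [] → v ≠ [] → shuffleEval u v a = 0) (w : List ι) :
    dynkinEval w a = w.length * a w := by
  rw [dynkinEval, splitShuffle, Finset.sum_range_succ, Finset.sum_eq_zero]
  · simp only [List.take_length, List.drop_length, List.reverse_nil, shuffleEval_nil_right,
      zero_add]
    have : ((-1 : ℝ)) ^ w.length * (-1) ^ w.length = 1 := by
      rw [← mul_pow]; simp
    linear_combination (w.length * a w) * this
  · intro k hk
    have hk := Finset.mem_range.1 hk
    rcases Nat.eq_zero_or_pos k with rfl | hk0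
    · simp
    · rw [ha, mul_zero]
      · rw [← List.length_pos_iff]; simp; omega
      · rw [← List.length_pos_iff]; simp; omega

theorem coeff_basisTensor [DecidableEq ι] (v w : List ι) :
    (basisTensor v).coeff (FreeMonoid.ofList w) = if v = w then 1 else 0 := by
  classical
  rw [basisTensor, MonoidAlgebra.coeff_single, Finsupp.single_apply]
  exact if_congr FreeMonoid.ofList.injective.eq_iff rfl rfl

theorem coeff_basisTensor_mul [DecidableEq ι] (x y : ι) (w : List ι) (P : TensorPoly ι) :
    (basisTensor [x] * P).coeff (FreeMonoid.ofList (y :: w)) =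
      if x = y then P.coeff (FreeMonoid.ofList w) else 0 := by
  rw [basisTensor]
  split_ifs with h
  · subst h
    rw [MonoidAlgebra.coeff_single_mul_eq_mul_coeff (FreeMonoid.ofList w), one_mul]
    intro m _
    constructor
    · intro h; exact List.tail_eq_of_cons_eq h
    · rintro rfl; rfl
  · refine MonoidAlgebra.coeff_single_mul_of_forall_mul_ne _ _ fun m hm => h ?_
    exact List.head_eq_of_cons_eq hm

theorem coeff_mul_basisTensor [DecidableEq ι] (x y : ι) (w : List ι) (P : TensorPoly ι) :
    (P * basisTensor [x]).coeff (FreeMonoid.ofList (w ++ [y])) =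
      if x = y then P.coeff (FreeMonoid.ofList w) else 0 := by
  rw [basisTensor]
  split_ifs with h
  · subst h
    rw [MonoidAlgebra.coeff_mul_single_eq_coeff_mul (FreeMonoid.ofList w), mul_one]
    intro m _
    constructor
    · intro h; exact (List.append_inj' h rfl).1
    · rintro rfl; rfl
  · refine MonoidAlgebra.coeff_mul_single_of_forall_mul_ne _ _ fun m hm => h ?_
    simpa using (List.append_inj' hm rfl).2

attribute [local instance] LieRing.ofAssociativeRing

variable [Fintype ι]

/-- Dynkin's operator `e_{i₁} ⊗ ⋯ ⊗ e_{iₙ} ↦ [e_{i₁}, [⋯, e_{iₙ}]]` on the component of level `n`. -/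
noncomputable def dynkin : ℕ → TensorSeries ι → TensorPoly ι
  | 0, _ => 0
  | 1, a => ∑ x, a [x] • basisTensor [x]
  | n + 2, a => ∑ x, ⁅basisTensor [x], dynkin (n + 1) (fun w => a (x :: w))⁆

theorem dynkin_mem (n : ℕ) : ∀ a : TensorSeries ι, dynkin n a ∈
    LieSubalgebra.lieSpan ℝ (TensorPoly ι) (Set.range fun i : ι => basisTensor [i]) := by
  have hgen : ∀ x : ι, basisTensor [x] ∈
      LieSubalgebra.lieSpan ℝ (TensorPoly ι) (Set.range fun i : ι => basisTensor [i]) :=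
    fun x => LieSubalgebra.subset_lieSpan ⟨x, rfl⟩
  induction n with
  | zero => intro a; exact zero_mem _
  | succ n ih =>
    intro a
    rcases n with _ | n
    · exact sum_mem fun x _ => (LieSubalgebra.lieSpan ℝ (TensorPoly ι) _).smul_mem _ (hgen x)
    · exact sum_mem fun x _ => (LieSubalgebra.lieSpan ℝ (TensorPoly ι) _).lie_mem (hgen x) (ih _)

/-- The recursion defining nested commutators matches `dynkinEval_cons_concat`, so membership in the
Lie algebra, clear for `dynkin`, transfers to a formula computable from shuffles. -/
theorem coeff_dynkin (n : ℕ) : ∀ (a : TensorSeries ι) (w : List ι),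
    (dynkin (n + 1) a).coeff (FreeMonoid.ofList w) =
      if w.length = n + 1 then dynkinEval w a else 0 := by
  classical
  induction n with
  | zero =>
    intro a w
    simp only [dynkin, MonoidAlgebra.coeff_sum, Finsupp.finsetSum_apply,
      MonoidAlgebra.coeff_smul_apply, coeff_basisTensor, smul_eq_mul, mul_ite, mul_one, mul_zero]
    split_ifs with hw
    · obtain ⟨x, rfl⟩ := List.length_eq_one_iff.1 hw
      simp [dynkinEval_singleton]
    · exact Finset.sum_eq_zero fun x _ => if_neg (by rintro rfl; simp at hw)
  | succ n ih =>
    intro a w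
    simp only [dynkin, MonoidAlgebra.coeff_sum, Finsupp.finsetSum_apply, Ring.lie_def,
      MonoidAlgebra.coeff_sub, Finsupp.sub_apply, Finset.sum_sub_distrib]
    rcases Nat.lt_or_ge w.length 2 with hlt | hge
    · rw [if_neg (by omega)]
      rcases w with _ | ⟨y, w⟩
      · have h1 : ∀ x, (basisTensor [x] * dynkin (n + 1) fun w => a (x :: w)).coeff
            (FreeMonoid.ofList []) = 0 := fun x =>
          MonoidAlgebra.coeff_single_mul_of_forall_mul_ne _ _ fun m hm => by
            simpa using congrArg FreeMonoid.length hm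
        have h2 : ∀ x, ((dynkin (n + 1) fun w => a (x :: w)) * basisTensor [x]).coeff
            (FreeMonoid.ofList []) = 0 := fun x =>
          MonoidAlgebra.coeff_mul_single_of_forall_mul_ne _ _ fun m hm => by
            simpa using congrArg FreeMonoid.length hm
        rw [Finset.sum_eq_zero fun x _ => h1 x, Finset.sum_eq_zero fun x _ => h2 x, sub_zero]
      · obtain rfl : w = [] := List.eq_nil_of_length_eq_zero (by simp only [List.length_cons] at hlt; omega)
        have h2 : ∀ x, ((dynkin (n + 1) fun w => a (x :: w)) * basisTensor [x]).coeff
            (FreeMonoid.ofList [y]) = if x = y then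
              (dynkin (n + 1) fun w => a (x :: w)).coeff (FreeMonoid.ofList []) else 0 := fun x =>
          coeff_mul_basisTensor x y [] _
        simp only [h2, coeff_basisTensor_mul, ih]
        simp
    · obtain ⟨x, v, y, rfl⟩ := List.exists_cons_concat (show w.length = (w.length - 2) + 2 by omega)
      have h2 : ∀ z, ((dynkin (n + 1) fun w => a (z :: w)) * basisTensor [z]).coeff
            (FreeMonoid.ofList (x :: (v ++ [y]))) = if z = y then
              (dynkin (n + 1) fun w => a (z :: w)).coeff (FreeMonoid.ofList (x :: v)) else 0 :=
        fun z => coeff_mul_basisTensor z y (x :: v) _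
      simp only [h2, coeff_basisTensor_mul, ih, Finset.sum_ite_eq', Finset.mem_univ, if_true,
        List.length_cons, List.length_append, List.length_nil, zero_add, Nat.add_right_cancel_iff]
      split_ifs with h
      · rw [dynkinEval_cons_concat]
      · simp

theorem coeff_level (a : TensorSeries ι) (n : ℕ) (w : List ι) :
    (level a n).coeff (FreeMonoid.ofList w) = if w.length = n then a w else 0 := by
  classical
  simp only [level, MonoidAlgebra.coeff_sum, Finsupp.finsetSum_apply,
    MonoidAlgebra.coeff_smul_apply, coeff_basisTensor, smul_eq_mul, mul_ite, mul_one, mul_zero]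
  split_ifs with hw
  · subst hw
    rw [Finset.sum_eq_single (fun k => w.get k)]
    · rw [if_pos (List.ofFn_get w), List.ofFn_get]
    · intro v _ hv
      refine if_neg fun h => hv ?_
      apply List.ofFn_injective
      rw [h, List.ofFn_get]
    · simp
  · exact Finset.sum_eq_zero fun v _ => if_neg (by rintro rfl; simp at hw)

/-- Series which vanish on shuffles of non-empty words are Lie series. -/
theorem isLie_of_shuffle {a : TensorSeries ι} (ha0 : a [] = 0)
    (ha : ∀ u v, u ≠ [] → v ≠ [] → shuffleEval u v a = 0) : IsLie a := by
  intro n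
  have hext : ∀ P Q : TensorPoly ι,
      (∀ w : List ι, P.coeff (FreeMonoid.ofList w) = Q.coeff (FreeMonoid.ofList w)) → P = Q :=
    fun P Q h => MonoidAlgebra.ext (Finsupp.ext h)
  rcases n with _ | n
  · rw [hext (level a 0) 0 fun w => ?_]
    · exact zero_mem _
    · rw [coeff_level]
      split_ifs with hw
      · simp [List.eq_nil_of_length_eq_zero hw, ha0]
      · simp
  · have : level a (n + 1) = ((n + 1 : ℕ) : ℝ)⁻¹ • dynkin (n + 1) a := by
      refine hext _ _ fun w => ?_
      rw [coeff_level, MonoidAlgebra.coeff_smul_apply, coeff_dynkin, smul_eq_mul]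
      split_ifs with hw
      · rw [dynkinEval_of_shuffle ha, hw]
        have : ((n + 1 : ℕ) : ℝ) ≠ 0 := by positivity
        field_simp
      · simp
    rw [this]
    exact (LieSubalgebra.lieSpan ℝ (TensorPoly ι) _).smul_mem _ (dynkin_mem _ _)

/-- Characters of the shuffle algebra are exponentials of Lie series. -/
theorem IsShuffleCharacter.isGroupLike {g : TensorSeries ι} (hg : IsShuffleCharacter g) :
    IsGroupLike g := by
  obtain ⟨a, ha0, rfl⟩ := exists_texp_eq hg.nil
  exact ⟨a, isLie_of_shuffle ha0 fun u v hu hv => shuffleEval_log ha0 hg hu hv, rfl⟩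

end Dynkin

/-! ### The corrected second level -/

section Corrected

variable {ι : Type} {p T : ℝ} {X : ℝ → ι → ℝ} {X2 : ℝ → ℝ → Matrix ι ι ℝ}

theorem roughBracket_apply (t : ℝ) (i j : ι) : roughBracket X X2 t i j =
    (X t i - X 0 i) * (X t j - X 0 j) - (X2 0 t i j + X2 0 t j i) := by
  simp [roughBracket, Matrix.vecMulVec_apply]

theorem roughBracket_symm (t : ℝ) (i j : ι) :
    roughBracket X X2 t i j = roughBracket X X2 t j i := by
  rw [roughBracket_apply, roughBracket_apply]
  ring

theorem correctedLift_apply (s t : ℝ) (i j : ι) : correctedLift X X2 s t i j =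
    X2 s t i j + 1 / 2 * (roughBracket X X2 t i j - roughBracket X X2 s i j) := by
  simp [correctedLift]

variable [Fintype ι]

theorem IsRoughPath.of_controlled (hp : 0 < p) {h : ℝ → ℝ} (hh : IsControl T h)
    (hXc : ∀ i, ContinuousOn (fun t => X t i) (Set.Icc 0 T))
    (hXb : ∀ i, Controlled T h (1 / p) fun s t => X t i - X s i)
    (hX2c : ∀ i j, ContinuousOn (fun q : ℝ × ℝ => X2 q.1 q.2 i j) (timeSimplex T))
    (hX2b : ∀ i j, Controlled T h (2 / p) fun s t => X2 s t i j)
    (hchen : ∀ s u t : ℝ, 0 ≤ s → s ≤ u → u ≤ t → t ≤ T → ∀ i j : ι,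
      X2 s t i j = X2 s u i j + X2 u t i j + (X u i - X s i) * (X t j - X u j)) :
    IsRoughPath p T X X2 where
  continuousOn_path := continuousOn_pi.2 hXc
  var_path := HasFiniteVar.of_controlled hh hp fun i => by simpa using hXb i
  continuousOn_lift := continuousOn_pi.2 fun i => continuousOn_pi.2 fun j => hX2c i j
  var_lift := HasFiniteVar.of_controlled hh (by positivity) fun q => by
    simpa using hX2b q.1 q.2
  chen := hchen

theorem IsRoughPath.continuousOn_apply (hX : IsRoughPath p T X X2) (i : ι) :
    ContinuousOn (fun t => X t i) (Set.Icc 0 T) :=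
  (continuous_apply i).comp_continuousOn hX.continuousOn_path

theorem IsRoughPath.continuousOn_lift_apply (hX : IsRoughPath p T X X2) (i j : ι) :
    ContinuousOn (fun q : ℝ × ℝ => X2 q.1 q.2 i j) (timeSimplex T) :=
  (continuous_apply_apply i j).comp_continuousOn hX.continuousOn_lift

theorem IsRoughPath.roughBracket_sub (hX : IsRoughPath p T X X2) {s t : ℝ} (hs : 0 ≤ s)
    (hst : s ≤ t) (ht : t ≤ T) (i j : ι) :
    roughBracket X X2 t i j - roughBracket X X2 s i j =
      (X t i - X s i) * (X t j - X s j) - (X2 s t i j + X2 s t j i) := by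
  rw [roughBracket_apply, roughBracket_apply, hX.chen 0 s t le_rfl hs hst ht i j,
    hX.chen 0 s t le_rfl hs hst ht j i]
  ring

theorem IsRoughPath.continuousOn_roughBracket (hX : IsRoughPath p T X X2) (i j : ι) :
    ContinuousOn (fun t => roughBracket X X2 t i j) (Set.Icc 0 T) := by
  simp only [roughBracket_apply]
  have h0 : ∀ i j, ContinuousOn (fun t => X2 0 t i j) (Set.Icc 0 T) := fun i j =>
    (hX.continuousOn_lift_apply i j).comp (f := fun t => ((0 : ℝ), t)) (by fun_prop)
      fun t ht => ⟨le_rfl, ht.1, ht.2⟩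
  exact (((hX.continuousOn_apply i).sub continuousOn_const).mul
    ((hX.continuousOn_apply j).sub continuousOn_const)).sub ((h0 i j).add (h0 j i))

theorem IsRoughPath.controlled_roughBracket (hX : IsRoughPath p T X X2) (hp : 0 < p) {h : ℝ → ℝ}
    (hh : IsControl T h) (hXb : ∀ i, Controlled T h (1 / p) fun s t => X t i - X s i)
    (hX2b : ∀ i j, Controlled T h (2 / p) fun s t => X2 s t i j) (i j : ι) :
    Controlled T h (2 / p) fun s t => roughBracket X X2 t i j - roughBracket X X2 s i j := by
  have h1 := (hXb i).mul hh (by positivity) (by positivity) (hXb j)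
  rw [← add_div, one_add_one_eq_two] at h1
  exact (h1.sub ((hX2b i j).add (hX2b j i))).congr fun s t hs hst ht =>
    hX.roughBracket_sub hs hst ht i j

/-- The bracket measures how far the second level is from having symmetric part `½ X ⊗ X`; adding
half of it closes that gap. -/
theorem IsRoughPath.correctedLift_symm (hX : IsRoughPath p T X X2) {s t : ℝ} (hs : 0 ≤ s)
    (hst : s ≤ t) (ht : t ≤ T) (i j : ι) :
    correctedLift X X2 s t i j + correctedLift X X2 s t j i =
      (X t i - X s i) * (X t j - X s j) := by
  rw [correctedLift_apply, correctedLift_apply, hX.roughBracket_sub hs hst ht i j,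
    hX.roughBracket_sub hs hst ht j i]
  ring

theorem IsRoughPath.corrected (hX : IsRoughPath p T X X2) (hp : 0 < p) (hT : 0 ≤ T) :
    IsRoughPath p T X (correctedLift X X2) := by
  obtain ⟨h, hh, h1, h2⟩ := hX.exists_control hp hT
  refine .of_controlled hp hh hX.continuousOn_apply h1 (fun i j => ?_) (fun i j => ?_) ?_
  · simp only [correctedLift_apply]
    have hb := hX.continuousOn_roughBracket i j
    exact (hX.continuousOn_lift_apply i j).add (continuousOn_const.mul
      ((continuousOn_snd_simplex hb).sub (continuousOn_fst_simplex hb)))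
  · simp only [correctedLift_apply]
    exact (h2 i j).add ((hX.controlled_roughBracket hp hh h1 h2 i j).const_mul _)
  · intro s u t hs hsu hut ht i j
    rw [correctedLift_apply, correctedLift_apply, correctedLift_apply,
      hX.chen s u t hs hsu hut ht]
    ring

/-- The series with components `x` of level one and `A` of level two. -/
def levelTwoSeries (x : ι → ℝ) (A : ι → ι → ℝ) : TensorSeries ι
  | [i] => x i
  | [i, j] => A i j
  | _ => 0

/-- The logarithm is taken to be `x + (M - ½ x ⊗ x)`. Its second component is antisymmetric by `hM`,
so it vanishes on the shuffle of two letters, and the exponential restores `½ x ⊗ x`. -/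
theorem exists_isGroupLike (x : ι → ℝ) (M : ι → ι → ℝ) (hM : ∀ i j, M i j + M j i = x i * x j) :
    ∃ g : TensorSeries ι, IsGroupLike g ∧ (∀ i, g [i] = x i) ∧ ∀ i j, g [i, j] = M i j := by
  set a := levelTwoSeries x fun i j => M i j - x i * x j / 2 with ha
  have h3 : ∀ w : List ι, 2 < w.length → a w = 0 := fun w hw => by
    match w, hw with
    | _ :: _ :: _ :: _, _ => rfl
  refine ⟨texp a, ⟨a, isLie_of_shuffle rfl fun u v hu hv => ?_, rfl⟩, fun i => ?_, fun i j => ?_⟩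
  · have hu' := List.length_pos_iff.2 hu
    have hv' := List.length_pos_iff.2 hv
    by_cases hl : u.length + v.length = 2
    · obtain ⟨i, rfl⟩ := List.length_eq_one_iff.1 (show u.length = 1 by omega)
      obtain ⟨j, rfl⟩ := List.length_eq_one_iff.1 (show v.length = 1 by omega)
      rw [shuffleEval_cons_cons, shuffleEval_nil_left, shuffleEval_nil_right]
      simp only [ha, levelTwoSeries]
      linear_combination hM i j
    · rw [shuffleEval_congr (b := fun w => 0 * a w), shuffleEval_mul, zero_mul]
      intro w hw
      rw [h3 w (by omega), mul_zero]
  · rw [texp_eq_add a (by simp)]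
    simp [ha, levelTwoSeries]
  · rw [texp_eq_add a (by simp)]
    have : tpow a 2 [i, j] = x i * x j := by
      rw [tpow, tpow_one]
      simp [tmul_cons, tmul_nil, ha, levelTwoSeries]
    rw [show ([i, j] : List ι).length + 1 = 3 from rfl, Nat.Ico_succ_singleton,
      Finset.sum_singleton, this]
    simp only [ha, levelTwoSeries, Nat.factorial]
    push_cast
    ring

theorem IsRoughPath.isWeaklyGeometric_corrected (hX : IsRoughPath p T X X2) (hp : 0 < p)
    (hT : 0 ≤ T) : IsWeaklyGeometric p T X (correctedLift X X2) where
  toIsRoughPath := hX.corrected hp hT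
  mem_group t ht := exists_isGroupLike (fun i => X t i - X 0 i) (correctedLift X X2 0 t)
    fun i j => hX.correctedLift_symm le_rfl ht.1 ht.2 i j

end Corrected

/-! ### Young integrals -/

theorem IsControl.exists_mesh {T θ : ℝ} (hT : 0 ≤ T) {h : ℝ → ℝ} (hh : IsControl T h)
    (hθ : 1 < θ) (C : ℝ) {ε : ℝ} (hC : 0 ≤ C) (hε : 0 < ε) :
    ∃ δ > 0, ∀ (s t : ℝ) (n : ℕ) (u : ℕ → ℝ), 0 ≤ s → t ≤ T → IsPartitionOf s t n u →
      (∀ k < n, u (k + 1) - u k < δ) →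
      ∑ k ∈ Finset.range n, C * (h (u (k + 1)) - h (u k)) ^ θ < ε := by
  obtain ⟨η, hη, hηε⟩ : ∃ η > 0, C * (η ^ (θ - 1) * (h T - h 0)) < ε := by
    have : Tendsto (fun η : ℝ => C * (η ^ (θ - 1) * (h T - h 0))) (𝓝[>] 0) (𝓝 0) := by
      have h1 : Tendsto (fun η : ℝ => η ^ (θ - 1)) (𝓝[>] 0) (𝓝 0) := by
        have := (Real.continuousAt_rpow_const 0 (θ - 1) (Or.inr (by linarith))).tendsto
        rw [Real.zero_rpow (by linarith)] at this
        exact this.mono_left nhdsWithin_le_nhds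
      simpa using (h1.mul_const (h T - h 0)).const_mul C
    obtain ⟨η, h1, h2⟩ := ((this.eventually (gt_mem_nhds hε)).and self_mem_nhdsWithin).exists
    exact ⟨η, h2, h1⟩
  have huc := isCompact_Icc.uniformContinuousOn_of_continuous hh.cont
  obtain ⟨δ, hδ, hd⟩ := Metric.uniformContinuousOn_iff.1 huc η hη
  refine ⟨δ, hδ, fun s t n u hs ht hu hmesh => lt_of_le_of_lt ?_ hηε⟩
  rw [← Finset.mul_sum]
  refine mul_le_mul_of_nonneg_left ?_ hC
  have hmem : ∀ k ≤ n, u k ∈ Set.Icc 0 T := fun k hk =>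
    ⟨hs.trans (hu.mem hk).1, (hu.mem hk).2.trans ht⟩
  have hinc : ∀ k < n, u k ≤ u (k + 1) := fun k hk => (hu.2.2 k hk).le
  refine (sum_rpow_le (η := η) _ hθ (fun k hk => ?_) fun k hk => ?_).trans ?_
  · have hk := Finset.mem_range.1 hk
    exact hh.sub_nonneg (hmem k hk.le).1 (hinc k hk) (hmem (k + 1) hk).2
  · have hk := Finset.mem_range.1 hk
    have := hd _ (hmem (k + 1) hk) _ (hmem k hk.le) (by
      rw [Real.dist_eq, abs_of_nonneg (by linarith [hinc k hk])]
      exact hmesh k hk)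
    rw [Real.dist_eq] at this
    exact (le_abs_self _).trans this.le
  · refine mul_le_mul_of_nonneg_left ?_ (Real.rpow_nonneg hη.le _)
    rw [Finset.sum_range_sub (fun k => h (u k))]
    have h1 := hh.mono (hmem n le_rfl) (Set.right_mem_Icc.2 hT) (hmem n le_rfl).2
    have h3 := hh.mono (Set.left_mem_Icc.2 hT) (hmem 0 (Nat.zero_le n)) (hmem 0 (Nat.zero_le n)).1
    linarith

theorem exists_partition_mesh {s t δ : ℝ} (hst : s ≤ t) (hδ : 0 < δ) :
    ∃ n u, IsPartitionOf s t n u ∧ ∀ k < n, u (k + 1) - u k < δ := by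
  rcases hst.eq_or_lt with rfl | hlt
  · exact ⟨0, fun _ => s, ⟨rfl, rfl, by simp⟩, by simp⟩
  obtain ⟨n, hn⟩ := exists_nat_gt ((t - s) / δ)
  have hn0 : (0 : ℝ) < n := lt_of_le_of_lt (div_nonneg (by linarith) hδ.le) hn
  have hstep : ∀ k : ℕ, (s + ((k + 1 : ℕ) : ℝ) * ((t - s) / n)) - (s + k * ((t - s) / n)) =
      (t - s) / n := fun k => by push_cast; ring
  refine ⟨n, fun k => s + k * ((t - s) / n), ⟨by simp, by field_simp; ring, fun k _ => ?_⟩,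
    fun k _ => ?_⟩
  · have : 0 < (t - s) / n := div_pos (by linarith) hn0
    linarith [hstep k]
  · rw [hstep, div_lt_iff₀ hn0]
    rwa [div_lt_iff₀ hδ, mul_comm] at hn

theorem HasYoungIntegral.unique {f g : ℝ → ℝ} {s t J J' : ℝ} (hst : s ≤ t)
    (h : HasYoungIntegral f g s t J) (h' : HasYoungIntegral f g s t J') : J = J' := by
  refine eq_of_forall_dist_le fun ε hε => ?_
  obtain ⟨δ, hδ, hd⟩ := h (ε / 2) (by linarith)
  obtain ⟨δ', hδ', hd'⟩ := h' (ε / 2) (by linarith)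
  obtain ⟨n, u, hu, hmesh⟩ := exists_partition_mesh hst (lt_min hδ hδ')
  have h1 := hd n u hu fun k hk => (hmesh k hk).trans_le (min_le_left _ _)
  have h2 := hd' n u hu fun k hk => (hmesh k hk).trans_le (min_le_right _ _)
  rw [abs_lt] at h1 h2
  rw [Real.dist_eq, abs_le]
  constructor <;> linarith [h1.1, h1.2, h2.1, h2.2]

/-- Young integration of paths of complementary regularity. -/
theorem exists_young {T α β : ℝ} (hT : 0 < T) {h : ℝ → ℝ} (hh : IsControl T h) (hα : 0 < α)
    (hβ : 0 < β) (hαβ : 1 < α + β) {f g : ℝ → ℝ} (hfc : ContinuousOn f (Set.Icc 0 T))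
    (hgc : ContinuousOn g (Set.Icc 0 T)) (hf : Controlled T h α fun s t => f t - f s)
    (hg : Controlled T h β fun s t => g t - g s) :
    ∃ I : ℝ → ℝ → ℝ,
      (∀ s t, 0 ≤ s → s ≤ t → t ≤ T → HasYoungIntegral (fun r => f r - f s) g s t (I s t)) ∧
      Controlled T h (α + β) I ∧ ContinuousOn (fun q : ℝ × ℝ => I q.1 q.2) (timeSimplex T) ∧
      ∀ s u t, 0 ≤ s → s ≤ u → u ≤ t → t ≤ T →
        I s t = I s u + I u t + (f u - f s) * (g t - g u) := by
  obtain ⟨C, hC, hCb⟩ := hf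
  obtain ⟨D, hD, hDb⟩ := hg
  obtain ⟨J, hJ⟩ := exists_sewing (A := fun s t => f s * (g t - g s)) hT hh hαβ (mul_nonneg hC hD)
    (fun s u t hs hsu hut ht => by
      have g1 := hh.sub_nonneg hs hsu (hut.trans ht)
      have g2 := hh.sub_nonneg (hs.trans hsu) hut ht
      rw [show f s * (g t - g s) - f s * (g u - g s) - f u * (g t - g u) =
        -((f u - f s) * (g t - g u)) by ring, abs_neg, abs_mul,
        Real.rpow_add_of_nonneg (by linarith) hα.le hβ.le, mul_mul_mul_comm]
      refine mul_le_mul ((hCb s u hs hsu (hut.trans ht)).trans ?_)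
        ((hDb u t (hs.trans hsu) hut ht).trans ?_) (abs_nonneg _)
        (mul_nonneg hC (Real.rpow_nonneg (by linarith) _))
      · exact mul_le_mul_of_nonneg_left (Real.rpow_le_rpow g1 (by linarith) hα.le) hC
      · exact mul_le_mul_of_nonneg_left (Real.rpow_le_rpow g2 (by linarith) hβ.le) hD)
  have hAc : ContinuousOn (fun q : ℝ × ℝ => f q.1 * (g q.2 - g q.1)) (timeSimplex T) :=
    (continuousOn_fst_simplex hfc).mul
      ((continuousOn_snd_simplex hgc).sub (continuousOn_fst_simplex hgc))
  have hJc := continuousOn_of_controlled hh (by linarith) hAc hJ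
  refine ⟨fun s t => J t - J s - f s * (g t - g s), ?_, hJ,
    ((continuousOn_snd_simplex hJc).sub (continuousOn_fst_simplex hJc)).sub hAc,
    fun s u t _ _ _ _ => by ring⟩
  intro s t hs hst ht ε hε
  obtain ⟨K, hK, hKb⟩ := hJ
  obtain ⟨δ, hδ, hmesh⟩ := hh.exists_mesh hT.le hαβ K hK hε
  refine ⟨δ, hδ, fun n u hu hd => lt_of_le_of_lt ?_ (hmesh s t n u hs ht hu hd)⟩
  have e1 : g t - g s = ∑ k ∈ Finset.range n, (g (u (k + 1)) - g (u k)) := by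
    rw [Finset.sum_range_sub (fun k => g (u k)), hu.1, hu.2.1]
  have e2 : J t - J s = ∑ k ∈ Finset.range n, (J (u (k + 1)) - J (u k)) := by
    rw [Finset.sum_range_sub (fun k => J (u k)), hu.1, hu.2.1]
  simp only
  rw [e1, e2, Finset.mul_sum, ← Finset.sum_sub_distrib, ← Finset.sum_sub_distrib]
  refine (Finset.abs_sum_le_sum_abs _ _).trans (Finset.sum_le_sum fun k hk => ?_)
  have hk := Finset.mem_range.1 hk
  rw [abs_sub_comm]
  refine le_trans (le_of_eq ?_) (hKb (u k) (u (k + 1)) (hs.trans (hu.mem hk.le).1)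
    (hu.2.2 k hk).le ((hu.mem (Nat.succ_le_iff.2 hk)).2.trans ht))
  congr 1
  ring

/-! ### The extended path and its canonical second level -/

section Extended

variable {d : ℕ} {p T : ℝ} {X : ℝ → Fin d → ℝ} {X2 : ℝ → ℝ → Matrix (Fin d) (Fin d) ℝ}

/-- Not both letters are coordinates of the path. -/
def IsYoungPair (a b : ExtIndex d) : Prop := ¬ ((∃ i, a = .path i) ∧ ∃ j, b = .path j)

theorem IsYoungPair.symm {a b : ExtIndex d} (h : IsYoungPair a b) : IsYoungPair b a :=
  fun h' => h ⟨h'.2, h'.1⟩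

theorem IsRoughPath.continuousOn_extPath (hX : IsRoughPath p T X X2) (a : ExtIndex d) :
    ContinuousOn (fun t => extPath X X2 t a) (Set.Icc 0 T) := by
  cases a with
  | time => exact continuousOn_id
  | path i => exact hX.continuousOn_apply i
  | bracket q => exact hX.continuousOn_roughBracket q.1.1 q.1.2

/-- A control for a rough path, the extended path, and the Young integrals of the extended path. -/
structure IsExtControl (p T : ℝ) (X : ℝ → Fin d → ℝ) (X2 : ℝ → ℝ → Matrix (Fin d) (Fin d) ℝ)
    (h : ℝ → ℝ) : Prop where
  control : IsControl T h
  path : ∀ a, Controlled T h (1 / p) fun s t => extPath X X2 t a - extPath X X2 s a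
  smooth : ∀ a : ExtIndex d, (¬ ∃ i, a = .path i) →
    Controlled T h (2 / p) fun s t => extPath X X2 t a - extPath X X2 s a
  lift : ∀ i j, Controlled T h (2 / p) fun s t => X2 s t i j

/-- Adding `t` to the control of the rough path accommodates the time coordinate, whose exponent `1`
is at least `2 / p` because `2 < p`. The bracket increments are quadratic in the rough path, hence
of order `2 / p`. -/
theorem IsRoughPath.exists_isExtControl (hX : IsRoughPath p T X X2) (hp : 2 < p) (hT : 0 ≤ T) :
    ∃ h, IsExtControl p T X X2 h := by
  have hp0 : 0 < p := by linarith
  obtain ⟨h₀, hh₀, h1, h2⟩ := hX.exists_control hp0 hT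
  have hid : IsControl T fun t => t := ⟨monotoneOn_id, continuousOn_id⟩
  have hh := hh₀.add hid
  have hle : 1 / p ≤ 2 / p := by gcongr; norm_num
  have hpath : ∀ i, Controlled T (fun t => h₀ t + t) (1 / p) fun s t => X t i - X s i :=
    fun i => (h1 i).add_left hh₀ hid (by positivity)
  have hlift : ∀ i j, Controlled T (fun t => h₀ t + t) (2 / p) fun s t => X2 s t i j :=
    fun i j => (h2 i j).add_left hh₀ hid (by positivity)
  have hsmooth : ∀ a : ExtIndex d, (¬ ∃ i, a = .path i) →
      Controlled T (fun t => h₀ t + t) (2 / p) fun s t => extPath X X2 t a - extPath X X2 s a := by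
    intro a ha
    cases a with
    | time =>
      have h3 : Controlled T (fun t => t) 1 fun s t => t - s :=
        ⟨1, zero_le_one, fun s t _ hst _ => by simp [abs_of_nonneg (sub_nonneg.2 hst)]⟩
      exact (h3.mono_exponent hid (by positivity) (by rw [div_le_one hp0]; exact hp.le)).add_right
        hh₀ hid (by positivity)
    | path i => exact absurd ⟨i, rfl⟩ ha
    | bracket q => exact hX.controlled_roughBracket hp0 hh hpath hlift _ _
  refine ⟨_, hh, fun a => ?_, hsmooth, hlift⟩
  by_cases ha : ∃ i, a = .path i
  · obtain ⟨i, rfl⟩ := ha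
    exact hpath i
  · exact (hsmooth a ha).mono_exponent hh (by positivity) hle

/-- In a Young pair at least one coordinate has order `2 / p`; using only `1 / p` for the other
gives `3 / p > 1` in all cases. -/
theorem IsRoughPath.exists_young_extPath (hX : IsRoughPath p T X X2) (hp : 2 < p) (hp3 : p < 3)
    (hT : 0 < T) {h : ℝ → ℝ} (hh : IsExtControl p T X X2 h) {a b : ExtIndex d}
    (hab : IsYoungPair a b) :
    ∃ I : ℝ → ℝ → ℝ,
      (∀ s t, 0 ≤ s → s ≤ t → t ≤ T → HasYoungIntegral
        (fun r => extPath X X2 r a - extPath X X2 s a) (fun r => extPath X X2 r b) s t (I s t)) ∧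
      Controlled T h (3 / p) I ∧ ContinuousOn (fun q : ℝ × ℝ => I q.1 q.2) (timeSimplex T) ∧
      ∀ s u t, 0 ≤ s → s ≤ u → u ≤ t → t ≤ T →
        I s t = I s u + I u t +
          (extPath X X2 u a - extPath X X2 s a) * (extPath X X2 t b - extPath X X2 u b) := by
  have hp0 : 0 < p := by linarith
  have h3 : 1 < 3 / p := by rw [lt_div_iff₀ hp0]; linarith
  by_cases ha : ∃ i, a = .path i
  · have hb : ¬ ∃ j, b = .path j := fun hb => hab ⟨ha, hb⟩
    have e : 1 / p + 2 / p = 3 / p := by rw [← add_div]; norm_num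
    have := exists_young hT hh.control (by positivity) (by positivity) (by rw [e]; exact h3)
      (hX.continuousOn_extPath a) (hX.continuousOn_extPath b) (hh.path a) (hh.smooth b hb)
    rwa [e] at this
  · have e : 2 / p + 1 / p = 3 / p := by rw [← add_div]; norm_num
    have := exists_young hT hh.control (by positivity) (by positivity) (by rw [e]; exact h3)
      (hX.continuousOn_extPath a) (hX.continuousOn_extPath b) (hh.smooth a ha) (hh.path b)
    rwa [e] at this

theorem IsRoughPath.exists_isCanonicalLift (hX : IsRoughPath p T X X2) (hp : 2 < p) (hp3 : p < 3)
    (hT : 0 < T) : ∃ Y2, IsCanonicalLift T X X2 Y2 := by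
  classical
  obtain ⟨h, hh⟩ := hX.exists_isExtControl hp hT.le
  have hI : ∀ a b : ExtIndex d, ∃ I : ℝ → ℝ → ℝ, IsYoungPair a b →
      ∀ s t, 0 ≤ s → s ≤ t → t ≤ T → HasYoungIntegral
        (fun r => extPath X X2 r a - extPath X X2 s a) (fun r => extPath X X2 r b) s t (I s t) := by
    intro a b
    by_cases hab : IsYoungPair a b
    · obtain ⟨I, hI, -⟩ := hX.exists_young_extPath hp hp3 hT hh hab
      exact ⟨I, fun _ => hI⟩
    · exact ⟨0, fun h' => absurd h' hab⟩
  choose I hI using hI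
  refine ⟨fun s t => Matrix.of fun a b => match a, b with
    | .path i, .path j => X2 s t i j
    | a, b => I a b s t, fun s t _ _ _ i j => rfl, fun s t hs hst ht a b hab => ?_⟩
  have := hI a b hab s t hs hst ht
  cases a <;> cases b <;> first | exact this | exact absurd ⟨⟨_, rfl⟩, ⟨_, rfl⟩⟩ hab

variable {Y2 : ℝ → ℝ → Matrix (ExtIndex d) (ExtIndex d) ℝ}

/-- Young integrals are unique, so any canonical lift inherits the estimates and Chen's relation of
the sewn integral. -/
theorem IsCanonicalLift.young_pair (hY : IsCanonicalLift T X X2 Y2) (hX : IsRoughPath p T X X2)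
    (hp : 2 < p) (hp3 : p < 3) (hT : 0 < T) {h : ℝ → ℝ} (hh : IsExtControl p T X X2 h)
    {a b : ExtIndex d} (hab : IsYoungPair a b) :
    Controlled T h (3 / p) (fun s t => Y2 s t a b) ∧
      ContinuousOn (fun q : ℝ × ℝ => Y2 q.1 q.2 a b) (timeSimplex T) ∧
      ∀ s u t, 0 ≤ s → s ≤ u → u ≤ t → t ≤ T →
        Y2 s t a b = Y2 s u a b + Y2 u t a b +
          (extPath X X2 u a - extPath X X2 s a) * (extPath X X2 t b - extPath X X2 u b) := by
  obtain ⟨I, hI, h1, h2, h3⟩ := hX.exists_young_extPath hp hp3 hT hh hab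
  have e : ∀ s t, 0 ≤ s → s ≤ t → t ≤ T → Y2 s t a b = I s t := fun s t hs hst ht =>
    (hY.young s t hs hst ht a b hab).unique hst (hI s t hs hst ht)
  refine ⟨h1.congr e, h2.congr fun q hq => e q.1 q.2 hq.1 hq.2.1 hq.2.2,
    fun s u t hs hsu hut ht => ?_⟩
  rw [e s t hs (hsu.trans hut) ht, e s u hs hsu (hut.trans ht), e u t (hs.trans hsu) hut ht]
  exact h3 s u t hs hsu hut ht

theorem IsCanonicalLift.isRoughPath (hY : IsCanonicalLift T X X2 Y2) (hX : IsRoughPath p T X X2)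
    (hp : 2 < p) (hp3 : p < 3) (hT : 0 < T) : IsRoughPath p T (extPath X X2) Y2 := by
  have hp0 : 0 < p := by linarith
  obtain ⟨h, hh⟩ := hX.exists_isExtControl hp hT.le
  refine .of_controlled hp0 hh.control hX.continuousOn_extPath hh.path (fun a b => ?_)
    (fun a b => ?_) fun s u t hs hsu hut ht a b => ?_
  all_goals by_cases hab : IsYoungPair a b
  · exact (hY.young_pair hX hp hp3 hT hh hab).2.1
  · obtain ⟨⟨i, rfl⟩, j, rfl⟩ := not_not.1 hab
    exact (hX.continuousOn_lift_apply i j).congr fun q hq =>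
      hY.path_path q.1 q.2 hq.1 hq.2.1 hq.2.2 i j
  · exact (hY.young_pair hX hp hp3 hT hh hab).1.mono_exponent hh.control (by positivity)
      (by gcongr; norm_num)
  · obtain ⟨⟨i, rfl⟩, j, rfl⟩ := not_not.1 hab
    exact (hh.lift i j).congr fun s t hs hst ht => hY.path_path s t hs hst ht i j
  · exact (hY.young_pair hX hp hp3 hT hh hab).2.2 s u t hs hsu hut ht
  · obtain ⟨⟨i, rfl⟩, j, rfl⟩ := not_not.1 hab
    rw [hY.path_path s t hs (hsu.trans hut) ht, hY.path_path s u hs hsu (hut.trans ht),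
      hY.path_path u t (hs.trans hsu) hut ht]
    exact hX.chen s u t hs hsu hut ht i j

/-- Integration by parts for Young integrals: the bracket has no component on Young pairs. -/
theorem IsCanonicalLift.roughBracket_eq_zero (hY : IsCanonicalLift T X X2 Y2)
    (hX : IsRoughPath p T X X2) (hp : 2 < p) (hp3 : p < 3) (hT : 0 < T) {a b : ExtIndex d}
    (hab : IsYoungPair a b) {t : ℝ} (ht : t ∈ Set.Icc 0 T) :
    roughBracket (extPath X X2) Y2 t a b = 0 := by
  have hp0 : 0 < p := by linarith
  obtain ⟨h, hh⟩ := hX.exists_isExtControl hp hT.le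
  -- The product of increments has the same order `3 / p` as the two integrals. The defect of
  -- integration by parts is additive and hence vanishes.
  have hprod : Controlled T h (3 / p) fun s t =>
      (extPath X X2 t a - extPath X X2 s a) * (extPath X X2 t b - extPath X X2 s b) := by
    by_cases ha : ∃ i, a = .path i
    · have := (hh.path a).mul hh.control (by positivity) (by positivity)
        (hh.smooth b fun hb => hab ⟨ha, hb⟩)
      rwa [← add_div, show (1 : ℝ) + 2 = 3 by norm_num] at this
    · have := (hh.smooth a ha).mul hh.control (by positivity) (by positivity) (hh.path b)
      rwa [← add_div, show (2 : ℝ) + 1 = 3 by norm_num] at this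
  obtain ⟨b1, -, c1⟩ := hY.young_pair hX hp hp3 hT hh hab
  obtain ⟨b2, -, c2⟩ := hY.young_pair hX hp hp3 hT hh hab.symm
  rw [roughBracket_apply]
  refine (hprod.sub (b1.add b2)).eq_zero hh.control (by rw [lt_div_iff₀ hp0]; linarith)
    (fun s u t hs hsu hut ht => ?_) le_rfl ht.1 ht.2
  rw [c1 s u t hs hsu hut ht, c2 s u t hs hsu hut ht]
  ring

theorem IsCanonicalLift.roughBracket_path (hY : IsCanonicalLift T X X2 Y2) {t : ℝ}
    (ht : t ∈ Set.Icc 0 T) (i j : Fin d) :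
    roughBracket (extPath X X2) Y2 t (.path i) (.path j) = roughBracket X X2 t i j := by
  rw [roughBracket_apply, roughBracket_apply, hY.path_path 0 t le_rfl ht.1 ht.2,
    hY.path_path 0 t le_rfl ht.1 ht.2]
  rfl

end Extended

/-! ### The pairing with the coefficients `ℓ^I` -/

section Pairing

variable {ι : Type}

theorem tensorPairing_basisTensor (w : List ι) (a : TensorSeries ι) :
    tensorPairing (basisTensor w) a = a w := by
  rw [tensorPairing, basisTensor, MonoidAlgebra.coeff_single, Finsupp.sum_single_index (by simp)]
  simp

theorem tensorPairing_add (l m : TensorPoly ι) (a : TensorSeries ι) :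
    tensorPairing (l + m) a = tensorPairing l a + tensorPairing m a := by
  rw [tensorPairing, MonoidAlgebra.coeff_add]
  exact Finsupp.sum_add_index' (by simp) fun _ _ _ => add_mul _ _ _

theorem tensorPairing_smul (c : ℝ) (l : TensorPoly ι) (a : TensorSeries ι) :
    tensorPairing (c • l) a = c * tensorPairing l a := by
  rw [tensorPairing, MonoidAlgebra.coeff_smul, Finsupp.sum_smul_index' (by simp), tensorPairing,
    Finsupp.mul_sum]
  simp [mul_assoc]

theorem tensorPairing_zero (a : TensorSeries ι) : tensorPairing (0 : TensorPoly ι) a = 0 := by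
  simp [tensorPairing]

theorem tensorPairing_sub (l m : TensorPoly ι) (a : TensorSeries ι) :
    tensorPairing (l - m) a = tensorPairing l a - tensorPairing m a := by
  rw [sub_eq_add_neg, ← neg_one_smul ℝ m, tensorPairing_add, tensorPairing_smul]
  ring

theorem tensorPairing_mul_add (l : TensorPoly ι) (c : ℝ) (a b : TensorSeries ι) :
    tensorPairing l (fun w => a w * c + b w) = tensorPairing l a * c + tensorPairing l b := by
  simp only [tensorPairing, Finsupp.sum, mul_add, Finset.sum_add_distrib, Finset.sum_mul, mul_assoc]

theorem tensorPairing_mul_basisTensor (l : TensorPoly ι) (x : ι) (a : TensorSeries ι) :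
    tensorPairing (l * basisTensor [x]) a = tensorPairing l fun w => a (w ++ [x]) := by
  induction l using MonoidAlgebra.induction_linear with
  | zero => simp [tensorPairing_zero]
  | add l m hl hm => rw [add_mul, tensorPairing_add, tensorPairing_add, hl, hm]
  | single w c =>
    rw [basisTensor, MonoidAlgebra.single_mul_single, mul_one, tensorPairing, tensorPairing,
      MonoidAlgebra.coeff_single, MonoidAlgebra.coeff_single, Finsupp.sum_single_index (by simp),
      Finsupp.sum_single_index (by simp)]
    rfl

theorem tensorPairing_mul_basisTensor_tmul (l : TensorPoly ι) (x : ι) (a b : TensorSeries ι) :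
    tensorPairing (l * basisTensor [x]) (tmul a b) =
      tensorPairing (l * basisTensor [x]) a * b [] +
        tensorPairing l (tmul a fun w => b (w ++ [x])) := by
  rw [tensorPairing_mul_basisTensor, tensorPairing_mul_basisTensor, ← tensorPairing_mul_add]
  simp only [tmul_concat]

end Pairing

/-! ### The coefficients `ℓ^I`: multiplicativity of the transpose and homogeneity. -/

section Ell

variable {d : ℕ}

theorem epsTensor_of_isYoungPair {a b : ExtIndex d} (hab : IsYoungPair a b) :
    epsTensor a b = 0 := by
  cases a <;> cases b <;> first | rfl | exact absurd ⟨⟨_, rfl⟩, ⟨_, rfl⟩⟩ hab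

/-- Writing `ε` as a multiple of one letter lets all pairs be treated alike; for Young pairs the
letter `.time` is a dummy with coefficient zero. -/
theorem exists_epsTensor_eq (a b : ExtIndex d) :
    ∃ (c : ℝ) (z : ExtIndex d), epsTensor a b = c • basisTensor [z] := by
  cases a <;> cases b <;>
    first | exact ⟨0, .time, (zero_smul ℝ _).symm⟩ | exact ⟨1, _, (one_smul ℝ _).symm⟩

/-- The transpose of `e_I ↦ ℓ^I`. -/
noncomputable def ellTranspose (a : TensorSeries (ExtIndex d)) : TensorSeries (ExtIndex d) :=
  fun I => tensorPairing (ellCoeff I) a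

theorem ellTranspose_nil (a : TensorSeries (ExtIndex d)) : ellTranspose a [] = a [] := by
  rw [ellTranspose, ellCoeff_nil, tensorPairing_basisTensor]

theorem ellTranspose_singleton (a : TensorSeries (ExtIndex d)) (x : ExtIndex d) :
    ellTranspose a [x] = a [x] := by
  rw [ellTranspose, ellCoeff_singleton, tensorPairing_basisTensor]

theorem List.eq_append_pair {ι : Type*} {w : List ι} {n : ℕ} (hw : w.length = n + 2) :
    ∃ v x y, w = v ++ [x, y] := by
  induction n generalizing w with
  | zero =>
    obtain ⟨x, y, rfl⟩ := List.length_eq_two.1 hw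
    exact ⟨[], x, y, rfl⟩
  | succ n ih =>
    obtain ⟨z, w, rfl⟩ := List.exists_cons_of_length_eq_add_one hw
    obtain ⟨v, x, y, rfl⟩ := ih (w := w) (by simpa using hw)
    exact ⟨z :: v, x, y, rfl⟩

/-- The transpose of `e_I ↦ ℓ^I` is multiplicative. -/
theorem ellTranspose_tmul (n : ℕ) : ∀ (I : List (ExtIndex d)), I.length = n →
    ∀ a b : TensorSeries (ExtIndex d),
      ellTranspose (tmul a b) I = tmul (ellTranspose a) (ellTranspose b) I := by
  induction n using Nat.strong_induction_on with
  | _ n ih =>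
  intro I hI a b
  match n, ih, hI with
  | 0, _, hI =>
    obtain rfl := List.eq_nil_of_length_eq_zero hI
    rw [ellTranspose_nil, tmul_nil, tmul_nil, ellTranspose_nil, ellTranspose_nil]
  | 1, _, hI =>
    obtain ⟨x, rfl⟩ := List.length_eq_one_iff.1 hI
    simp only [ellTranspose_singleton, tmul_cons, tmul_nil, ellTranspose_nil]
  | n + 2, ih, hI =>
    obtain ⟨J, x, y, rfl⟩ := List.eq_append_pair hI
    obtain ⟨c, z, hz⟩ := exists_epsTensor_eq x y
    have hrec : ∀ (v : List (ExtIndex d)) (g : TensorSeries (ExtIndex d)),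
        ellTranspose g (v ++ [x] ++ [y]) = tensorPairing (ellCoeff (v ++ [x]) * basisTensor [y]) g +
          -(1 / 2 * c) * tensorPairing (ellCoeff v * basisTensor [z]) g := by
      intro v g
      rw [ellTranspose, List.append_assoc, List.singleton_append, ellCoeff_append,
        tensorPairing_sub, tensorPairing_smul, hz, mul_smul_comm, tensorPairing_smul]
      ring
    have hl : J.length = n := by simpa using hI
    -- The recursion for `ℓ` acts at the end of the word, so the last letter, `y` or `z`, is moved
    -- into `b` and the induction hypothesis is applied to the shifted series. Splittings that
    -- separate `x` from `y` or leave `b` empty are matched by hand.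
    have i1 := ih (n + 1) (by omega) (J ++ [x]) (by simp [hl]) a (fun w => b (w ++ [y]))
    have i2 := ih n (by omega) J hl a (fun w => b (w ++ [z]))
    rw [show J ++ [x, y] = J ++ [x] ++ [y] by simp, tmul_concat, tmul_concat, hrec J, hrec J]
    simp only [hrec]
    rw [tmul_add, tmul_smul, tensorPairing_mul_basisTensor_tmul, tensorPairing_mul_basisTensor_tmul]
    simp only [tensorPairing_mul_basisTensor _ _ b]
    simp only [ellTranspose] at i1 i2
    rw [i1, i2, tmul_concat]
    have e1 := ellTranspose_nil b
    have e2 := ellTranspose_singleton b y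
    have e3 := ellTranspose_nil fun w => b (w ++ [y])
    simp only [ellTranspose, List.nil_append] at e1 e2 e3 ⊢
    rw [e1, e2, e3, show (ellTranspose fun w => b (w ++ [z])) = fun v => tensorPairing (ellCoeff v)
      fun w => b (w ++ [z]) from rfl]
    ring

/-- The homogeneity of a word, where the bracket letters count twice. -/
def wordWeight (w : List (ExtIndex d)) : ℕ :=
  (w.map fun a => match a with
    | .bracket _ => 2
    | _ => 1).sum

theorem wordWeight_le (w : List (ExtIndex d)) : wordWeight w ≤ 2 * w.length := by
  induction w with
  | nil => simp [wordWeight]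
  | cons a w ih =>
    simp only [wordWeight, List.map_cons, List.sum_cons, List.length_cons] at ih ⊢
    cases a <;> simp only <;> omega

theorem wordWeight_append (v w : List (ExtIndex d)) :
    wordWeight (v ++ w) = wordWeight v + wordWeight w := by
  simp [wordWeight]

/-- The tensors of homogeneity at least `n` and of degree at most `n`. -/
noncomputable def weightSpan (d n : ℕ) : Submodule ℝ (TensorPoly (ExtIndex d)) :=
  Submodule.span ℝ {l | ∃ w, l = basisTensor w ∧ n ≤ wordWeight w ∧ w.length ≤ n}

theorem mul_basisTensor_mem_weightSpan {n k : ℕ} {l : TensorPoly (ExtIndex d)}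
    (hl : l ∈ weightSpan d n) {x : ExtIndex d} (hk : k ≤ wordWeight [x]) (hk1 : 1 ≤ k) :
    l * basisTensor [x] ∈ weightSpan d (n + k) := by
  refine Submodule.span_induction (p := fun l _ => l * basisTensor [x] ∈ weightSpan d (n + k))
    ?_ ?_ ?_ ?_ hl
  · rintro _ ⟨w, rfl, h1, h2⟩
    refine Submodule.subset_span ⟨w ++ [x], ?_, ?_, ?_⟩
    · rw [basisTensor, basisTensor, MonoidAlgebra.single_mul_single, mul_one]
      rfl
    · rw [wordWeight_append]; omega
    · simp; omega
  · simp
  · intro a b _ _ h1 h2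
    rw [add_mul]
    exact add_mem h1 h2
  · intro c a _ h1
    rw [smul_mul_assoc]
    exact Submodule.smul_mem _ _ h1

theorem one_le_wordWeight_singleton (x : ExtIndex d) : 1 ≤ wordWeight [x] := by
  cases x <;> simp [wordWeight]

/-- Each correction trades two path letters for one bracket letter of weight two: the weight does
not drop and the length does not grow. The weight yields decay, and the length keeps all words under
one control. -/
theorem ellCoeff_mem_weightSpan (n : ℕ) : ∀ (I : List (ExtIndex d)), I.length = n →
    ellCoeff I ∈ weightSpan d n := by
  induction n using Nat.strong_induction_on with
  | _ n ih =>
  intro I hI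
  match n, ih, hI with
  | 0, _, hI =>
    obtain rfl := List.eq_nil_of_length_eq_zero hI
    exact Submodule.subset_span ⟨[], ellCoeff_nil, by simp, by simp⟩
  | 1, _, hI =>
    obtain ⟨x, rfl⟩ := List.length_eq_one_iff.1 hI
    exact Submodule.subset_span ⟨[x], ellCoeff_singleton x, one_le_wordWeight_singleton x, by simp⟩
  | n + 2, ih, hI =>
    obtain ⟨J, x, y, rfl⟩ := List.eq_append_pair hI
    have hl : J.length = n := by simpa using hI
    rw [ellCoeff_append]
    have h1 : ellCoeff (J ++ [x]) * basisTensor [y] ∈ weightSpan d (n + 2) :=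
      mul_basisTensor_mem_weightSpan (k := 1) (ih (n + 1) (by omega) (J ++ [x]) (by simp [hl]))
        (one_le_wordWeight_singleton y) le_rfl
    have h2 : ellCoeff J * epsTensor x y ∈ weightSpan d (n + 2) := by
      by_cases hxy : IsYoungPair x y
      · rw [epsTensor_of_isYoungPair hxy, mul_zero]
        exact zero_mem _
      · obtain ⟨⟨i, rfl⟩, j, rfl⟩ := not_not.1 hxy
        exact mul_basisTensor_mem_weightSpan (k := 2) (ih n (by omega) J hl) (by simp [wordWeight])
          (by norm_num)
    exact Submodule.sub_mem _ h1 (Submodule.smul_mem _ _ h2)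

end Ell

/-! ### Identification of the two Lyons extensions. -/

section Main

variable {d : ℕ} {p T : ℝ} {X : ℝ → Fin d → ℝ} {X2 : ℝ → ℝ → Matrix (Fin d) (Fin d) ℝ}
  {Y2 : ℝ → ℝ → Matrix (ExtIndex d) (ExtIndex d) ℝ}
  {S So : ℝ → ℝ → TensorSeries (ExtIndex d)}

theorem correctedLift_young_pair (hY : IsCanonicalLift T X X2 Y2) (hX : IsRoughPath p T X X2)
    (hp : 2 < p) (hp3 : p < 3) (hT : 0 < T) {a b : ExtIndex d} (hab : IsYoungPair a b) {s t : ℝ}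
    (hs : 0 ≤ s) (hst : s ≤ t) (ht : t ≤ T) :
    correctedLift (extPath X X2) Y2 s t a b = Y2 s t a b := by
  rw [correctedLift_apply, hY.roughBracket_eq_zero hX hp hp3 hT hab ⟨hs.trans hst, ht⟩,
    hY.roughBracket_eq_zero hX hp hp3 hT hab ⟨hs, hst.trans ht⟩]
  ring

theorem tensorPairing_epsTensor (hY : IsCanonicalLift T X X2 Y2) (hX : IsRoughPath p T X X2)
    (hp : 2 < p) (hp3 : p < 3) (hT : 0 < T)
    (hSo : IsLyonsExtension p T (extPath X X2) (correctedLift (extPath X X2) Y2) So)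
    (a b : ExtIndex d) {s t : ℝ} (hs : 0 ≤ s) (hst : s ≤ t) (ht : t ≤ T) :
    tensorPairing (epsTensor a b) (So s t) =
      roughBracket (extPath X X2) Y2 t a b - roughBracket (extPath X X2) Y2 s a b := by
  have ht' : t ∈ Set.Icc 0 T := ⟨hs.trans hst, ht⟩
  have hs' : s ∈ Set.Icc 0 T := ⟨hs, hst.trans ht⟩
  by_cases hab : IsYoungPair a b
  · rw [epsTensor_of_isYoungPair hab, tensorPairing_zero, hY.roughBracket_eq_zero hX hp hp3 hT hab ht',
      hY.roughBracket_eq_zero hX hp hp3 hT hab hs', sub_zero]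
  · obtain ⟨⟨i, rfl⟩, j, rfl⟩ := not_not.1 hab
    rw [epsTensor, tensorPairing_basisTensor, hSo.level_one s t hs hst ht,
      hY.roughBracket_path ht', hY.roughBracket_path hs']
    simp only [extPath]
    rcases le_total i j with hij | hij
    · rw [min_eq_left hij, max_eq_right hij]
    · rw [min_eq_right hij, max_eq_left hij, roughBracket_symm t, roughBracket_symm s]

/-- The Lyons extension of the canonical lift is the transform of the one of the corrected lift. -/
theorem lyonsExtension_eq_ellTranspose (hY : IsCanonicalLift T X X2 Y2)
    (hX : IsRoughPath p T X X2) (hp : 2 < p) (hp3 : p < 3) (hT : 0 < T)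
    (hS : IsLyonsExtension p T (extPath X X2) Y2 S)
    (hSo : IsLyonsExtension p T (extPath X X2) (correctedLift (extPath X X2) Y2) So) (n : ℕ) :
    ∀ I : List (ExtIndex d), I.length = n → ∀ s t : ℝ, 0 ≤ s → s ≤ t → t ≤ T →
      S s t I = ellTranspose (So s t) I := by
  have hp0 : 0 < p := by linarith
  induction n using Nat.strong_induction_on with
  | _ n ih =>
  intro I hI s t hs hst ht
  match n, ih, hI with
  | 0, _, hI =>
    obtain rfl := List.eq_nil_of_length_eq_zero hI
    rw [ellTranspose_nil, hS.level_zero s t hs hst ht, hSo.level_zero s t hs hst ht]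
  | 1, _, hI =>
    obtain ⟨x, rfl⟩ := List.length_eq_one_iff.1 hI
    rw [ellTranspose_singleton, hS.level_one s t hs hst ht, hSo.level_one s t hs hst ht]
  | 2, _, hI =>
    obtain ⟨a, b, rfl⟩ := List.length_eq_two.1 hI
    have h1 := ellCoeff_append [] a b
    rw [List.nil_append, List.nil_append, ellCoeff_singleton, ellCoeff_nil,
      show (basisTensor [] : TensorPoly (ExtIndex d)) = 1 from rfl, one_mul] at h1
    rw [ellTranspose, h1, tensorPairing_sub, tensorPairing_smul, tensorPairing_mul_basisTensor,
      tensorPairing_basisTensor, tensorPairing_epsTensor hY hX hp hp3 hT hSo a b hs hst ht,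
      List.singleton_append, hS.level_two s t hs hst ht, hSo.level_two s t hs hst ht,
      correctedLift_apply]
    ring
  | n + 3, ih, hI =>
    obtain ⟨h₁, hh₁, hb₁⟩ := hS.exists_control hp0 hT.le (n + 3)
    obtain ⟨h₂, hh₂, hb₂⟩ := hSo.exists_control hp0 hT.le (n + 3)
    obtain ⟨h₃, hh₃⟩ := hX.exists_isExtControl hp hT.le
    have hh₁₂ := hh₁.add hh₂
    have hh := hh₁₂.add hh₃.control
    have hexp : ∀ w : List (ExtIndex d), 3 ≤ w.length → (3 : ℝ) / p ≤ w.length / p := fun w hw => by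
      gcongr; exact_mod_cast hw
    have hSb : Controlled T (fun t => h₁ t + h₂ t + h₃ t) (3 / p) fun s t => S s t I :=
      (((hb₁ I (by rintro rfl; simp at hI) hI.le).add_left hh₁ hh₂ (by positivity)).add_left
        hh₁₂ hh₃.control (by positivity)).mono_exponent hh (by positivity) (hexp I (by omega))
    -- Weight at least three excludes words of length below two and forces a two-letter word to be a
    -- Young pair. Its coefficient is an uncorrected Young integral of order `3 / p`, better than
    -- the `2 / p` of a general second level.
    have hword : ∀ w : List (ExtIndex d), n + 3 ≤ wordWeight w → w.length ≤ n + 3 →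
        Controlled T (fun t => h₁ t + h₂ t + h₃ t) (3 / p) fun s t => So s t w := by
      intro w hw hlen
      have hw2 := wordWeight_le w
      rcases Nat.lt_or_ge w.length 3 with hlt | hge
      · obtain ⟨a, b, rfl⟩ := List.length_eq_two.1 (show w.length = 2 by omega)
        have hab : IsYoungPair a b := by
          rintro ⟨⟨i, rfl⟩, j, rfl⟩
          simp [wordWeight] at hw
        exact ((hY.young_pair hX hp hp3 hT hh₃ hab).1.add_right hh₁₂ hh₃.control
          (by positivity)).congr fun s t hs hst ht => by
            rw [hSo.level_two s t hs hst ht, correctedLift_young_pair hY hX hp hp3 hT hab hs hst ht]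
      · exact (((hb₂ w (by rintro rfl; simp at hge) hlen).add_right hh₁ hh₂
          (by positivity)).add_left hh₁₂ hh₃.control (by positivity)).mono_exponent hh
          (by positivity) (hexp w hge)
    have hpair : ∀ l ∈ weightSpan d (n + 3),
        Controlled T (fun t => h₁ t + h₂ t + h₃ t) (3 / p) fun s t => tensorPairing l (So s t) := by
      intro l hl
      refine Submodule.span_induction (p := fun l _ =>
        Controlled T (fun t => h₁ t + h₂ t + h₃ t) (3 / p) fun s t => tensorPairing l (So s t))
        ?_ ?_ ?_ ?_ hl
      · rintro _ ⟨w, rfl, h1, h2⟩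
        simpa only [tensorPairing_basisTensor] using hword w h1 h2
      · simpa only [tensorPairing_zero] using Controlled.zero
      · intro l m _ _ h1 h2
        simpa only [tensorPairing_add] using h1.add h2
      · intro c l _ h1
        simpa only [tensorPairing_smul] using h1.const_mul c
    have hdiff := hSb.sub (hpair _ (ellCoeff_mem_weightSpan (n + 3) I hI))
    refine sub_eq_zero.1 (hdiff.eq_zero hh (by rw [lt_div_iff₀ hp0]; linarith)
      (fun s u t hs hsu hut ht => ?_) hs hst ht)
    change S s t I - ellTranspose (So s t) I = (S s u I - ellTranspose (So s u) I) +
      (S u t I - ellTranspose (So u t) I)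
    rw [hS.chen s u t hs hsu hut ht, hSo.chen s u t hs hsu hut ht, ellTranspose_tmul _ I hI]
    -- The two factors are exchanged one after the other; lower levels agree by induction, so each
    -- exchange costs just the top-level difference on its subinterval.
    have e1 := tmul_sub_tmul_left (a := S s u) (a' := ellTranspose (So s u)) (b := S u t) (w := I)
      fun v hv => ih v.length (by omega) v rfl s u hs hsu (hut.trans ht)
    have e2 := tmul_sub_tmul_right (a := ellTranspose (So s u)) (b := S u t)
      (b' := ellTranspose (So u t)) (w := I)
      fun v hv => ih v.length (by omega) v rfl u t (hs.trans hsu) hut ht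
    rw [hS.level_zero u t (hs.trans hsu) hut ht] at e1
    rw [ellTranspose_nil, hSo.level_zero s u hs hsu (hut.trans ht)] at e2
    linarith

end Main

theorem mainTheorem3 (d : ℕ) (p T : ℝ) (hp2 : 2 < p) (hp3 : p < 3) (hT : 0 < T)
    (X : ℝ → Fin d → ℝ) (X2 : ℝ → ℝ → Matrix (Fin d) (Fin d) ℝ) (hX : IsRoughPath p T X X2) :
    (∃ Y2, IsCanonicalLift T X X2 Y2) ∧
    ∀ Y2, IsCanonicalLift T X X2 Y2 →
      IsRoughPath p T (extPath X X2) Y2 ∧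
      IsWeaklyGeometric p T (extPath X X2) (correctedLift (extPath X X2) Y2) ∧
      (∃ S, IsLyonsExtension p T (extPath X X2) Y2 S) ∧
      (∃ So, IsLyonsExtension p T (extPath X X2) (correctedLift (extPath X X2) Y2) So) ∧
      ∀ S So, IsLyonsExtension p T (extPath X X2) Y2 S →
        IsLyonsExtension p T (extPath X X2) (correctedLift (extPath X X2) Y2) So →
        ∀ t ∈ Set.Icc 0 T,
          TensorSeries.IsGroupLike (So 0 t) ∧
          ∀ I : List (ExtIndex d),
            tensorPairing (basisTensor I) (S 0 t) = tensorPairing (ellCoeff I) (So 0 t) := by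
  have hp0 : 0 < p := by linarith
  refine ⟨hX.exists_isCanonicalLift hp2 hp3 hT, fun Y2 hY => ?_⟩
  have hYr := hY.isRoughPath hX hp2 hp3 hT
  refine ⟨hYr, hYr.isWeaklyGeometric_corrected hp0 hT.le, hYr.exists_lyonsExtension hp0 hp3 hT,
    (hYr.corrected hp0 hT.le).exists_lyonsExtension hp0 hp3 hT, fun S So hS hSo t ht => ⟨?_, ?_⟩⟩
  · exact (hSo.isShuffleCharacter hp0 hp3 hT.le
      (fun s t hs hst ht i j => hYr.correctedLift_symm hs hst ht i j)
      le_rfl ht.1 ht.2).isGroupLike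
  · intro I
    rw [tensorPairing_basisTensor]
    exact lyonsExtension_eq_ellTranspose hY hX hp2 hp3 hT hS hSo _ I rfl 0 t le_rfl ht.1 ht.2
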